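/- **Setting.** Fix an integer $K\ge 0$. For each $n$ let $p=p_n$ and consider the factor augmented single-index model $Y=g(\boldsymbol f^\top\boldsymbol\gamma+\boldsymbol u^\top\boldsymbol\beta,\varepsilon)$, $\boldsymbol x=\boldsymbol B\boldsymbol f+\boldsymbol u$, where $\boldsymbol f$ is $\mathbb R^K$-valued, $\boldsymbol u$ is $\mathbb R^p$-valued and uncorrelated with $\boldsymbol f$, $\varepsilon$ is independent of $(\boldsymbol f,\boldsymbol u)$, $g$ is measurable, $\mathrm{Cov}(\boldsymbol f)=\boldsymbol I_K$ and $\boldsymbol B^\top\boldsymbol B$ is diagonal (all of this may depend on $n$). Let $F$ be the distribution function of $Y$, $h(Y)=F(Y)-1/2$, $\boldsymbol\Sigma_u=\mathrm{Cov}(\boldsymbol u)$, $\boldsymbol\beta_h=\mathbb E(\boldsymbol u\boldsymbol u^\top)^{-1}\mathrm{Cov}\{\boldsymbol u,h(Y)\}$ and $s=\|\boldsymbol\beta_h\|_0$. The data $(\boldsymbol f_i,\boldsymbol u_i,Y_i)$, $i\le n$, are i.i.d. copies of $(\boldsymbol f,\boldsymbol u,Y)$; $\boldsymbol x_i=\boldsymbol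 B\boldsymbol f_i+\boldsymbol u_i$, and $\boldsymbol X=(\boldsymbol x_1,\dots,\boldsymbol x_n)^\top$. **Assumptions.** With constants $c_0,\Upsilon>0$, $\tau>1$, $0<\kappa<1$ not depending on $n$: 1. $\|\boldsymbol f\|_{\psi_2},\|\boldsymbol u\|_{\psi_2}\le c_0$ and $\mathbb E\boldsymbol f=\boldsymbol 0$, $\mathbb E\boldsymbol u=\boldsymbol 0$; all eigenvalues of $\boldsymbol B^\top\boldsymbol B$ lie in $[p/\tau,p\tau]$; $\|\boldsymbol B\|_{\max}\le\Upsilon$ and $\mathbb E|\boldsymbol u^\top\boldsymbol u-\mathrm{tr}\,\boldsymbol\Sigma_u|^4\le\Upsilon p^2$; all eigenvalues of $\boldsymbol\Sigma_u$ lie in $[\kappa,1/\kappa]$, $\|\boldsymbol\Sigma_u\|_1\le 1/\kappa$ (maximal absolute column sum), and $\mathrm{Var}(u_ku_l)\ge\kappa$ for all $k,l\le p$. Here $\|X\|_{\psi_2}=\inf\{c>0:\mathbb E e^{X^2/c^2}\le 2\}$ for a random variable and $\|\boldsymbol x\|_{\psi_2}=\sup_{\|\boldsymbol c\|_2=1}\|\boldsymbol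 c^\top\boldsymbol x\|_{\psi_2}$ for a random vector. 2. There are pilot estimators $\hat{\boldsymbol\Sigma}$, $\hat{\boldsymbol\Lambda}$ (diagonal), $\hat{\boldsymbol\Gamma}$ of $\boldsymbol\Sigma=\mathrm{Cov}(\boldsymbol x)$, of the diagonal matrix $\boldsymbol\Lambda$ of its $K$ leading eigenvalues and of a matrix $\boldsymbol\Gamma$ of corresponding orthonormal eigenvectors, with $\|\hat{\boldsymbol\Sigma}-\boldsymbol\Sigma\|_{\max}=O_{\mathbb P}(\sqrt{\log p/n})$, $\|(\hat{\boldsymbol\Lambda}-\boldsymbol\Lambda)\hat{\boldsymbol\Lambda}^{-1}\|_{\max}=O_{\mathbb P}(\sqrt{\log p/n})$ and $\|\hat{\boldsymbol\Gamma}-\boldsymbol\Gamma\|_{\max}=O_{\mathbb P}(\sqrt{\log p/(np)})$. 3. (Linearity condition) With $\boldsymbol v=(\boldsymbol u^\top,\boldsymbol f^\top)^\top$ and $\boldsymbol\eta=(\boldsymbol\beta^\top,\boldsymbol\gamma^\top)^\top$, $\mathbb E(\boldsymbol v\mid\boldsymbol v^\top\boldsymbol\eta)$ is a linear function of $\boldsymbol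 v^\top\boldsymbol\eta$. **Estimators.** $(\hat{\boldsymbol F},\hat{\boldsymbol B})$ is any minimizer of $\|\boldsymbol X-\boldsymbol F\boldsymbol B^\top\|_{\mathbb F}^2$ over $\boldsymbol F\in\mathbb R^{n\times K}$, $\boldsymbol B\in\mathbb R^{p\times K}$ with $n^{-1}\boldsymbol F^\top\boldsymbol F=\boldsymbol I_K$ and $\boldsymbol B^\top\boldsymbol B$ diagonal; $\hat{\boldsymbol U}=\boldsymbol X-\hat{\boldsymbol F}\hat{\boldsymbol B}^\top$; $F_n$ is the empirical distribution function of $Y_1,\dots,Y_n$; $\tilde F_n(\boldsymbol Y)=(\boldsymbol I_n-n^{-1}\hat{\boldsymbol F}\hat{\boldsymbol F}^\top)\{F_n(Y_i)-1/2\}_{i\le n}$; and $\hat{\boldsymbol\beta}_h$ is any minimizer over $\boldsymbol b\in\mathbb R^p$ of $(2n)^{-1}\|\tilde F_n(\boldsymbol Y)-\hat{\boldsymbol U}\boldsymbol b\|_2^2+\lambda\|\boldsymbol b\|_1$. **Theorem.** Let $D>0$. There is a constant $C_0>0$, depending only on $K,c_0,\tau,\Upsilon,\kappa,D$, such that the following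 holds. Suppose that Assumptions 1–3 hold, that $\log p=o(n)$ and $s=o(n/\log p)$, that $n\max(1,s)\le D\,p^2\log p$ for all large $n$ (which is automatic when $n=O(p)$, $p \to \infty$ and $s=o(n/\log p)$), and that $\lambda\asymp\sqrt{\log p/n}$ with $C_0\sqrt{\log p/n}\le\lambda\le C_1\sqrt{\log p/n}$ for all large $n$ and some constant $C_1$. Then, as $n\to\infty$, $$\|\hat{\boldsymbol\beta}_h-\boldsymbol\beta_h\|_2=O_{\mathbb P}(\lambda\sqrt s)\quad\text{and}\quad\|\hat{\boldsymbol\beta}_h-\boldsymbol\beta_h\|_1=O_{\mathbb P}(\lambda s).$$ -/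

import Mathlib

open MeasureTheory ProbabilityTheory Filter Matrix
open scoped ENNReal

noncomputable section

/-! Norms -/

/-- The `ℓ₁` norm of a vector. -/
def l1Norm {m : ℕ} (a : Fin m → ℝ) : ℝ := ∑ i, |a i|

/-- The `ℓ₂` norm of a vector. -/
def l2Norm {m : ℕ} (a : Fin m → ℝ) : ℝ := Real.sqrt (∑ i, a i ^ 2)

/-- The number of non-zero entries of a vector. -/
def l0Norm {m : ℕ} (a : Fin m → ℝ) : ℕ := {i : Fin m | a i ≠ 0}.ncard

/-- The elementwise max-norm of a matrix. -/
def maxNorm {m k : ℕ} (A : Matrix (Fin m) (Fin k) ℝ) : ℝ := ⨆ q : Fin m × Fin k, |A q.1 q.2|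

/-- The square of the Frobenius norm of a matrix. -/
def frobSq {m k : ℕ} (A : Matrix (Fin m) (Fin k) ℝ) : ℝ := ∑ i, ∑ j, A i j ^ 2

/-- The Orlicz `ψ₂` norm `inf {c > 0 : E exp (X² / c²) ≤ 2}` of a random variable
(it is `∞` when no such `c` exists). -/
def psiTwoNorm {Ω : Type*} [MeasurableSpace Ω] (P : Measure Ω) (X : Ω → ℝ) : ℝ≥0∞ :=
  ⨅ (c : ℝ) (_ : 0 < c ∧ ∫⁻ ω, ENNReal.ofReal (Real.exp (X ω ^ 2 / c ^ 2)) ∂P ≤ 2),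
    ENNReal.ofReal c

/-- The `ψ₂` norm of a random vector: the supremum of the `ψ₂` norms of its projections
on unit vectors. -/
def psiTwoNormVec {Ω : Type*} [MeasurableSpace Ω] (P : Measure Ω) {m : ℕ}
    (X : Ω → Fin m → ℝ) : ℝ≥0∞ :=
  ⨆ (a : Fin m → ℝ) (_ : l2Norm a = 1), psiTwoNorm P (fun ω => a ⬝ᵥ X ω)

/-- `R n = O_P (b n)`. The `n`-th variable lives on its own probability space. -/
def IsBigOP {Ω : ℕ → Type*} [∀ n, MeasurableSpace (Ω n)] (P : ∀ n, Measure (Ω n))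
    (R : ∀ n, Ω n → ℝ) (b : ℕ → ℝ) : Prop :=
  ∀ δ : ℝ, 0 < δ → ∃ M : ℝ, 0 < M ∧
    ∀ᶠ n in atTop, P n {ω | M * b n < |R n ω|} ≤ ENNReal.ofReal δ

/-! The population model -/

/-- The factor augmented single-index model
`Y = g (fᵀγ + uᵀβ, ε)`, `x = B f + u`, with `ε` independent of `(f, u)`, `u` uncorrelated with
`f`, and the identifiability conditions `Cov f = I`, `Bᵀ B` diagonal. -/
structure FASIM (K p : ℕ) {Ω : Type*} [MeasurableSpace Ω] (P : Measure Ω) where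
  B : Matrix (Fin p) (Fin K) ℝ
  γ : Fin K → ℝ
  β : Fin p → ℝ
  g : ℝ → ℝ → ℝ
  f : Ω → Fin K → ℝ
  u : Ω → Fin p → ℝ
  ε : Ω → ℝ
  measurable_g : Measurable (Function.uncurry g)
  measurable_f : Measurable f
  measurable_u : Measurable u
  measurable_ε : Measurable ε
  memLp_f : ∀ k, MemLp (fun ω => f ω k) 2 P
  memLp_u : ∀ j, MemLp (fun ω => u ω j) 2 P
  indep : IndepFun ε (fun ω => (f ω, u ω)) P
  uncorrelated : ∀ j k, cov[fun ω => u ω j, fun ω => f ω k; P] = 0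
  cov_f : ∀ k l, cov[fun ω => f ω k, fun ω => f ω l; P] = if k = l then 1 else 0
  diag_B : (Bᵀ * B).IsDiag

namespace FASIM

variable {K p : ℕ} {Ω : Type*} [MeasurableSpace Ω] {P : Measure Ω} (M : FASIM K p P)

/-- The observed covariate vector. -/
def x (ω : Ω) : Fin p → ℝ := M.B *ᵥ M.f ω + M.u ω

/-- The index `vᵀη = uᵀβ + fᵀγ`. -/
def index (ω : Ω) : ℝ := M.f ω ⬝ᵥ M.γ + M.u ω ⬝ᵥ M.β

/-- The response. -/
def Y (ω : Ω) : ℝ := M.g (M.index ω) (M.ε ω)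

/-- The transformed response `h(Y) = F(Y) - 1/2`, with `F` the distribution function of `Y`. -/
def hY (ω : Ω) : ℝ := cdf (P.map M.Y) (M.Y ω) - 1 / 2

/-- `Σ = Cov x`. -/
def covX : Matrix (Fin p) (Fin p) ℝ :=
  Matrix.of fun j l => cov[fun ω => M.x ω j, fun ω => M.x ω l; P]

/-- `Σ_u = Cov u`. -/
def covU : Matrix (Fin p) (Fin p) ℝ :=
  Matrix.of fun j l => cov[fun ω => M.u ω j, fun ω => M.u ω l; P]

/-- `β_h = (E u uᵀ)⁻¹ Cov (u, h(Y))`. -/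
def betaH : Fin p → ℝ :=
  (Matrix.of fun j l => ∫ ω, M.u ω j * M.u ω l ∂P : Matrix (Fin p) (Fin p) ℝ)⁻¹ *ᵥ
    fun j => cov[fun ω => M.u ω j, M.hY; P]

/-- The linearity condition: with `v = (u, f)`, the conditional expectation `E (v | vᵀη)` is a
linear function of `vᵀη`. -/
def LinearityCondition : Prop :=
  (∃ a : Fin p → ℝ, ∀ j,
    P[fun ω => M.u ω j | MeasurableSpace.comap M.index inferInstance]
      =ᵐ[P] fun ω => a j * M.index ω) ∧
  (∃ b : Fin K → ℝ, ∀ k,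
    P[fun ω => M.f ω k | MeasurableSpace.comap M.index inferInstance]
      =ᵐ[P] fun ω => b k * M.index ω)

/-- The regularity conditions on factors, loadings and idiosyncratic components, with
constants `c₀, τ, Υ, κ`. -/
structure Regular (c₀ τ Υ κ : ℝ) : Prop where
  psi_f : psiTwoNormVec P M.f ≤ ENNReal.ofReal c₀
  psi_u : psiTwoNormVec P M.u ≤ ENNReal.ofReal c₀
  mean_f : ∀ k, ∫ ω, M.f ω k ∂P = 0
  mean_u : ∀ j, ∫ ω, M.u ω j ∂P = 0
  pervasive : ∀ r ∈ spectrum ℝ (M.Bᵀ * M.B), (p : ℝ) / τ ≤ r ∧ r ≤ p * τ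
  loadings : ∀ j k, |M.B j k| ≤ Υ
  fourth_moment : ∫ ω, |M.u ω ⬝ᵥ M.u ω - M.covU.trace| ^ 4 ∂P ≤ Υ * (p : ℝ) ^ 2
  eig_covU : ∀ r ∈ spectrum ℝ M.covU, κ ≤ r ∧ r ≤ 1 / κ
  colsum_covU : ∀ l, ∑ j, |M.covU j l| ≤ 1 / κ
  var_prod : ∀ k l, κ ≤ Var[fun ω => M.u ω k * M.u ω l; P]

/-- A sample of size `n`: i.i.d. copies `(f_i, u_i, Y_i)` of `(f, u, Y)`. -/
structure Sample (n : ℕ) where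
  f : Fin n → Ω → Fin K → ℝ
  u : Fin n → Ω → Fin p → ℝ
  Y : Fin n → Ω → ℝ
  measurable_f : ∀ i, Measurable (f i)
  measurable_u : ∀ i, Measurable (u i)
  measurable_Y : ∀ i, Measurable (Y i)
  indep : iIndepFun (fun i ω => (f i ω, u i ω, Y i ω)) P
  ident : ∀ i, IdentDistrib (fun ω => (f i ω, u i ω, Y i ω))
    (fun ω => (M.f ω, M.u ω, M.Y ω)) P P

variable {M}

/-- The `n × p` matrix with rows `x_i = B f_i + u_i`. -/
def Sample.X {n : ℕ} (S : M.Sample n) (ω : Ω) : Matrix (Fin n) (Fin p) ℝ :=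
  Matrix.of fun i => M.B *ᵥ S.f i ω + S.u i ω

/-- The vector of observed responses. -/
def Sample.Yvec {n : ℕ} (S : M.Sample n) (ω : Ω) : Fin n → ℝ := fun i => S.Y i ω

end FASIM

/-! Leading eigenpairs -/

/-- `lam` lists the `K` largest eigenvalues of the symmetric matrix `A` in non-increasing order
(with multiplicity), and the columns of `G` are corresponding orthonormal eigenvectors. -/
structure IsLeadingEigen {p K : ℕ} (A : Matrix (Fin p) (Fin p) ℝ) (lam : Fin K → ℝ)
    (G : Matrix (Fin p) (Fin K) ℝ) : Prop where
  orthonormal : Gᵀ * G = 1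
  eigen : A * G = G * Matrix.diagonal lam
  antitone : Antitone lam
  leading : ∀ (r : ℝ) (v : Fin p → ℝ), v ≠ 0 → A *ᵥ v = r • v → Gᵀ *ᵥ v = 0 → ∀ k, r ≤ lam k

/-! The estimators, as functions of the data matrix and the response vector -/

/-- Feasibility in the constrained least squares problem: `n⁻¹ Fᵀ F = I`, `Bᵀ B` diagonal. -/
def FactorFeasible {n p K : ℕ} (F : Matrix (Fin n) (Fin K) ℝ) (B : Matrix (Fin p) (Fin K) ℝ) :
    Prop :=
  (n : ℝ)⁻¹ • (Fᵀ * F) = 1 ∧ (Bᵀ * B).IsDiag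

/-- `(F, B)` is a constrained least squares estimate of (factors, loadings). -/
def IsFactorEstimate {n p K : ℕ} (X : Matrix (Fin n) (Fin p) ℝ)
    (F : Matrix (Fin n) (Fin K) ℝ) (B : Matrix (Fin p) (Fin K) ℝ) : Prop :=
  FactorFeasible F B ∧ ∀ (F' : Matrix (Fin n) (Fin K) ℝ) (B' : Matrix (Fin p) (Fin K) ℝ),
    FactorFeasible F' B' → frobSq (X - F * Bᵀ) ≤ frobSq (X - F' * B'ᵀ)

/-- The empirical distribution function. -/
def empCDF {n : ℕ} (Y : Fin n → ℝ) (y : ℝ) : ℝ := (n : ℝ)⁻¹ * ∑ i, if Y i ≤ y then 1 else 0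

/-- The transformed responses `F_n(Y) - 1/2`, after projection off the column space of `F`:
`(I - n⁻¹ F Fᵀ) (F_n(Y) - 1/2)`. -/
def projResponse {n K : ℕ} (F : Matrix (Fin n) (Fin K) ℝ) (Y : Fin n → ℝ) : Fin n → ℝ :=
  (1 - (n : ℝ)⁻¹ • (F * Fᵀ)) *ᵥ fun i => empCDF Y (Y i) - 1 / 2

/-- The Lasso criterion `(2n)⁻¹ ‖y - U b‖₂² + lam ‖b‖₁`. -/
def lassoObj {n p : ℕ} (lam : ℝ) (y : Fin n → ℝ) (U : Matrix (Fin n) (Fin p) ℝ)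
    (b : Fin p → ℝ) : ℝ :=
  (2 * (n : ℝ))⁻¹ * l2Norm (y - U *ᵥ b) ^ 2 + lam * l1Norm b

/-- `b` is a Lasso estimate computed from the data `X`, `Y` with estimated factors `F`, estimated
loadings `B`, estimated idiosyncratic components `X - F Bᵀ` and tuning parameter `lam`. -/
def IsLassoEstimate {n p K : ℕ} (lam : ℝ) (X : Matrix (Fin n) (Fin p) ℝ) (Y : Fin n → ℝ)
    (F : Matrix (Fin n) (Fin K) ℝ) (B : Matrix (Fin p) (Fin K) ℝ) (b : Fin p → ℝ) : Prop :=
  ∀ b' : Fin p → ℝ, lassoObj lam (projResponse F Y) (X - F * Bᵀ) b ≤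
    lassoObj lam (projResponse F Y) (X - F * Bᵀ) b'

/-- The rate condition on pilot estimators `Sh`, `diag (lamh)`, `Gh` of `Σ = Cov x`, of the
diagonal matrix `diag (lam)` of its `K` leading eigenvalues and of the matrix `G` of corresponding
eigenvectors. -/
structure PilotRates {K : ℕ} {p : ℕ → ℕ} {Ω : ℕ → Type*} [∀ n, MeasurableSpace (Ω n)]
    (P : ∀ n, Measure (Ω n)) (M : ∀ n, FASIM K (p n) (P n))
    (lam : ℕ → Fin K → ℝ) (G : ∀ n, Matrix (Fin (p n)) (Fin K) ℝ)
    (Sh : ∀ n, Ω n → Matrix (Fin (p n)) (Fin (p n)) ℝ)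
    (lamh : ∀ n, Ω n → Fin K → ℝ)
    (Gh : ∀ n, Ω n → Matrix (Fin (p n)) (Fin K) ℝ) : Prop where
  leading : ∀ n, IsLeadingEigen (M n).covX (lam n) (G n)
  cov_rate : IsBigOP P (fun n ω => maxNorm (Sh n ω - (M n).covX))
    (fun n => Real.sqrt (Real.log (p n) / n))
  eigenvalue_rate : IsBigOP P
    (fun n ω => maxNorm ((Matrix.diagonal (lamh n ω) - Matrix.diagonal (lam n)) *
      (Matrix.diagonal (lamh n ω))⁻¹))
    (fun n => Real.sqrt (Real.log (p n) / n))
  eigenvector_rate : IsBigOP P (fun n ω => maxNorm (Gh n ω - G n))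
    (fun n => Real.sqrt (Real.log (p n) / (n * p n)))

end

noncomputable section

/-! Euclidean norms of coordinate vectors -/

/-! Write r = √(log p / n), h = √(1/p + r²), m = max(1, s), and let Q = I − n⁻¹F̂F̂ᵀ be the
projection off the estimated factors. By the normal equations the Lasso design is QX, and its
response is Q applied to F_n(Y) − 1/2. On an event of probability tending to one
(`FASIM.Sample.Good`) everything is deterministic. There `lasso_error_bound` reduces the theorem to
two facts: the gradient of the squared loss at β_h is at most λ/2 in sup norm, and the design has a
restricted eigenvalue on the cone ‖v‖₁ ≤ 4√s‖v‖₂.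

Gradient. Linear regression of h(Y) on (f, u) gives h(Y) = fᵀγ_h + uᵀβ_h + e with e uncorrelated
with f and u. Hence the Lasso residual at β_h is Q(Fφ + e + δ), where φ = γ_h − Bᵀβ_h has size at
most a multiple of √m and δ is the error of the empirical distribution function at the data
(`FASIM.Sample.response_sub`). The terms with e and δ contribute order r + h². The delicate term is
the factor leakage QFφ. Comparing the least squares value at (F̂, B̂) with that at (F, B) gives only
‖QFa‖ ≲ √n h‖a‖, which would contribute h√m. The normal equation QXB̂ = 0 does better: QFa = −QUB̂ψ
with ‖ψ‖ ≲ ‖a‖/p (`FactorDesign.exists_projOff_factors_eq`). The leakage is therefore itself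
idiosyncratic noise averaged over p coordinates, and its inner product with a column of U is of
second order, h²√m (`FactorDesign.score_le`). The condition n·m ≤ D p² log p is what makes h²√m at
most a multiple of r (`rate_le`).

Quadratic forms in U. The operator norm of U and its restricted eigenvalue both come from empirical
sparsification in the manner of Maurey. A vector x is ‖x‖₁ times the mean of a random signed basis
vector, so a quadratic form that is nonnegative on all sums of d such vectors is bounded below
everywhere by a multiple of −‖x‖₁²/(d − 1) (`quadratic_ge_of_signedSum`). There are only (2p)^d such
sums, so tail bounds for fixed vectors and a union bound suffice. Taking d = p gives ‖U‖² ≲ n + p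
log p; taking d of order m gives the restricted eigenvalue, because d log p = o(n). The passage from
U to QX costs √n h‖v‖₁ (`FactorDesign.le_l2Norm_residual_mulVec`), which is negligible on the cone
since m h² → 0.

Probability. All variables have one `ψ₂` scale, products of two of them satisfy a Bernstein
inequality, and the empirical distribution function is controlled at the data through n + 1 levels
of F and of its reflection (`FASIM.Sample.abs_empCDF_sub_le`). -/

theorem l2Norm_eq_norm {m : ℕ} (a : Fin m → ℝ) : l2Norm a = ‖WithLp.toLp 2 a‖ := by
  simp [l2Norm, EuclideanSpace.norm_eq]

theorem l2Norm_nonneg {m : ℕ} (a : Fin m → ℝ) : 0 ≤ l2Norm a := Real.sqrt_nonneg _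

theorem l2Norm_sq {m : ℕ} (a : Fin m → ℝ) : l2Norm a ^ 2 = a ⬝ᵥ a := by
  rw [l2Norm, Real.sq_sqrt (Finset.sum_nonneg fun _ _ => sq_nonneg _)]
  simp [dotProduct, sq]

theorem l2Norm_sq' {m : ℕ} (a : Fin m → ℝ) : l2Norm a ^ 2 = ∑ i, a i ^ 2 :=
  Real.sq_sqrt (Finset.sum_nonneg fun _ _ => sq_nonneg _)

theorem l2Norm_zero {m : ℕ} : l2Norm (0 : Fin m → ℝ) = 0 := by simp [l2Norm]

theorem l2Norm_add_le {m : ℕ} (a b : Fin m → ℝ) : l2Norm (a + b) ≤ l2Norm a + l2Norm b := by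
  simpa [l2Norm_eq_norm] using norm_add_le (WithLp.toLp 2 a) (WithLp.toLp 2 b)

theorem l2Norm_sub_le {m : ℕ} (a b : Fin m → ℝ) : l2Norm (a - b) ≤ l2Norm a + l2Norm b := by
  simpa [l2Norm_eq_norm] using norm_sub_le (WithLp.toLp 2 a) (WithLp.toLp 2 b)

theorem l2Norm_neg {m : ℕ} (a : Fin m → ℝ) : l2Norm (-a) = l2Norm a := by
  simp [l2Norm]

theorem le_l2Norm_add {m : ℕ} (a b : Fin m → ℝ) : l2Norm a - l2Norm b ≤ l2Norm (a + b) := by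
  have := l2Norm_sub_le (a + b) b
  rw [add_sub_cancel_right] at this
  linarith

theorem l2Norm_smul {m : ℕ} (c : ℝ) (a : Fin m → ℝ) : l2Norm (c • a) = |c| * l2Norm a := by
  simpa [l2Norm_eq_norm] using norm_smul c (WithLp.toLp 2 a)

theorem l2Norm_eq_zero {m : ℕ} {a : Fin m → ℝ} (h : l2Norm a = 0) : a = 0 := by
  rw [l2Norm_eq_norm, norm_eq_zero] at h
  simpa using h

theorem abs_dotProduct_le {m : ℕ} (a b : Fin m → ℝ) : |a ⬝ᵥ b| ≤ l2Norm a * l2Norm b := by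
  refine Real.abs_le_sqrt ?_ |>.trans_eq
    (Real.sqrt_mul (Finset.sum_nonneg fun _ _ => sq_nonneg _) _)
  exact Finset.sum_mul_sq_le_sq_mul_sq _ _ _

theorem dotProduct_le_l2Norm {m : ℕ} (a b : Fin m → ℝ) : a ⬝ᵥ b ≤ l2Norm a * l2Norm b :=
  (le_abs_self _).trans (abs_dotProduct_le a b)

theorem l2Norm_le_of_sq {m : ℕ} {a : Fin m → ℝ} {c : ℝ} (hc : 0 ≤ c) (h : a ⬝ᵥ a ≤ c ^ 2) :
    l2Norm a ≤ c := by
  rw [← l2Norm_sq] at h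
  exact abs_le_of_sq_le_sq' h hc |>.2

theorem l2Norm_le_of_forall {m : ℕ} {a : Fin m → ℝ} {c : ℝ} (hc : 0 ≤ c) (h : ∀ i, |a i| ≤ c) :
    l2Norm a ≤ Real.sqrt m * c := by
  refine l2Norm_le_of_sq (by positivity) ?_
  rw [← l2Norm_sq, l2Norm_sq', mul_pow, Real.sq_sqrt (Nat.cast_nonneg m)]
  calc ∑ i, a i ^ 2 ≤ ∑ _i : Fin m, c ^ 2 :=
        Finset.sum_le_sum fun i _ => sq_le_sq' (by linarith [abs_le.1 (h i)]) (abs_le.1 (h i)).2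
    _ = m * c ^ 2 := by simp

theorem l1Norm_nonneg {m : ℕ} (a : Fin m → ℝ) : 0 ≤ l1Norm a :=
  Finset.sum_nonneg fun _ _ => abs_nonneg _

theorem l1Norm_le_sqrt_mul_l2Norm {m : ℕ} (a : Fin m → ℝ) :
    l1Norm a ≤ Real.sqrt m * l2Norm a := by
  rw [l2Norm, ← Real.sqrt_mul (Nat.cast_nonneg m)]
  refine Real.le_sqrt_of_sq_le ?_
  simpa [l1Norm] using sq_sum_le_card_mul_sum_sq (s := Finset.univ) (f := fun i => |a i|)

theorem abs_dotProduct_le_l1Norm {m : ℕ} {a b : Fin m → ℝ} {c : ℝ} (h : ∀ i, |a i| ≤ c) :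
    |a ⬝ᵥ b| ≤ c * l1Norm b := by
  rw [dotProduct, l1Norm, Finset.mul_sum]
  refine (Finset.abs_sum_le_sum_abs _ _).trans (Finset.sum_le_sum fun i _ => ?_)
  rw [abs_mul]
  exact mul_le_mul_of_nonneg_right (h i) (abs_nonneg _)

/-- `A v` is a combination of the columns of `A`, bounded by `‖v‖₁` times the largest column. -/
theorem l2Norm_mulVec_le_l1Norm {m k : ℕ} (A : Matrix (Fin m) (Fin k) ℝ) {c : ℝ}
    (h : ∀ j, l2Norm (fun i => A i j) ≤ c) (v : Fin k → ℝ) : l2Norm (A *ᵥ v) ≤ c * l1Norm v := by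
  have h1 : A *ᵥ v = ∑ j, v j • fun i => A i j := by
    ext i; simp [mulVec, dotProduct, mul_comm]
  have h2 : ∀ s : Finset (Fin k), l2Norm (∑ j ∈ s, v j • fun i => A i j) ≤
      ∑ j ∈ s, |v j| * c := by
    intro s
    induction s using Finset.induction_on with
    | empty => simp [l2Norm_zero]
    | insert a s ha ih =>
      rw [Finset.sum_insert ha, Finset.sum_insert ha]
      refine (l2Norm_add_le _ _).trans (add_le_add ?_ ih)
      rw [l2Norm_smul]
      exact mul_le_mul_of_nonneg_left (h a) (abs_nonneg _)
  rw [h1, l1Norm, Finset.mul_sum]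
  exact (h2 _).trans_eq (Finset.sum_congr rfl fun _ _ => mul_comm _ _)

theorem mulVec_dotProduct {m k : ℕ} (A : Matrix (Fin m) (Fin k) ℝ) (v : Fin k → ℝ)
    (w : Fin m → ℝ) : (A *ᵥ v) ⬝ᵥ w = v ⬝ᵥ (Aᵀ *ᵥ w) := by
  rw [dotProduct_comm, dotProduct_mulVec, ← mulVec_transpose, dotProduct_comm]

theorem l2Norm_transpose_mulVec_le {m k : ℕ} {A : Matrix (Fin m) (Fin k) ℝ} {L : ℝ} (hL : 0 ≤ L)
    (h : ∀ v, l2Norm (A *ᵥ v) ≤ L * l2Norm v) (w : Fin m → ℝ) :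
    l2Norm (Aᵀ *ᵥ w) ≤ L * l2Norm w := by
  have h1 : l2Norm (Aᵀ *ᵥ w) ^ 2 ≤ l2Norm w * (L * l2Norm (Aᵀ *ᵥ w)) := by
    rw [l2Norm_sq, mulVec_dotProduct, transpose_transpose]
    exact (dotProduct_le_l2Norm _ _).trans (mul_le_mul_of_nonneg_left (h _) (l2Norm_nonneg _))
  rcases (l2Norm_nonneg (Aᵀ *ᵥ w)).eq_or_lt with h0 | h0
  · rw [← h0]
    exact mul_nonneg hL (l2Norm_nonneg w)
  · nlinarith

/-- A square matrix that is bounded below is surjective. -/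
theorem exists_mulVec_eq {k : ℕ} {A : Matrix (Fin k) (Fin k) ℝ} {c : ℝ} (hc : 0 < c)
    (h : ∀ v, c * l2Norm v ≤ l2Norm (A *ᵥ v)) (b : Fin k → ℝ) :
    ∃ v, A *ᵥ v = b ∧ l2Norm v ≤ l2Norm b / c := by
  have hinj : Function.Injective A.mulVecLin := by
    rw [← LinearMap.ker_eq_bot, LinearMap.ker_eq_bot']
    intro v hv
    have h1 := h v
    rw [show A *ᵥ v = 0 from hv, l2Norm_zero] at h1
    exact l2Norm_eq_zero (le_antisymm (by nlinarith [l2Norm_nonneg v]) (l2Norm_nonneg v))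
  obtain ⟨v, hv⟩ := LinearMap.injective_iff_surjective.1 hinj b
  refine ⟨v, hv, ?_⟩
  rw [le_div_iff₀ hc, mul_comm, ← show A *ᵥ v = b from hv]
  exact h v

/-- Squareness turns the lower bound into surjectivity: with `A v = a` and ‖v‖ ≤ ‖a‖/c, write ‖a‖² =
v · Aᵀa and apply Cauchy–Schwarz. -/
theorem le_l2Norm_transpose_mulVec {k : ℕ} {A : Matrix (Fin k) (Fin k) ℝ} {c : ℝ} (hc : 0 < c)
    (h : ∀ v, c * l2Norm v ≤ l2Norm (A *ᵥ v)) (a : Fin k → ℝ) :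
    c * l2Norm a ≤ l2Norm (Aᵀ *ᵥ a) := by
  obtain ⟨v, hv, hv'⟩ := exists_mulVec_eq hc h a
  have h1 : l2Norm a ^ 2 ≤ l2Norm (Aᵀ *ᵥ a) * (l2Norm a / c) := by
    rw [l2Norm_sq]
    nth_rewrite 1 [← hv]
    rw [mulVec_dotProduct, dotProduct_comm]
    exact (dotProduct_le_l2Norm _ _).trans (mul_le_mul_of_nonneg_left hv' (l2Norm_nonneg _))
  rcases (l2Norm_nonneg a).eq_or_lt with h0 | h0
  · rw [← h0, mul_zero]; exact l2Norm_nonneg _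
  · rw [mul_div_assoc', le_div_iff₀ hc] at h1
    nlinarith

/-! Empirical sparsification of a quadratic form -/

/-- The signed sum of standard basis vectors encoded by `J`. -/
def signedSum {p d : ℕ} (J : Fin d → Fin p × Bool) : Fin p → ℝ :=
  ∑ a, Pi.single (J a).1 (if (J a).2 then (1 : ℝ) else -1)

theorem dotProduct_mulVec_add {p : ℕ} (A : Matrix (Fin p) (Fin p) ℝ) (x y : Fin p → ℝ) :
    (x + y) ⬝ᵥ A *ᵥ (x + y) = x ⬝ᵥ A *ᵥ x + x ⬝ᵥ A *ᵥ y + y ⬝ᵥ A *ᵥ x + y ⬝ᵥ A *ᵥ y := by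
  rw [mulVec_add, add_dotProduct, dotProduct_add, dotProduct_add]; ring

/-- The variance identity for a random vector with weights `w` and values `ξ`. -/
theorem sum_mul_quadratic_add {p : ℕ} (A : Matrix (Fin p) (Fin p) ℝ) {w : Fin p → ℝ}
    (hw : ∑ j, w j = 1) (ξ : Fin p → Fin p → ℝ) {μ : Fin p → ℝ} (hμ : ∑ j, w j • ξ j = μ)
    (z : Fin p → ℝ) :
    ∑ j, w j * ((z + ξ j) ⬝ᵥ A *ᵥ (z + ξ j)) =
      (z + μ) ⬝ᵥ A *ᵥ (z + μ) + (∑ j, w j * (ξ j ⬝ᵥ A *ᵥ ξ j) - μ ⬝ᵥ A *ᵥ μ) := by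
  have h1 : ∑ j, w j * (z ⬝ᵥ A *ᵥ ξ j) = z ⬝ᵥ A *ᵥ μ := by
    rw [← hμ, mulVec_sum, dotProduct_sum]
    exact Finset.sum_congr rfl fun j _ => by rw [mulVec_smul, dotProduct_smul, smul_eq_mul]
  have h2 : ∑ j, w j * (ξ j ⬝ᵥ A *ᵥ z) = μ ⬝ᵥ A *ᵥ z := by
    rw [← hμ, sum_dotProduct]
    exact Finset.sum_congr rfl fun j _ => by rw [smul_dotProduct, smul_eq_mul]
  have h3 : ∑ j, w j * (z ⬝ᵥ A *ᵥ z) = z ⬝ᵥ A *ᵥ z := by rw [← Finset.sum_mul, hw, one_mul]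
  simp only [dotProduct_mulVec_add, mul_add, Finset.sum_add_distrib, h1, h2, h3]
  ring

/-- Draw d independent signed basis vectors with weights `w`. The expected form is its value at the
mean `z + d μ` plus d times a one-draw variance, so some outcome is no larger. The induction fixes
the draws one at a time, and `z` accumulates those already fixed. Signs square to one, so the second
moment only sees diagonal entries. -/
theorem exists_signedSum_quadratic_le {p : ℕ} (A : Matrix (Fin p) (Fin p) ℝ) {w : Fin p → ℝ}
    (hw0 : ∀ j, 0 ≤ w j) (hw : ∑ j, w j = 1) (b : Fin p → Bool) {μ : Fin p → ℝ}
    (hμ : ∀ j, μ j = w j * if b j then 1 else -1) (d : ℕ) (z : Fin p → ℝ) :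
    ∃ J : Fin d → Fin p × Bool, (z + signedSum J) ⬝ᵥ A *ᵥ (z + signedSum J) ≤
      (z + (d : ℝ) • μ) ⬝ᵥ A *ᵥ (z + (d : ℝ) • μ) +
        d * (∑ j, w j * A j j - μ ⬝ᵥ A *ᵥ μ) := by
  set ξ : Fin p → Fin p → ℝ := fun j => Pi.single j (if b j then (1 : ℝ) else -1) with hξ
  have hμ' : ∑ j, w j • ξ j = μ := by
    ext i
    simp [hξ, hμ, Finset.sum_apply, Pi.single_apply]
  have hdiag : ∀ j, ξ j ⬝ᵥ A *ᵥ ξ j = A j j := by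
    intro j
    simp only [hξ, single_dotProduct, mulVec_single]
    cases b j <;> simp
  induction d generalizing z with
  | zero => exact ⟨Fin.elim0, by simp [signedSum]⟩
  | succ d ih =>
    have hid := sum_mul_quadratic_add A hw ξ hμ' (z + (d : ℝ) • μ)
    simp only [hdiag] at hid
    obtain ⟨j, hj⟩ : ∃ j, ((z + (d : ℝ) • μ) + ξ j) ⬝ᵥ A *ᵥ ((z + (d : ℝ) • μ) + ξ j) ≤
        ((z + (d : ℝ) • μ) + μ) ⬝ᵥ A *ᵥ ((z + (d : ℝ) • μ) + μ) +
          (∑ j, w j * A j j - μ ⬝ᵥ A *ᵥ μ) := by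
      -- Otherwise every value exceeds the weighted average; some weight is positive because the
      -- weights sum to one, so the average would exceed itself.
      by_contra! hcon
      rw [← hid] at hcon
      set T := ∑ j, w j * ((z + (d : ℝ) • μ + ξ j) ⬝ᵥ A *ᵥ (z + (d : ℝ) • μ + ξ j)) with hT
      have hpos : ∃ j, 0 < w j := by
        by_contra! h0
        have := Finset.sum_nonpos fun j (_ : j ∈ Finset.univ) => h0 j
        linarith
      obtain ⟨j₀, hj₀⟩ := hpos
      have : ∑ j, w j * T < T := by
        nth_rewrite 2 [hT]
        exact Finset.sum_lt_sum (fun j _ => mul_le_mul_of_nonneg_left (hcon j).le (hw0 j))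
          ⟨j₀, Finset.mem_univ _, mul_lt_mul_of_pos_left (hcon j₀) hj₀⟩
      rw [← Finset.sum_mul, hw, one_mul] at this
      exact lt_irrefl _ this
    obtain ⟨J, hJ⟩ := ih (z + ξ j)
    refine ⟨Fin.cons (j, b j) J, ?_⟩
    have e1 : z + signedSum (Fin.cons (j, b j) J : Fin (d + 1) → Fin p × Bool) =
        z + ξ j + signedSum J := by
      simp [signedSum, Fin.sum_univ_succ, hξ, add_assoc]
    have e2 : z + ξ j + (d : ℝ) • μ = z + (d : ℝ) • μ + ξ j := by abel
    have e3 : z + ((d + 1 : ℕ) : ℝ) • μ = z + (d : ℝ) • μ + μ := by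
      push_cast; rw [add_smul, one_smul, add_assoc]
    rw [e1, e3]
    rw [e2] at hJ
    push_cast
    linarith

/-- If a quadratic form is nonnegative on all signed sums of `d` basis vectors, it is bounded
below on all vectors by a multiple of `-‖x‖₁² / (d - 1)`. -/
theorem quadratic_ge_of_signedSum {p d : ℕ} (A : Matrix (Fin p) (Fin p) ℝ) {a : ℝ}
    (hd : 2 ≤ d) (ha : ∀ j, A j j ≤ a)
    (h : ∀ J : Fin d → Fin p × Bool, 0 ≤ signedSum J ⬝ᵥ A *ᵥ signedSum J) (x : Fin p → ℝ) :
    -(a * l1Norm x ^ 2) ≤ ((d : ℝ) - 1) * (x ⬝ᵥ A *ᵥ x) := by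
  rcases (l1Norm_nonneg x).eq_or_lt with h0 | h0
  · have hx : x = 0 := by
      have := (Finset.sum_eq_zero_iff_of_nonneg fun i (_ : i ∈ Finset.univ) => abs_nonneg (x i)).1
        h0.symm
      ext i; simpa using this i (Finset.mem_univ i)
    simp [hx, l1Norm]
  set N := l1Norm x with hN
  have hwsum : ∑ j, |x j| / N = 1 := by
    rw [← Finset.sum_div]; exact div_self h0.ne'
  -- Weights proportional to |x_j|, carrying the signs of x, have mean x / ‖x‖₁.
  obtain ⟨J, hJ⟩ := exists_signedSum_quadratic_le A (w := fun j => |x j| / N)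
    (fun j => div_nonneg (abs_nonneg _) h0.le) hwsum (fun j => decide (0 ≤ x j))
    (μ := N⁻¹ • x) (fun j => by
      by_cases hj : 0 ≤ x j
      · simp [hj, abs_of_nonneg hj]; ring
      · simp [hj, abs_of_neg (not_le.1 hj)]; ring) d 0
  simp only [zero_add] at hJ
  have h1 := (h J).trans hJ
  simp only [mulVec_smul, dotProduct_smul, smul_dotProduct, smul_eq_mul] at h1
  have h2 : ∑ j, |x j| / N * A j j ≤ a := by
    calc ∑ j, |x j| / N * A j j ≤ ∑ j, |x j| / N * a :=
          Finset.sum_le_sum fun j _ => mul_le_mul_of_nonneg_left (ha j) (by positivity)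
      _ = a := by rw [← Finset.sum_mul, hwsum, one_mul]
  have hd' : (2 : ℝ) ≤ d := by exact_mod_cast hd
  set q := x ⬝ᵥ A *ᵥ x
  -- The value at the mean contributes d² q/N² and the variance −d q/N²; this is the source of d −
  -- 1.
  have h3 : 0 ≤ (d : ℝ) * ((d - 1) * q * (N⁻¹ * N⁻¹) + a) := by nlinarith
  have h4 : 0 ≤ (d - 1) * q * (N⁻¹ * N⁻¹) + a := by
    by_contra hc; push Not at hc; nlinarith
  have h5 : 0 ≤ N ^ 2 * ((d - 1) * q * (N⁻¹ * N⁻¹) + a) := by positivity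
  have h6 : N ^ 2 * ((d - 1) * q * (N⁻¹ * N⁻¹) + a) = (d - 1) * q + a * N ^ 2 := by
    field_simp
  linarith

/-! The Lasso under a gradient bound and a restricted eigenvalue condition -/

theorem lassoObj_sub {n p : ℕ} (lam : ℝ) (y : Fin n → ℝ) (U : Matrix (Fin n) (Fin p) ℝ)
    (b v : Fin p → ℝ) :
    lassoObj lam y U (b + v) - lassoObj lam y U b =
      (2 * (n : ℝ))⁻¹ * l2Norm (U *ᵥ v) ^ 2 - (n : ℝ)⁻¹ * (v ⬝ᵥ Uᵀ *ᵥ (y - U *ᵥ b)) +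
        lam * (l1Norm (b + v) - l1Norm b) := by
  have h1 : y - U *ᵥ (b + v) = (y - U *ᵥ b) - U *ᵥ v := by rw [mulVec_add]; abel
  rw [lassoObj, lassoObj, h1]
  generalize y - U *ᵥ b = R
  have h2 : l2Norm (R - U *ᵥ v) ^ 2 = l2Norm R ^ 2 + l2Norm (U *ᵥ v) ^ 2
      - 2 * (v ⬝ᵥ Uᵀ *ᵥ R) := by
    rw [← mulVec_dotProduct, l2Norm_sq, l2Norm_sq, l2Norm_sq, sub_dotProduct, dotProduct_sub,
      dotProduct_sub, dotProduct_comm R (U *ᵥ v)]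
    ring
  rw [h2, mul_inv]
  ring

/-- The gradient bound uses half of the penalty. With a₁ and a₂ the ℓ₁ masses of the error v on and
off the support, optimality gives n⁻¹‖Uv‖² + λa₂ ≤ 3λa₁. Hence a₂ ≤ 3a₁, so ‖v‖₁ ≤ 4a₁ ≤ 4√s‖v‖₂ and
the restricted eigenvalue applies: c‖v‖₂² ≤ 3λ√s‖v‖₂. The ℓ₁ constant is 12 = 4 · 3. -/
theorem lasso_error_bound {n p : ℕ} {lam c : ℝ} (hlam : 0 < lam) (hc : 0 < c) {y : Fin n → ℝ}
    {U : Matrix (Fin n) (Fin p) ℝ} {b bh : Fin p → ℝ}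
    (hmin : ∀ b', lassoObj lam y U bh ≤ lassoObj lam y U b')
    (hgrad : ∀ j, |(n : ℝ)⁻¹ * (Uᵀ *ᵥ (y - U *ᵥ b)) j| ≤ lam / 2)
    (hRE : ∀ v : Fin p → ℝ, l1Norm v ≤ 4 * Real.sqrt (l0Norm b) * l2Norm v →
      c * l2Norm v ^ 2 ≤ (n : ℝ)⁻¹ * l2Norm (U *ᵥ v) ^ 2) :
    l2Norm (bh - b) ≤ 3 / c * (lam * Real.sqrt (l0Norm b)) ∧
      l1Norm (bh - b) ≤ 12 / c * (lam * l0Norm b) := by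
  set v := bh - b with hv
  have hbh : bh = b + v := by rw [hv]; abel
  have h0 := lassoObj_sub lam y U b v
  rw [← hbh] at h0
  have hm := hmin b
  have hg : (n : ℝ)⁻¹ * (v ⬝ᵥ Uᵀ *ᵥ (y - U *ᵥ b)) ≤ lam / 2 * l1Norm v := by
    have := abs_dotProduct_le_l1Norm (a := (n : ℝ)⁻¹ • (Uᵀ *ᵥ (y - U *ᵥ b))) (b := v) hgrad
    rw [smul_dotProduct, smul_eq_mul, dotProduct_comm] at this
    exact (le_abs_self _).trans this
  set S : Finset (Fin p) := Finset.univ.filter fun i => b i ≠ 0 with hS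
  have hcard : (S.card : ℝ) = l0Norm b := by
    rw [l0Norm, hS, ← Set.ncard_coe_finset]; simp
  set a1 := ∑ i ∈ S, |v i| with ha1
  set a2 := ∑ i ∈ Sᶜ, |v i| with ha2
  have hsplit : l1Norm v = a1 + a2 := (Finset.sum_add_sum_compl S _).symm
  have hl1 : a2 - a1 ≤ l1Norm bh - l1Norm b := by
    rw [l1Norm, l1Norm, ← Finset.sum_sub_distrib, ← Finset.sum_add_sum_compl S]
    have i1 : -a1 ≤ ∑ i ∈ S, (|bh i| - |b i|) := by
      rw [ha1, ← Finset.sum_neg_distrib]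
      refine Finset.sum_le_sum fun i _ => ?_
      have := abs_sub_abs_le_abs_sub (b i) (bh i)
      rw [abs_sub_comm] at this
      rw [hv, Pi.sub_apply]; linarith
    have i2 : a2 = ∑ i ∈ Sᶜ, (|bh i| - |b i|) := by
      refine Finset.sum_congr rfl fun i hi => ?_
      have : b i = 0 := by simpa [hS] using hi
      simp [hv, this]
    linarith
  have ha1' : a1 ≤ Real.sqrt (l0Norm b) * l2Norm v := by
    rw [← hcard, l2Norm, ← Real.sqrt_mul (Nat.cast_nonneg _)]
    refine Real.le_sqrt_of_sq_le ?_
    refine (sq_sum_le_card_mul_sum_sq (s := S) (f := fun i => |v i|)).trans ?_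
    refine mul_le_mul_of_nonneg_left ?_ (Nat.cast_nonneg _)
    simp only [sq_abs]
    exact Finset.sum_le_sum_of_subset_of_nonneg (Finset.subset_univ _) fun _ _ _ => sq_nonneg _
  have hquad : 0 ≤ (n : ℝ)⁻¹ * l2Norm (U *ᵥ v) ^ 2 := by positivity
  rw [mul_inv] at h0
  have hl1' := mul_le_mul_of_nonneg_left hl1 hlam.le
  rw [hsplit] at hg
  have key : (n : ℝ)⁻¹ * l2Norm (U *ᵥ v) ^ 2 + lam * a2 ≤ 3 * lam * a1 := by linarith
  have hcone : a2 ≤ 3 * a1 := by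
    by_contra hcon; push Not at hcon; nlinarith
  have hb1 : l1Norm v ≤ 4 * Real.sqrt (l0Norm b) * l2Norm v := by
    rw [hsplit]; linarith
  have ha2n : 0 ≤ a2 := Finset.sum_nonneg fun _ _ => abs_nonneg _
  have hre := hRE v hb1
  have h3 : c * l2Norm v ^ 2 ≤ 3 * lam * (Real.sqrt (l0Norm b) * l2Norm v) := by
    have : 3 * lam * a1 ≤ 3 * lam * (Real.sqrt (l0Norm b) * l2Norm v) := by gcongr
    nlinarith [mul_nonneg hlam.le ha2n]
  have hs := Real.sqrt_nonneg (l0Norm b : ℝ)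
  have h4 : l2Norm v ≤ 3 / c * (lam * Real.sqrt (l0Norm b)) := by
    rw [div_mul_eq_mul_div, le_div_iff₀ hc]
    rcases (l2Norm_nonneg v).eq_or_lt with h | h
    · rw [← h]; simp only [zero_mul]; positivity
    · nlinarith
  refine ⟨h4, hb1.trans ?_⟩
  calc 4 * Real.sqrt (l0Norm b) * l2Norm v
      ≤ 4 * Real.sqrt (l0Norm b) * (3 / c * (lam * Real.sqrt (l0Norm b))) := by gcongr
    _ = 12 / c * (lam * (Real.sqrt (l0Norm b) * Real.sqrt (l0Norm b))) := by ring
    _ = _ := by rw [Real.mul_self_sqrt (Nat.cast_nonneg _)]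

end

noncomputable section

/-! Symmetric matrices -/

theorem exists_orthogonal_diagonalization {k : ℕ} {A : Matrix (Fin k) (Fin k) ℝ} (hA : Aᵀ = A) :
    ∃ (R : Matrix (Fin k) (Fin k) ℝ) (d : Fin k → ℝ), Rᵀ * R = 1 ∧ R * Rᵀ = 1 ∧
      Rᵀ * A * R = diagonal d ∧ ∀ i, d i ∈ spectrum ℝ A := by
  have hH : A.IsHermitian := by rw [IsHermitian, conjTranspose_eq_transpose_of_trivial, hA]
  refine ⟨hH.eigenvectorUnitary, hH.eigenvalues, ?_, ?_, ?_, hH.eigenvalues_mem_spectrum_real⟩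
  · have := (mem_unitaryGroup_iff').1 hH.eigenvectorUnitary.2
    rwa [star_eq_conjTranspose, conjTranspose_eq_transpose_of_trivial] at this
  · have := (mem_unitaryGroup_iff).1 hH.eigenvectorUnitary.2
    rwa [star_eq_conjTranspose, conjTranspose_eq_transpose_of_trivial] at this
  · have := hH.conjStarAlgAut_star_eigenvectorUnitary
    rw [Unitary.conjStarAlgAut_star_apply, star_eq_conjTranspose,
      conjTranspose_eq_transpose_of_trivial] at this
    rw [this]; rfl

theorem dotProduct_mulVec_mul {m k : ℕ} (A : Matrix (Fin m) (Fin m) ℝ)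
    (R : Matrix (Fin m) (Fin k) ℝ) (v : Fin k → ℝ) :
    (R *ᵥ v) ⬝ᵥ A *ᵥ (R *ᵥ v) = v ⬝ᵥ (Rᵀ * A * R) *ᵥ v := by
  rw [mulVec_dotProduct, mulVec_mulVec, mulVec_mulVec, Matrix.mul_assoc]

theorem dotProduct_self_mulVec {m k : ℕ} (R : Matrix (Fin m) (Fin k) ℝ) (v : Fin k → ℝ) :
    (R *ᵥ v) ⬝ᵥ (R *ᵥ v) = v ⬝ᵥ (Rᵀ * R) *ᵥ v := by
  rw [mulVec_dotProduct, mulVec_mulVec]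

theorem dotProduct_diagonal_mulVec {k : ℕ} (d v : Fin k → ℝ) :
    v ⬝ᵥ diagonal d *ᵥ v = ∑ i, d i * v i ^ 2 := by
  simp only [dotProduct, mulVec_diagonal]
  exact Finset.sum_congr rfl fun i _ => by ring

theorem mul_l2Norm_sq_le_of_spectrum {k : ℕ} {A : Matrix (Fin k) (Fin k) ℝ} (hA : Aᵀ = A) {c : ℝ}
    (h : ∀ r ∈ spectrum ℝ A, c ≤ r) (v : Fin k → ℝ) : c * l2Norm v ^ 2 ≤ v ⬝ᵥ A *ᵥ v := by
  obtain ⟨R, d, h1, h2, h3, h4⟩ := exists_orthogonal_diagonalization hA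
  obtain ⟨w, rfl⟩ : ∃ w, v = R *ᵥ w := ⟨Rᵀ *ᵥ v, by rw [mulVec_mulVec, h2, one_mulVec]⟩
  rw [l2Norm_sq, dotProduct_mulVec_mul, dotProduct_self_mulVec, h1, h3, one_mulVec,
    dotProduct_diagonal_mulVec, ← l2Norm_sq, l2Norm_sq', Finset.mul_sum]
  exact Finset.sum_le_sum fun i _ => mul_le_mul_of_nonneg_right (h _ (h4 i)) (sq_nonneg _)

theorem le_mul_l2Norm_sq_of_spectrum {k : ℕ} {A : Matrix (Fin k) (Fin k) ℝ} (hA : Aᵀ = A) {c : ℝ}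
    (h : ∀ r ∈ spectrum ℝ A, r ≤ c) (v : Fin k → ℝ) : v ⬝ᵥ A *ᵥ v ≤ c * l2Norm v ^ 2 := by
  obtain ⟨R, d, h1, h2, h3, h4⟩ := exists_orthogonal_diagonalization hA
  obtain ⟨w, rfl⟩ : ∃ w, v = R *ᵥ w := ⟨Rᵀ *ᵥ v, by rw [mulVec_mulVec, h2, one_mulVec]⟩
  rw [l2Norm_sq, dotProduct_mulVec_mul, dotProduct_self_mulVec, h1, h3, one_mulVec,
    dotProduct_diagonal_mulVec, ← l2Norm_sq, l2Norm_sq', Finset.mul_sum]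
  exact Finset.sum_le_sum fun i _ => mul_le_mul_of_nonneg_right (h _ (h4 i)) (sq_nonneg _)

/-- A positive definite matrix can be whitened by an invertible matrix. -/
theorem exists_whitening {k : ℕ} {A : Matrix (Fin k) (Fin k) ℝ} (hA : Aᵀ = A)
    (hpos : ∀ v, v ≠ 0 → 0 < v ⬝ᵥ A *ᵥ v) :
    ∃ T C : Matrix (Fin k) (Fin k) ℝ, T * C = 1 ∧ C * T = 1 ∧ Tᵀ * A * T = 1 := by
  obtain ⟨R, d, h1, h2, h3, -⟩ := exists_orthogonal_diagonalization hA
  have hd : ∀ i, 0 < d i := by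
    intro i
    have hne : R *ᵥ (Pi.single i 1) ≠ 0 := by
      intro h0
      have : Rᵀ *ᵥ (R *ᵥ (Pi.single i (1 : ℝ))) = 0 := by rw [h0, mulVec_zero]
      rw [mulVec_mulVec, h1, one_mulVec] at this
      have := congrFun this i
      simp at this
    have := hpos _ hne
    rw [dotProduct_mulVec_mul, h3, dotProduct_diagonal_mulVec] at this
    simpa [Pi.single_apply] using this
  have e1 : diagonal (fun i => (Real.sqrt (d i))⁻¹) * diagonal (fun i => Real.sqrt (d i)) = 1 := by
    rw [diagonal_mul_diagonal, ← diagonal_one]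
    congr 1; ext i
    exact inv_mul_cancel₀ (Real.sqrt_pos.2 (hd i)).ne'
  have e2 : diagonal (fun i => Real.sqrt (d i)) * diagonal (fun i => (Real.sqrt (d i))⁻¹) = 1 := by
    rw [diagonal_mul_diagonal, ← diagonal_one]
    congr 1; ext i
    exact mul_inv_cancel₀ (Real.sqrt_pos.2 (hd i)).ne'
  refine ⟨R * diagonal fun i => (Real.sqrt (d i))⁻¹, (diagonal fun i => Real.sqrt (d i)) * Rᵀ,
    ?_, ?_, ?_⟩
  · rw [Matrix.mul_assoc, ← Matrix.mul_assoc (diagonal _), e1, Matrix.one_mul, h2]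
  · rw [Matrix.mul_assoc, ← Matrix.mul_assoc Rᵀ, h1, Matrix.one_mul, e2]
  · rw [transpose_mul, diagonal_transpose, Matrix.mul_assoc, Matrix.mul_assoc, ← Matrix.mul_assoc A,
      ← Matrix.mul_assoc Rᵀ, ← Matrix.mul_assoc Rᵀ, h3, diagonal_mul_diagonal,
      diagonal_mul_diagonal, ← diagonal_one]
    congr 1; ext i
    have := (Real.sqrt_pos.2 (hd i)).ne'
    have h5 := Real.mul_self_sqrt (hd i).le
    field_simp
    rw [sq, h5]

/-! The Frobenius norm -/

theorem frobSq_eq_trace {m k : ℕ} (A : Matrix (Fin m) (Fin k) ℝ) : frobSq A = (Aᵀ * A).trace := by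
  simp only [frobSq, trace, diag, mul_apply, transpose_apply]
  rw [Finset.sum_comm]
  exact Finset.sum_congr rfl fun _ _ => Finset.sum_congr rfl fun _ _ => sq _

theorem frobSq_nonneg {m k : ℕ} (A : Matrix (Fin m) (Fin k) ℝ) : 0 ≤ frobSq A :=
  Finset.sum_nonneg fun _ _ => Finset.sum_nonneg fun _ _ => sq_nonneg _

theorem frobSq_eq_zero {m k : ℕ} {A : Matrix (Fin m) (Fin k) ℝ} (h : frobSq A = 0) : A = 0 := by
  have h1 := (Finset.sum_eq_zero_iff_of_nonneg
    fun i _ => Finset.sum_nonneg fun j _ => sq_nonneg (A i j)).1 h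
  ext i j
  have := (Finset.sum_eq_zero_iff_of_nonneg fun j _ => sq_nonneg (A i j)).1
    (h1 i (Finset.mem_univ i)) j (Finset.mem_univ j)
  simpa using this

theorem frobSq_transpose {m k : ℕ} (A : Matrix (Fin m) (Fin k) ℝ) : frobSq Aᵀ = frobSq A :=
  Finset.sum_comm

theorem frobSq_add {m k : ℕ} (A B : Matrix (Fin m) (Fin k) ℝ) :
    frobSq (A + B) = frobSq A + 2 * (Aᵀ * B).trace + frobSq B := by
  have : (Bᵀ * A).trace = (Aᵀ * B).trace := by
    rw [← trace_transpose, transpose_mul, transpose_transpose]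
  simp only [frobSq_eq_trace, transpose_add, Matrix.add_mul, Matrix.mul_add, trace_add, this]
  ring

theorem frobSq_smul {m k : ℕ} (t : ℝ) (A : Matrix (Fin m) (Fin k) ℝ) :
    frobSq (t • A) = t ^ 2 * frobSq A := by
  simp [frobSq, mul_pow, Finset.mul_sum]

/-- First-order optimality: a residual that cannot be shortened along a direction is orthogonal to
it. Both normal equations for the factor estimates follow from this. -/
theorem trace_eq_zero_of_frobSq_le {m k : ℕ} {R A : Matrix (Fin m) (Fin k) ℝ}
    (h : ∀ t : ℝ, frobSq R ≤ frobSq (R - t • A)) : (Rᵀ * A).trace = 0 := by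
  have h1 : ∀ t : ℝ, 0 ≤ t ^ 2 * frobSq A - 2 * t * (Rᵀ * A).trace := by
    intro t
    have := h t
    rw [sub_eq_add_neg, ← neg_smul, frobSq_add, frobSq_smul, Matrix.mul_smul, trace_smul,
      smul_eq_mul]
      at this
    linarith
  set b := (Rᵀ * A).trace
  have ha := frobSq_nonneg A
  by_contra hb
  -- Essentially the minimiser of the parabola in t; the added 1 covers `A = 0`.
  have h2 := h1 (b / (frobSq A + 1))
  have h3 : (b / (frobSq A + 1)) ^ 2 * frobSq A - 2 * (b / (frobSq A + 1)) * b =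
      -(b ^ 2 * (frobSq A + 2) / (frobSq A + 1) ^ 2) := by field_simp; ring
  rw [h3] at h2
  have : 0 < b ^ 2 * (frobSq A + 2) / (frobSq A + 1) ^ 2 := by positivity
  linarith

theorem abs_trace_le {m k : ℕ} (A B : Matrix (Fin m) (Fin k) ℝ) :
    |(Aᵀ * B).trace| ≤ Real.sqrt (frobSq A) * Real.sqrt (frobSq B) := by
  have h1 : ∀ C : Matrix (Fin m) (Fin k) ℝ, frobSq C = ∑ q : Fin m × Fin k, C q.1 q.2 ^ 2 :=
    fun C => (Fintype.sum_prod_type fun q : Fin m × Fin k => C q.1 q.2 ^ 2).symm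
  have h2 : (Aᵀ * B).trace = ∑ q : Fin m × Fin k, A q.1 q.2 * B q.1 q.2 := by
    rw [Fintype.sum_prod_type, Finset.sum_comm]; rfl
  rw [h1, h1, h2, ← Real.sqrt_mul (Finset.sum_nonneg fun _ _ => sq_nonneg _)]
  exact Real.abs_le_sqrt (Finset.sum_mul_sq_le_sq_mul_sq _ _ _)

theorem l2Norm_mulVec_le_frobSq {m k : ℕ} (A : Matrix (Fin m) (Fin k) ℝ) (v : Fin k → ℝ) :
    l2Norm (A *ᵥ v) ≤ Real.sqrt (frobSq A) * l2Norm v := by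
  refine l2Norm_le_of_sq (mul_nonneg (Real.sqrt_nonneg _) (l2Norm_nonneg _)) ?_
  rw [mul_pow, Real.sq_sqrt (frobSq_nonneg A), ← l2Norm_sq, l2Norm_sq', l2Norm_sq', frobSq,
    Finset.sum_mul]
  refine Finset.sum_le_sum fun i _ => ?_
  rw [← l2Norm_sq' v, l2Norm_sq' v]
  exact Finset.sum_mul_sq_le_sq_mul_sq Finset.univ (A i) v

theorem frobSq_mul_le {m k l : ℕ} {A : Matrix (Fin m) (Fin k) ℝ} {L : ℝ}
    (h : ∀ v, l2Norm (A *ᵥ v) ≤ L * l2Norm v) (B : Matrix (Fin k) (Fin l) ℝ) :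
    frobSq (A * B) ≤ L ^ 2 * frobSq B := by
  rw [← frobSq_transpose, ← frobSq_transpose B, frobSq, frobSq, Finset.mul_sum]
  refine Finset.sum_le_sum fun j _ => ?_
  have h1 := h (fun i => B i j)
  have h2 := pow_le_pow_left₀ (l2Norm_nonneg _) h1 2
  rw [mul_pow, l2Norm_sq', l2Norm_sq'] at h2
  exact h2

theorem frobSq_of_transpose_mul_self {m k : ℕ} {A : Matrix (Fin m) (Fin k) ℝ} {c : ℝ}
    (h : Aᵀ * A = c • (1 : Matrix (Fin k) (Fin k) ℝ)) : frobSq A = c * k := by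
  rw [frobSq_eq_trace, h, trace_smul, trace_one, smul_eq_mul, Fintype.card_fin]

/-! The principal component estimates of factors and loadings -/

/-- The least squares factor estimates are optimal among all factor and loading matrices. -/
theorem IsFactorEstimate.frobSq_le {n p K : ℕ} (hn : 0 < n) {X : Matrix (Fin n) (Fin p) ℝ}
    {Fh : Matrix (Fin n) (Fin K) ℝ} {Bh : Matrix (Fin p) (Fin K) ℝ}
    (h : IsFactorEstimate X Fh Bh) (F : Matrix (Fin n) (Fin K) ℝ) (B : Matrix (Fin p) (Fin K) ℝ)
    (hF : ∀ v, v ≠ 0 → 0 < l2Norm (F *ᵥ v)) :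
    frobSq (X - Fh * Bhᵀ) ≤ frobSq (X - F * Bᵀ) := by
  have hn' : (0 : ℝ) < n := by exact_mod_cast hn
  -- The constraints only choose a representative of the product F Bᵀ: `T` whitens the factors, its
  -- inverse `C` moves to the loadings, and a rotation `R` of both makes the loading Gram matrix
  -- diagonal.
  obtain ⟨T, C, hTC, hCT, hT⟩ := exists_whitening (A := (n : ℝ)⁻¹ • (Fᵀ * F))
    (by rw [transpose_smul, transpose_mul, transpose_transpose]) (fun v hv => by
      rw [smul_mulVec, dotProduct_smul, ← dotProduct_self_mulVec, ← l2Norm_sq, smul_eq_mul]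
      have := hF v hv
      positivity)
  obtain ⟨R, d, h1, h2, h3, -⟩ := exists_orthogonal_diagonalization
    (A := (B * Cᵀ)ᵀ * (B * Cᵀ)) (by rw [transpose_mul, transpose_transpose])
  have hfeas : FactorFeasible (F * T * R) (B * Cᵀ * R) := by
    constructor
    · have : (n : ℝ)⁻¹ • ((F * T * R)ᵀ * (F * T * R)) =
          Rᵀ * (Tᵀ * ((n : ℝ)⁻¹ • (Fᵀ * F)) * T) * R := by
        simp only [transpose_mul, Matrix.mul_assoc, Matrix.smul_mul, Matrix.mul_smul]
      rw [this, hT, Matrix.mul_one, h1]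
    · have : (B * Cᵀ * R)ᵀ * (B * Cᵀ * R) = diagonal d := by
        rw [← h3, transpose_mul _ R]; simp only [Matrix.mul_assoc]
      rw [this]; exact isDiag_diagonal d
  have := h.2 _ _ hfeas
  have e : F * T * R * (B * Cᵀ * R)ᵀ = F * Bᵀ := by
    rw [transpose_mul, transpose_mul, transpose_transpose, Matrix.mul_assoc (F * T),
      ← Matrix.mul_assoc R, h2, Matrix.one_mul, Matrix.mul_assoc, ← Matrix.mul_assoc T, hTC,
      Matrix.one_mul]
  rwa [e] at this

theorem l2Norm_pos {m : ℕ} {v : Fin m → ℝ} (hv : v ≠ 0) : 0 < l2Norm v :=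
  lt_of_le_of_ne (l2Norm_nonneg v) fun h => hv (l2Norm_eq_zero h.symm)

section

variable {n p K : ℕ} {X : Matrix (Fin n) (Fin p) ℝ} {Fh : Matrix (Fin n) (Fin K) ℝ}
  {Bh : Matrix (Fin p) (Fin K) ℝ}

theorem IsFactorEstimate.gram (hn : 0 < n) (h : IsFactorEstimate X Fh Bh) :
    Fhᵀ * Fh = (n : ℝ) • (1 : Matrix (Fin K) (Fin K) ℝ) := by
  have hn' : (n : ℝ) ≠ 0 := by exact_mod_cast hn.ne'
  rw [← h.1.1, smul_smul, mul_inv_cancel₀ hn', one_smul]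

theorem IsFactorEstimate.l2Norm_mulVec (hn : 0 < n) (h : IsFactorEstimate X Fh Bh)
    (v : Fin K → ℝ) : l2Norm (Fh *ᵥ v) = Real.sqrt n * l2Norm v := by
  have : l2Norm (Fh *ᵥ v) ^ 2 = (Real.sqrt n * l2Norm v) ^ 2 := by
    rw [l2Norm_sq, dotProduct_self_mulVec, h.gram hn, smul_mulVec, one_mulVec, dotProduct_smul,
      smul_eq_mul, mul_pow, Real.sq_sqrt (Nat.cast_nonneg n), l2Norm_sq]
  exact (pow_left_inj₀ (l2Norm_nonneg _)
    (mul_nonneg (Real.sqrt_nonneg _) (l2Norm_nonneg _)) two_ne_zero).1 this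

/-- Normal equations for the loadings. -/
theorem IsFactorEstimate.loadings (hn : 0 < n) (h : IsFactorEstimate X Fh Bh) :
    Bhᵀ = (n : ℝ)⁻¹ • (Fhᵀ * X) := by
  have hn' : (0 : ℝ) < n := by exact_mod_cast hn
  have h0 : Fhᵀ * (X - Fh * Bhᵀ) = 0 := by
    apply frobSq_eq_zero
    rw [frobSq_eq_trace, transpose_mul, transpose_transpose, Matrix.mul_assoc]
    apply trace_eq_zero_of_frobSq_le
    intro t
    have := h.frobSq_le hn Fh (Bh + t • ((X - Fh * Bhᵀ)ᵀ * Fh)) fun v hv => by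
      rw [h.l2Norm_mulVec hn]
      have := l2Norm_pos hv
      positivity
    refine this.trans_eq (congrArg frobSq ?_)
    rw [transpose_add, transpose_smul, transpose_mul _ Fh, transpose_transpose, Matrix.mul_add,
      Matrix.mul_smul, sub_add_eq_sub_sub]
  rw [Matrix.mul_sub, ← Matrix.mul_assoc, h.gram hn, Matrix.smul_mul, Matrix.one_mul,
    sub_eq_zero] at h0
  rw [h0, smul_smul, inv_mul_cancel₀ hn'.ne', one_smul]

/-- The residual matrix is the projection of the data off the estimated factors. -/
theorem IsFactorEstimate.residual (hn : 0 < n) (h : IsFactorEstimate X Fh Bh) :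
    X - Fh * Bhᵀ = (1 - (n : ℝ)⁻¹ • (Fh * Fhᵀ)) * X := by
  rw [h.loadings hn, Matrix.sub_mul, Matrix.one_mul, Matrix.mul_smul, Matrix.smul_mul,
    Matrix.mul_assoc]

theorem IsFactorEstimate.transpose_mul_proj (hn : 0 < n) (h : IsFactorEstimate X Fh Bh) :
    Fhᵀ * (1 - (n : ℝ)⁻¹ • (Fh * Fhᵀ)) = 0 := by
  have hn' : (n : ℝ) ≠ 0 := by exact_mod_cast hn.ne'
  rw [Matrix.mul_sub, Matrix.mul_one, Matrix.mul_smul, ← Matrix.mul_assoc, h.gram hn,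
    Matrix.smul_mul, Matrix.one_mul, smul_smul, inv_mul_cancel₀ hn', one_smul, sub_self]

theorem transpose_proj (Fh : Matrix (Fin n) (Fin K) ℝ) :
    (1 - (n : ℝ)⁻¹ • (Fh * Fhᵀ))ᵀ = 1 - (n : ℝ)⁻¹ • (Fh * Fhᵀ) := by
  simp [transpose_sub, transpose_smul, transpose_mul]

theorem IsFactorEstimate.proj_mul_proj (hn : 0 < n) (h : IsFactorEstimate X Fh Bh) :
    (1 - (n : ℝ)⁻¹ • (Fh * Fhᵀ)) * (1 - (n : ℝ)⁻¹ • (Fh * Fhᵀ)) = 1 - (n : ℝ)⁻¹ • (Fh * Fhᵀ) := by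
  nth_rewrite 1 [Matrix.sub_mul]
  rw [Matrix.one_mul, Matrix.smul_mul, Matrix.mul_assoc, h.transpose_mul_proj hn, Matrix.mul_zero,
    smul_zero, sub_zero]

/-- Normal equations for the factors. -/
theorem IsFactorEstimate.residual_mul_loadings (hn : 0 < n) (h : IsFactorEstimate X Fh Bh) :
    (1 - (n : ℝ)⁻¹ • (Fh * Fhᵀ)) * X * Bh = 0 := by
  have hn' : (0 : ℝ) < n := by exact_mod_cast hn
  rw [← h.residual hn]
  set R := X - Fh * Bhᵀ with hR
  apply frobSq_eq_zero
  have horth : Fhᵀ * (R * Bh) = 0 := by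
    rw [hR, h.residual hn, ← Matrix.mul_assoc, ← Matrix.mul_assoc, h.transpose_mul_proj hn,
      Matrix.zero_mul, Matrix.zero_mul]
  have horth' : (R * Bh)ᵀ * Fh = 0 := by
    have := congrArg transpose horth
    rwa [transpose_mul Fhᵀ, transpose_transpose, transpose_zero] at this
  have : ((R * Bh)ᵀ * (R * Bh)).trace = (Rᵀ * (R * Bh * Bhᵀ)).trace := by
    rw [transpose_mul R, Matrix.mul_assoc, trace_mul_comm, Matrix.mul_assoc]
  rw [frobSq_eq_trace, this]
  apply trace_eq_zero_of_frobSq_le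
  intro t
  -- The comparison needs perturbed factors of full column rank. The perturbation is orthogonal to
  -- the columns of `Fh`, so their Gram matrix is n I plus a positive semidefinite matrix.
  have := h.frobSq_le hn (Fh + t • (R * Bh)) Bh fun v hv => by
    have h1 : (Fh + t • (R * Bh))ᵀ * (Fh + t • (R * Bh)) =
        (n : ℝ) • (1 : Matrix (Fin K) (Fin K) ℝ) + (t • (R * Bh))ᵀ * (t • (R * Bh)) := by
      rw [transpose_add, Matrix.add_mul, Matrix.mul_add, Matrix.mul_add, h.gram hn,
        transpose_smul, Matrix.mul_smul _ t, horth, Matrix.smul_mul, horth']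
      simp
    have h2 : l2Norm ((Fh + t • (R * Bh)) *ᵥ v) ^ 2 =
        n * l2Norm v ^ 2 + l2Norm ((t • (R * Bh)) *ᵥ v) ^ 2 := by
      rw [l2Norm_sq, dotProduct_self_mulVec, h1, add_mulVec, dotProduct_add, smul_mulVec,
        one_mulVec, dotProduct_smul, smul_eq_mul, l2Norm_sq, l2Norm_sq, dotProduct_self_mulVec]
    have h3 := l2Norm_pos hv
    have h4 : 0 < l2Norm ((Fh + t • (R * Bh)) *ᵥ v) ^ 2 := by rw [h2]; positivity
    exact lt_of_le_of_ne (l2Norm_nonneg _) fun h5 => by rw [← h5] at h4; simp at h4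
  refine this.trans_eq (congrArg frobSq ?_)
  rw [Matrix.add_mul, Matrix.smul_mul, sub_add_eq_sub_sub]

/-- The estimated factors capture the span of the true factors, up to an error governed by the
operator norm of the idiosyncratic components. -/
theorem IsFactorEstimate.frobSq_proj_factors_le {F : Matrix (Fin n) (Fin K) ℝ}
    {B : Matrix (Fin p) (Fin K) ℝ} {U : Matrix (Fin n) (Fin p) ℝ} (hn : 0 < n)
    (h : IsFactorEstimate (F * Bᵀ + U) Fh Bh)
    (hF : ∀ v, v ≠ 0 → 0 < l2Norm (F *ᵥ v)) (hB : ∀ v, v ≠ 0 → 0 < l2Norm (B *ᵥ v)) {L : ℝ}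
    (hL : 0 ≤ L) (hU : ∀ v, l2Norm (U *ᵥ v) ≤ L * l2Norm v) :
    Real.sqrt (frobSq ((1 - (n : ℝ)⁻¹ • (Fh * Fhᵀ)) * F * Bᵀ)) ≤ 3 * (Real.sqrt K * L) := by
  have hn' : (0 : ℝ) < n := by exact_mod_cast hn
  -- This says ‖Q(FBᵀ + U)‖² ≤ ‖U‖² in Frobenius norm. Projecting U loses only n⁻¹‖Uᵀ F̂‖² ≤ K L²,
  -- so the leakage must be balanced by its cross term with U.
  have hcmp := h.frobSq_le hn F B hF
  rw [h.residual hn, add_sub_cancel_left] at hcmp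
  have hQQ := h.proj_mul_proj hn
  have hQt := transpose_proj (n := n) Fh
  have hQU : frobSq ((1 - (n : ℝ)⁻¹ • (Fh * Fhᵀ)) * U) =
      frobSq U - (n : ℝ)⁻¹ * frobSq (Uᵀ * Fh) := by
    rw [frobSq_eq_trace, transpose_mul, hQt, Matrix.mul_assoc, ← Matrix.mul_assoc _ _ U, hQQ,
      Matrix.sub_mul, Matrix.mul_sub, Matrix.one_mul, trace_sub, frobSq_eq_trace,
      ← frobSq_transpose, frobSq_eq_trace, transpose_mul, transpose_transpose]
    simp only [Matrix.smul_mul, Matrix.mul_smul, trace_smul, smul_eq_mul, Matrix.mul_assoc]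
    rw [transpose_mul Fhᵀ, transpose_transpose, Matrix.mul_assoc]
  set Q := 1 - (n : ℝ)⁻¹ • (Fh * Fhᵀ) with hQ
  have hFrob : frobSq (Uᵀ * Fh) ≤ L ^ 2 * (n * K) := by
    rw [← frobSq_of_transpose_mul_self (h.gram hn)]
    exact frobSq_mul_le (l2Norm_transpose_mulVec_le hL hU) Fh
  -- `E = B T` is an orthonormal basis of the column space of B. The cross term then meets U only
  -- through U E, whose squared Frobenius norm is at most K L², whatever p is.
  obtain ⟨T, C, hTC, hCT, hT⟩ := exists_whitening (A := Bᵀ * B)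
    (by rw [transpose_mul, transpose_transpose]) (fun v hv => by
      rw [← dotProduct_self_mulVec, ← l2Norm_sq]
      have := hB v hv
      positivity)
  set E := B * T with hE
  have hEE : Eᵀ * E = 1 := by rw [← hT, hE, transpose_mul]; simp only [Matrix.mul_assoc]
  have hBE : B = E * C := by rw [hE, Matrix.mul_assoc, hTC, Matrix.mul_one]
  have hN : Q * F * Bᵀ = Q * F * Cᵀ * Eᵀ := by
    rw [hBE, transpose_mul]; simp only [Matrix.mul_assoc]
  have hNfrob : frobSq (Q * F * Bᵀ) = frobSq (Q * F * Cᵀ) := by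
    rw [hN, ← frobSq_transpose, frobSq_eq_trace, transpose_transpose, transpose_mul _ Eᵀ,
      transpose_transpose, Matrix.mul_assoc, ← Matrix.mul_assoc Eᵀ, hEE, Matrix.one_mul,
      ← frobSq_transpose, frobSq_eq_trace, transpose_transpose]
  have hUE : frobSq (U * E) ≤ L ^ 2 * K := by
    refine (frobSq_mul_le hU E).trans_eq ?_
    rw [frobSq_of_transpose_mul_self (c := 1) (by rw [hEE, one_smul]), one_mul]
  have hcross : ((Q * F * Bᵀ)ᵀ * (Q * U)).trace = ((Q * F * Cᵀ)ᵀ * (U * E)).trace := by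
    have e1 : (Q * F * Bᵀ)ᵀ * (Q * U) = E * ((Q * F * Cᵀ)ᵀ * U) := by
      rw [hN, transpose_mul _ Eᵀ, transpose_transpose, Matrix.mul_assoc]
      congr 1
      rw [Matrix.mul_assoc Q, transpose_mul, hQt, Matrix.mul_assoc, Matrix.mul_assoc,
        ← Matrix.mul_assoc Q Q, hQQ]
    rw [e1, trace_mul_comm, Matrix.mul_assoc]
  have hexp : frobSq (Q * (F * Bᵀ + U)) = frobSq (Q * F * Bᵀ) +
      2 * ((Q * F * Cᵀ)ᵀ * (U * E)).trace + (frobSq U - (n : ℝ)⁻¹ * frobSq (Uᵀ * Fh)) := by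
    rw [Matrix.mul_add, ← Matrix.mul_assoc, frobSq_add, hcross, hQU]
  have habs := abs_trace_le (Q * F * Cᵀ) (U * E)
  rw [← hNfrob] at habs
  set a := Real.sqrt (frobSq (Q * F * Bᵀ)) with ha
  have ha0 : 0 ≤ a := Real.sqrt_nonneg _
  have ha2 : a ^ 2 = frobSq (Q * F * Bᵀ) := Real.sq_sqrt (frobSq_nonneg _)
  set b := Real.sqrt K * L with hb
  have hb0 : 0 ≤ b := mul_nonneg (Real.sqrt_nonneg _) hL
  have hb2 : b ^ 2 = L ^ 2 * K := by
    rw [hb, mul_pow, Real.sq_sqrt (Nat.cast_nonneg K), mul_comm]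
  have hUE' : Real.sqrt (frobSq (U * E)) ≤ b := by
    rw [← Real.sqrt_sq hb0]; exact Real.sqrt_le_sqrt (by rw [hb2]; exact hUE)
  have h1 : |((Q * F * Cᵀ)ᵀ * (U * E)).trace| ≤ a * b :=
    habs.trans (mul_le_mul_of_nonneg_left hUE' ha0)
  have h2 : (n : ℝ)⁻¹ * frobSq (Uᵀ * Fh) ≤ b ^ 2 := by
    rw [inv_mul_le_iff₀ hn', hb2]; linarith
  have h3 := (abs_le.1 h1).1
  have h4 : a ^ 2 ≤ 2 * (a * b) + b ^ 2 := by rw [ha2]; linarith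
  -- The inequality a² ≤ 2ab + b² forces a ≤ (1 + √2) b, which is less than 3b unless b = 0.
  by_contra hcon
  push Not at hcon
  nlinarith

end

end

/-! ### Deterministic analysis of the estimated factors and loadings. -/

noncomputable section

/-- Deterministic size conditions on factors `F`, loadings `B`, idiosyncratic components `U` and
regression errors `e`, at the scales `r` (sampling error) and `h` (factor estimation error). -/
structure FactorDesign {n p K : ℕ} (C h r : ℝ) (F : Matrix (Fin n) (Fin K) ℝ)
    (B : Matrix (Fin p) (Fin K) ℝ) (U : Matrix (Fin n) (Fin p) ℝ) (e : Fin n → ℝ) : Prop where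
  one_le : 1 ≤ C
  card_le : Real.sqrt K ≤ C
  r_nonneg : 0 ≤ r
  r_le : r ≤ h
  inv_le : (Real.sqrt p)⁻¹ ≤ h
  small : 6 * C ^ 4 * h ≤ 1
  op_U : ∀ v, l2Norm (U *ᵥ v) ≤ C * (Real.sqrt n * Real.sqrt p * h) * l2Norm v
  F_upper : ∀ v, l2Norm (F *ᵥ v) ≤ 2 * Real.sqrt n * l2Norm v
  F_lower : ∀ v, (n : ℝ) / 2 * l2Norm v ^ 2 ≤ l2Norm (F *ᵥ v) ^ 2
  B_upper : ∀ v, l2Norm (B *ᵥ v) ≤ C * Real.sqrt p * l2Norm v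
  B_lower : ∀ v, Real.sqrt p / C * l2Norm v ≤ l2Norm (B *ᵥ v)
  B_row : ∀ j, l2Norm (B j) ≤ C
  U_col : ∀ j, l2Norm (Uᵀ j) ≤ C * Real.sqrt n
  FU : ∀ j, l2Norm (Fᵀ *ᵥ Uᵀ j) ≤ C * (n * r)
  BUU : ∀ j, l2Norm (Bᵀ *ᵥ (Uᵀ *ᵥ Uᵀ j)) ≤ C * (n * (1 + Real.sqrt p * r))
  Ue : ∀ j, |Uᵀ j ⬝ᵥ e| ≤ C * (n * r)
  Fe : l2Norm (Fᵀ *ᵥ e) ≤ C * (n * r)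
  e_norm : l2Norm e ≤ C * Real.sqrt n

/-- The projection off the estimated factors. -/
def projOff {n K : ℕ} (Fh : Matrix (Fin n) (Fin K) ℝ) : Matrix (Fin n) (Fin n) ℝ :=
  1 - (n : ℝ)⁻¹ • (Fh * Fhᵀ)

section

variable {n p K : ℕ} {X : Matrix (Fin n) (Fin p) ℝ} {F Fh : Matrix (Fin n) (Fin K) ℝ}
  {B Bh : Matrix (Fin p) (Fin K) ℝ} {U : Matrix (Fin n) (Fin p) ℝ} {e : Fin n → ℝ} {C h r : ℝ}

theorem dotProduct_projOff (Fh : Matrix (Fin n) (Fin K) ℝ) (v w : Fin n → ℝ) :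
    v ⬝ᵥ projOff Fh *ᵥ w = v ⬝ᵥ w - (n : ℝ)⁻¹ * ((Fhᵀ *ᵥ v) ⬝ᵥ (Fhᵀ *ᵥ w)) := by
  rw [projOff, sub_mulVec, one_mulVec, dotProduct_sub, smul_mulVec, dotProduct_smul, smul_eq_mul,
    mulVec_dotProduct, transpose_transpose, mulVec_mulVec]

theorem projOff_mulVec_dotProduct (Fh : Matrix (Fin n) (Fin K) ℝ) (v w : Fin n → ℝ) :
    (projOff Fh *ᵥ v) ⬝ᵥ w = v ⬝ᵥ projOff Fh *ᵥ w := by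
  rw [mulVec_dotProduct, projOff, transpose_proj]

theorem IsFactorEstimate.projOff_mulVec_projOff (hn : 0 < n) (hest : IsFactorEstimate X Fh Bh)
    (v : Fin n → ℝ) : projOff Fh *ᵥ (projOff Fh *ᵥ v) = projOff Fh *ᵥ v := by
  rw [mulVec_mulVec, projOff, hest.proj_mul_proj hn]

theorem IsFactorEstimate.l2Norm_projOff_sq (hn : 0 < n) (hest : IsFactorEstimate X Fh Bh)
    (v : Fin n → ℝ) :
    l2Norm (projOff Fh *ᵥ v) ^ 2 = l2Norm v ^ 2 - (n : ℝ)⁻¹ * l2Norm (Fhᵀ *ᵥ v) ^ 2 := by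
  rw [l2Norm_sq, projOff_mulVec_dotProduct, hest.projOff_mulVec_projOff hn, dotProduct_projOff,
    l2Norm_sq, l2Norm_sq]

theorem IsFactorEstimate.l2Norm_projOff_le (hn : 0 < n) (hest : IsFactorEstimate X Fh Bh)
    (v : Fin n → ℝ) : l2Norm (projOff Fh *ᵥ v) ≤ l2Norm v := by
  have h1 := hest.l2Norm_projOff_sq hn v
  have h2 : 0 ≤ (n : ℝ)⁻¹ * l2Norm (Fhᵀ *ᵥ v) ^ 2 := by positivity
  exact (pow_le_pow_iff_left₀ (l2Norm_nonneg _) (l2Norm_nonneg _) two_ne_zero).1 (by linarith)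

theorem IsFactorEstimate.l2Norm_transpose_mulVec_le (hn : 0 < n) (hest : IsFactorEstimate X Fh Bh)
    (v : Fin n → ℝ) : l2Norm (Fhᵀ *ᵥ v) ≤ Real.sqrt n * l2Norm v :=
  _root_.l2Norm_transpose_mulVec_le (Real.sqrt_nonneg _) (fun v => (hest.l2Norm_mulVec hn v).le) v

theorem IsFactorEstimate.le_l2Norm_projOff (hn : 0 < n) (hest : IsFactorEstimate X Fh Bh)
    (v : Fin n → ℝ) :
    l2Norm v - l2Norm (Fhᵀ *ᵥ v) / Real.sqrt n ≤ l2Norm (projOff Fh *ᵥ v) := by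
  have hn' : (0 : ℝ) < Real.sqrt n := Real.sqrt_pos.2 (by exact_mod_cast hn)
  have h1 : v = projOff Fh *ᵥ v + (n : ℝ)⁻¹ • (Fh *ᵥ (Fhᵀ *ᵥ v)) := by
    rw [projOff, sub_mulVec, one_mulVec, smul_mulVec, mulVec_mulVec]; abel
  have h2 := l2Norm_add_le (projOff Fh *ᵥ v) ((n : ℝ)⁻¹ • (Fh *ᵥ (Fhᵀ *ᵥ v)))
  rw [← h1, l2Norm_smul, hest.l2Norm_mulVec hn, abs_of_nonneg (by positivity)] at h2
  have h3 : (n : ℝ)⁻¹ * (Real.sqrt n * l2Norm (Fhᵀ *ᵥ v)) = l2Norm (Fhᵀ *ᵥ v) / Real.sqrt n := by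
    nth_rewrite 1 [← Real.mul_self_sqrt (Nat.cast_nonneg n)]
    field_simp
  linarith

namespace FactorDesign

variable (W : FactorDesign C h r F B U e) (hn : 0 < n) (hp : 0 < p)
  (hest : IsFactorEstimate (F * Bᵀ + U) Fh Bh)
include W

theorem C_pos : 0 < C := one_pos.trans_le W.one_le

theorem h_nonneg : 0 ≤ h := W.r_nonneg.trans W.r_le

theorem h_le_one : h ≤ 1 := by
  have h1 := one_le_pow₀ (n := 4) W.one_le
  nlinarith [W.small, W.h_nonneg]

include hp

theorem le_gram_loadings (v : Fin K → ℝ) :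
    p / C ^ 2 * l2Norm v ≤ l2Norm ((Bᵀ * B) *ᵥ v) := by
  have hC := W.C_pos
  have h1 := W.B_lower v
  have h2 : l2Norm (B *ᵥ v) ^ 2 ≤ l2Norm v * l2Norm ((Bᵀ * B) *ᵥ v) := by
    rw [l2Norm_sq, dotProduct_self_mulVec]; exact dotProduct_le_l2Norm _ _
  have h3 : (Real.sqrt p / C * l2Norm v) ^ 2 ≤ l2Norm (B *ᵥ v) ^ 2 :=
    pow_le_pow_left₀ (mul_nonneg (by positivity) (l2Norm_nonneg _)) h1 2
  rw [mul_pow, div_pow, Real.sq_sqrt (Nat.cast_nonneg p)] at h3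
  rcases (l2Norm_nonneg v).eq_or_lt with h0 | h0
  · rw [← h0, mul_zero]; exact l2Norm_nonneg _
  · refine le_of_mul_le_mul_left ?_ h0
    nlinarith

/-- A preimage taken in the range of B has norm of order ‖a‖/√p; through it the strength of the
loadings enters. -/
theorem exists_loadings_preimage (a : Fin K → ℝ) :
    ∃ w, Bᵀ *ᵥ w = a ∧ l2Norm w ≤ C / Real.sqrt p * l2Norm a := by
  have hC := W.C_pos
  have hp' : (0 : ℝ) < p := by exact_mod_cast hp
  obtain ⟨ψ, hψ, -⟩ := exists_mulVec_eq (A := Bᵀ * B) (by positivity) (W.le_gram_loadings hp) a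
  refine ⟨B *ᵥ ψ, by rw [mulVec_mulVec, hψ], ?_⟩
  have h1 : l2Norm (B *ᵥ ψ) ^ 2 ≤ l2Norm ψ * l2Norm a := by
    rw [l2Norm_sq, dotProduct_self_mulVec, hψ]; exact dotProduct_le_l2Norm _ _
  have h2 := W.B_lower ψ
  have hs : 0 < Real.sqrt p := Real.sqrt_pos.2 hp'
  have h3 : l2Norm ψ ≤ C / Real.sqrt p * l2Norm (B *ᵥ ψ) := by
    rw [div_mul_eq_mul_div, le_div_iff₀ hs]
    rw [div_mul_eq_mul_div, div_le_iff₀ hC] at h2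
    linarith
  rcases (l2Norm_nonneg (B *ᵥ ψ)).eq_or_lt with h0 | h0
  · rw [← h0]; exact mul_nonneg (by positivity) (l2Norm_nonneg _)
  · refine le_of_mul_le_mul_left ?_ h0
    nlinarith [mul_le_mul_of_nonneg_right h3 (l2Norm_nonneg a)]

include hn hest

/-- The Frobenius bound on Q F Bᵀ is of order √n √p h; applied to a preimage of a under Bᵀ, of norm
at most C‖a‖/√p, it loses the factor √p. -/
theorem l2Norm_projOff_factors_le (a : Fin K → ℝ) :
    l2Norm (projOff Fh *ᵥ (F *ᵥ a)) ≤ 3 * C ^ 3 * (Real.sqrt n * h) * l2Norm a := by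
  have hC := W.C_pos
  have hh := W.h_nonneg
  have hn' : (0 : ℝ) < n := by exact_mod_cast hn
  have hs : 0 < Real.sqrt p := Real.sqrt_pos.2 (by exact_mod_cast hp)
  have hfrob := hest.frobSq_proj_factors_le hn
    (fun v hv => by
      have h1 := W.F_lower v
      have h2 := l2Norm_pos hv
      have h3 : 0 < l2Norm (F *ᵥ v) ^ 2 := lt_of_lt_of_le (by positivity) h1
      exact lt_of_le_of_ne (l2Norm_nonneg _) fun h5 => by rw [← h5] at h3; simp at h3)
    (fun v hv => lt_of_lt_of_le (mul_pos (by positivity) (l2Norm_pos hv)) (W.B_lower v))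
    (by positivity) W.op_U
  obtain ⟨w, rfl, hw⟩ := W.exists_loadings_preimage hp a
  rw [mulVec_mulVec, mulVec_mulVec]
  have h1 := l2Norm_mulVec_le_frobSq (projOff Fh * F * Bᵀ) w
  refine h1.trans ?_
  calc Real.sqrt (frobSq (projOff Fh * F * Bᵀ)) * l2Norm w
      ≤ (3 * (Real.sqrt K * (C * (Real.sqrt n * Real.sqrt p * h)))) *
          (C / Real.sqrt p * l2Norm (Bᵀ *ᵥ w)) :=
        mul_le_mul hfrob hw (l2Norm_nonneg _) (by positivity)
    _ = 3 * (Real.sqrt K * C ^ 2) * (Real.sqrt n * h) * l2Norm (Bᵀ *ᵥ w) := by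
        field_simp
    _ ≤ 3 * (C * C ^ 2) * (Real.sqrt n * h) * l2Norm (Bᵀ *ᵥ w) := by
        have := W.card_le
        have := l2Norm_nonneg (Bᵀ *ᵥ w)
        gcongr
    _ = _ := by ring

/-- The matrix of empirical inner products of true and estimated factors. -/
theorem factor_overlap_lower (a : Fin K → ℝ) :
    1 / 2 * l2Norm a ≤ l2Norm (((n : ℝ)⁻¹ • (Fᵀ * Fh)) *ᵥ a) := by
  have hC := W.C_pos
  have hh := W.h_nonneg
  have hn' : (0 : ℝ) < n := by exact_mod_cast hn
  have hC1 := W.one_le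
  -- By Pythagoras n⁻¹‖F̂ᵀFa‖² = ‖Fa‖² − ‖QFa‖² ≥ (n/2 − n/4)‖a‖², the smallness of h bounding the
  -- second term. The overlap matrix is square, so the bound passes to its transpose.
  have key : ∀ a, 1 / 2 * l2Norm a ≤ l2Norm (((n : ℝ)⁻¹ • (Fhᵀ * F)) *ᵥ a) := by
    intro a
    have h1 := hest.l2Norm_projOff_sq hn (F *ᵥ a)
    have h2 := W.l2Norm_projOff_factors_le hn hp hest a
    have h3 := W.F_lower a
    have h0 := l2Norm_nonneg a
    have hq : 3 * C ^ 3 * (Real.sqrt n * h) ≤ Real.sqrt n / 2 := by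
      have : C ^ 3 ≤ C ^ 4 := pow_le_pow_right₀ hC1 (by norm_num)
      have h6 : 6 * C ^ 3 * h ≤ 1 := le_trans (by gcongr) W.small
      nlinarith [Real.sqrt_nonneg (n : ℝ)]
    have h4 : l2Norm (projOff Fh *ᵥ (F *ᵥ a)) ^ 2 ≤ (Real.sqrt n / 2 * l2Norm a) ^ 2 :=
      pow_le_pow_left₀ (l2Norm_nonneg _) (h2.trans (by gcongr)) 2
    rw [mul_pow, div_pow, Real.sq_sqrt hn'.le] at h4
    have h5 : (n : ℝ) / 4 * l2Norm a ^ 2 ≤ (n : ℝ)⁻¹ * l2Norm (Fhᵀ *ᵥ (F *ᵥ a)) ^ 2 := by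
      linarith
    rw [smul_mulVec, l2Norm_smul, abs_of_pos (by positivity), ← mulVec_mulVec]
    refine (pow_le_pow_iff_left₀ (by positivity)
      (mul_nonneg (by positivity) (l2Norm_nonneg _)) two_ne_zero).1 ?_
    have h6 := mul_le_mul_of_nonneg_left h5 (inv_nonneg.2 hn'.le)
    calc (1 / 2 * l2Norm a) ^ 2 = (n : ℝ)⁻¹ * (n / 4 * l2Norm a ^ 2) := by field_simp; ring
      _ ≤ _ := h6
      _ = _ := by ring
  have := le_l2Norm_transpose_mulVec one_half_pos key a
  rwa [transpose_smul, transpose_mul, transpose_transpose] at this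

omit hp in
theorem factor_overlap_upper (a : Fin K → ℝ) :
    l2Norm (((n : ℝ)⁻¹ • (Fᵀ * Fh)) *ᵥ a) ≤ 2 * l2Norm a := by
  have hn' : (0 : ℝ) < n := by exact_mod_cast hn
  rw [smul_mulVec, l2Norm_smul, abs_of_pos (by positivity), ← mulVec_mulVec]
  have h1 := _root_.l2Norm_transpose_mulVec_le (by positivity) W.F_upper (Fh *ᵥ a)
  rw [hest.l2Norm_mulVec hn] at h1
  rw [inv_mul_le_iff₀ hn']
  calc _ ≤ _ := h1
    _ = (Real.sqrt n * Real.sqrt n) * (2 * l2Norm a) := by ring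
    _ = _ := by rw [Real.mul_self_sqrt hn'.le]

/-- The overlap matrix n⁻¹FᵀF̂ sends F̂ᵀw to Fᵀw − (QF)ᵀw and is bounded below by 1/2. Inner
products with estimated factors thus reduce to those with the true ones plus leakage. -/
theorem l2Norm_estimated_factors_le (w : Fin n → ℝ) :
    l2Norm (Fhᵀ *ᵥ w) ≤ 2 * (l2Norm (Fᵀ *ᵥ w) + 3 * C ^ 3 * (Real.sqrt n * h) * l2Norm w) := by
  have hC := W.C_pos
  have hh := W.h_nonneg
  have hn' : (0 : ℝ) < n := by exact_mod_cast hn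
  have h1 := W.factor_overlap_lower hn hp hest (Fhᵀ *ᵥ w)
  have h2 : ((n : ℝ)⁻¹ • (Fᵀ * Fh)) *ᵥ (Fhᵀ *ᵥ w) = Fᵀ *ᵥ w - (projOff Fh * F)ᵀ *ᵥ w := by
    rw [projOff, transpose_mul, transpose_proj, Matrix.mul_sub, Matrix.mul_one, sub_mulVec,
      sub_sub_cancel, mulVec_mulVec, Matrix.mul_smul, Matrix.smul_mul, Matrix.mul_assoc]
  have h3 := _root_.l2Norm_transpose_mulVec_le (A := projOff Fh * F)
    (L := 3 * C ^ 3 * (Real.sqrt n * h)) (by positivity)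
    (fun a => by rw [← mulVec_mulVec]; exact W.l2Norm_projOff_factors_le hn hp hest a) w
  rw [h2] at h1
  linarith [l2Norm_sub_le (Fᵀ *ᵥ w) ((projOff Fh * F)ᵀ *ᵥ w)]

omit W hp in
theorem estimated_loadings_eq :
    Bh = B * ((n : ℝ)⁻¹ • (Fᵀ * Fh)) + (n : ℝ)⁻¹ • (Uᵀ * Fh) := by
  have h1 := congrArg transpose (hest.loadings hn)
  rw [transpose_transpose, transpose_smul, transpose_mul, transpose_transpose, transpose_add,
    transpose_mul, transpose_transpose, Matrix.add_mul, smul_add, Matrix.mul_assoc] at h1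
  rw [h1, Matrix.mul_smul]

omit hp in
theorem l2Norm_transpose_U_Fh_le (a : Fin K → ℝ) :
    l2Norm (Uᵀ *ᵥ (Fh *ᵥ a)) ≤ C * (n * Real.sqrt p * h) * l2Norm a := by
  have hC := W.C_pos
  have hh := W.h_nonneg
  have h1 := _root_.l2Norm_transpose_mulVec_le (by positivity) W.op_U (Fh *ᵥ a)
  rw [hest.l2Norm_mulVec hn] at h1
  calc _ ≤ _ := h1
    _ = C * ((Real.sqrt n * Real.sqrt n) * Real.sqrt p * h) * l2Norm a := by ring
    _ = _ := by rw [Real.mul_self_sqrt (Nat.cast_nonneg n)]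

omit hp in
theorem l2Norm_estimated_loadings_le (a : Fin K → ℝ) :
    l2Norm (Bh *ᵥ a) ≤ 3 * C * Real.sqrt p * l2Norm a := by
  have hC := W.C_pos
  have hh := W.h_nonneg
  have hn' : (0 : ℝ) < n := by exact_mod_cast hn
  rw [estimated_loadings_eq hn hest, add_mulVec, smul_mulVec, ← mulVec_mulVec, ← mulVec_mulVec]
  refine (l2Norm_add_le _ _).trans ?_
  rw [l2Norm_smul _ (Uᵀ *ᵥ _), abs_of_pos (by positivity)]
  have h1 := W.B_upper (((n : ℝ)⁻¹ • (Fᵀ * Fh)) *ᵥ a)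
  have h2 := mul_le_mul_of_nonneg_left (W.factor_overlap_upper hn hest a)
    (show 0 ≤ C * Real.sqrt p by positivity)
  have h3 := W.l2Norm_transpose_U_Fh_le hn hest a
  have h4 : (n : ℝ)⁻¹ * l2Norm (Uᵀ *ᵥ (Fh *ᵥ a)) ≤ C * Real.sqrt p * l2Norm a := by
    rw [inv_mul_le_iff₀ hn']
    refine h3.trans ?_
    have := W.h_le_one
    have := l2Norm_nonneg a
    calc C * (n * Real.sqrt p * h) * l2Norm a ≤ C * (n * Real.sqrt p * 1) * l2Norm a := by gcongr
      _ = _ := by ring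
  linarith

/-- B̂ is B times the overlap matrix plus n⁻¹UᵀF̂. The first part gives at least p/(2C²), and 6C⁴h ≤
1 keeps the noise part below half of that. -/
theorem le_loadings_overlap (a : Fin K → ℝ) :
    p / (4 * C ^ 2) * l2Norm a ≤ l2Norm ((Bᵀ * Bh) *ᵥ a) := by
  have hC := W.C_pos
  have hh := W.h_nonneg
  have hn' : (0 : ℝ) < n := by exact_mod_cast hn
  have ha := l2Norm_nonneg a
  have e1 : (Bᵀ * Bh) *ᵥ a = (Bᵀ * B) *ᵥ (((n : ℝ)⁻¹ • (Fᵀ * Fh)) *ᵥ a) +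
      (n : ℝ)⁻¹ • (Bᵀ *ᵥ (Uᵀ *ᵥ (Fh *ᵥ a))) := by
    rw [estimated_loadings_eq hn hest, Matrix.mul_add, add_mulVec, ← Matrix.mul_assoc,
      ← mulVec_mulVec, Matrix.mul_smul, smul_mulVec (n : ℝ)⁻¹ (Bᵀ * (Uᵀ * Fh)), ← mulVec_mulVec a Bᵀ,
      ← mulVec_mulVec a Uᵀ]
  have h1 := W.le_gram_loadings hp (((n : ℝ)⁻¹ • (Fᵀ * Fh)) *ᵥ a)
  have h2 := W.factor_overlap_lower hn hp hest a
  have h3 := _root_.l2Norm_transpose_mulVec_le (by positivity) W.B_upper (Uᵀ *ᵥ (Fh *ᵥ a))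
  have h4 := W.l2Norm_transpose_U_Fh_le hn hest a
  have h5 : l2Norm ((n : ℝ)⁻¹ • (Bᵀ *ᵥ (Uᵀ *ᵥ (Fh *ᵥ a)))) ≤ p / (4 * C ^ 2) * l2Norm a := by
    rw [l2Norm_smul, abs_of_pos (by positivity), inv_mul_le_iff₀ hn']
    calc _ ≤ _ := h3
      _ ≤ C * Real.sqrt p * (C * (n * Real.sqrt p * h) * l2Norm a) := by gcongr
      _ = (Real.sqrt p * Real.sqrt p) * (n * l2Norm a) * (C ^ 2 * h) := by ring
      _ = p * (n * l2Norm a) * (C ^ 2 * h) := by rw [Real.mul_self_sqrt (Nat.cast_nonneg p)]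
      _ ≤ p * (n * l2Norm a) * (1 / (4 * C ^ 2)) := by
          have : C ^ 2 * h ≤ 1 / (4 * C ^ 2) := by
            rw [le_div_iff₀ (by positivity)]
            nlinarith [W.small, mul_nonneg (pow_nonneg hC.le 4) hh]
          gcongr
      _ = _ := by ring
  have h6 : p / C ^ 2 * (1 / 2 * l2Norm a) ≤
      l2Norm ((Bᵀ * B) *ᵥ (((n : ℝ)⁻¹ • (Fᵀ * Fh)) *ᵥ a)) :=
    (mul_le_mul_of_nonneg_left h2 (by positivity)).trans h1
  have h7 := le_l2Norm_add ((Bᵀ * B) *ᵥ (((n : ℝ)⁻¹ • (Fᵀ * Fh)) *ᵥ a))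
    ((n : ℝ)⁻¹ • (Bᵀ *ᵥ (Uᵀ *ᵥ (Fh *ᵥ a))))
  rw [e1]
  have h8 : p / C ^ 2 * (1 / 2 * l2Norm a) = 2 * (p / (4 * C ^ 2) * l2Norm a) := by ring
  linarith

/-- The true factors, projected off the estimated ones, are explained by the idiosyncratic
components alone. -/
theorem exists_projOff_factors_eq (a : Fin K → ℝ) :
    ∃ ψ, projOff Fh *ᵥ (F *ᵥ a) = -(projOff Fh *ᵥ (U *ᵥ (Bh *ᵥ ψ))) ∧
      l2Norm ψ ≤ 4 * C ^ 2 / p * l2Norm a := by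
  have hC := W.C_pos
  have hp' : (0 : ℝ) < p := by exact_mod_cast hp
  obtain ⟨ψ, hψ, hb⟩ := exists_mulVec_eq (A := Bᵀ * Bh) (by positivity)
    (W.le_loadings_overlap hn hp hest) a
  refine ⟨ψ, ?_, hb.trans_eq (by field_simp)⟩
  -- With BᵀB̂ψ = a, the normal equation QXB̂ψ = 0 reads QFa + QUB̂ψ = 0.
  have h1 := congrArg (· *ᵥ ψ) (hest.residual_mul_loadings hn)
  simp only [zero_mulVec] at h1
  rw [← mulVec_mulVec, ← mulVec_mulVec, add_mulVec, mulVec_add] at h1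
  rw [← hψ, projOff, eq_neg_iff_add_eq_zero, ← mulVec_mulVec ψ Bᵀ, mulVec_mulVec _ F, h1]

theorem l2Norm_estimated_factors_col_le (j : Fin p) :
    l2Norm (Fhᵀ *ᵥ Uᵀ j) ≤ 12 * C ^ 4 * (n * h) := by
  have hC := W.C_pos
  have hC1 := W.one_le
  have hh := W.h_nonneg
  have h1 := W.l2Norm_estimated_factors_le hn hp hest (Uᵀ j)
  have h2 := W.FU j
  have h3 : 3 * C ^ 3 * (Real.sqrt n * h) * l2Norm (Uᵀ j) ≤ 3 * C ^ 4 * (n * h) := by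
    calc 3 * C ^ 3 * (Real.sqrt n * h) * l2Norm (Uᵀ j)
        ≤ 3 * C ^ 3 * (Real.sqrt n * h) * (C * Real.sqrt n) := by gcongr; exact W.U_col j
      _ = 3 * C ^ 4 * ((Real.sqrt n * Real.sqrt n) * h) := by ring
      _ = _ := by rw [Real.mul_self_sqrt (Nat.cast_nonneg n)]
  have h4 : C * (n * r) ≤ C ^ 4 * (n * h) := by
    have := W.r_le
    have := W.r_nonneg
    have : C ≤ C ^ 4 := le_self_pow₀ hC1 (by norm_num)
    gcongr
  have : 0 ≤ C ^ 4 * (n * h) := by positivity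
  linarith

theorem l2Norm_estimated_factors_error_le :
    l2Norm (Fhᵀ *ᵥ e) ≤ 12 * C ^ 4 * (n * h) := by
  have hC := W.C_pos
  have hC1 := W.one_le
  have hh := W.h_nonneg
  have h1 := W.l2Norm_estimated_factors_le hn hp hest e
  have h2 := W.Fe
  have h3 : 3 * C ^ 3 * (Real.sqrt n * h) * l2Norm e ≤ 3 * C ^ 4 * (n * h) := by
    calc 3 * C ^ 3 * (Real.sqrt n * h) * l2Norm e
        ≤ 3 * C ^ 3 * (Real.sqrt n * h) * (C * Real.sqrt n) := by gcongr; exact W.e_norm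
      _ = 3 * C ^ 4 * ((Real.sqrt n * Real.sqrt n) * h) := by ring
      _ = _ := by rw [Real.mul_self_sqrt (Nat.cast_nonneg n)]
  have h4 : C * (n * r) ≤ C ^ 4 * (n * h) := by
    have := W.r_le
    have := W.r_nonneg
    have : C ≤ C ^ 4 := le_self_pow₀ hC1 (by norm_num)
    gcongr
  have : 0 ≤ C ^ 4 * (n * h) := by positivity
  linarith

/-- The estimated design inherits lower bounds from the idiosyncratic components. -/
theorem le_l2Norm_residual_mulVec (v : Fin p → ℝ) :
    l2Norm (U *ᵥ v) - 15 * C ^ 4 * (Real.sqrt n * h) * l1Norm v ≤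
      l2Norm ((projOff Fh * (F * Bᵀ + U)) *ᵥ v) := by
  have hC := W.C_pos
  have hh := W.h_nonneg
  have hn' : (0 : ℝ) < n := by exact_mod_cast hn
  have hs : 0 < Real.sqrt n := Real.sqrt_pos.2 hn'
  have e1 : (projOff Fh * (F * Bᵀ + U)) *ᵥ v =
      projOff Fh *ᵥ (U *ᵥ v) + projOff Fh *ᵥ (F *ᵥ (Bᵀ *ᵥ v)) := by
    rw [← mulVec_mulVec, add_mulVec, mulVec_add, ← mulVec_mulVec, add_comm]
  have h1 := le_l2Norm_add (projOff Fh *ᵥ (U *ᵥ v)) (projOff Fh *ᵥ (F *ᵥ (Bᵀ *ᵥ v)))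
  have h2 := W.l2Norm_projOff_factors_le hn hp hest (Bᵀ *ᵥ v)
  have h3 := l2Norm_mulVec_le_l1Norm Bᵀ (c := C) W.B_row v
  have h4 := hest.le_l2Norm_projOff hn (U *ᵥ v)
  have h5 : l2Norm (Fhᵀ *ᵥ (U *ᵥ v)) ≤ 12 * C ^ 4 * (n * h) * l1Norm v := by
    rw [mulVec_mulVec]
    exact l2Norm_mulVec_le_l1Norm _ (W.l2Norm_estimated_factors_col_le hn hp hest) v
  have h6 : l2Norm (Fhᵀ *ᵥ (U *ᵥ v)) / Real.sqrt n ≤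
      12 * C ^ 4 * (Real.sqrt n * h) * l1Norm v := by
    rw [div_le_iff₀ hs]
    refine h5.trans_eq ?_
    nth_rewrite 1 [← Real.mul_self_sqrt hn'.le]
    ring
  have h7 : l2Norm (projOff Fh *ᵥ (F *ᵥ (Bᵀ *ᵥ v))) ≤
      3 * C ^ 4 * (Real.sqrt n * h) * l1Norm v := by
    calc _ ≤ _ := h2
      _ ≤ 3 * C ^ 3 * (Real.sqrt n * h) * (C * l1Norm v) := by gcongr
      _ = _ := by ring
  rw [e1]
  linarith

end FactorDesign

end

end

/-! ### Second-order bound on the score of the Lasso. -/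

noncomputable section

namespace FactorDesign

variable {n p K : ℕ} {F Fh : Matrix (Fin n) (Fin K) ℝ}
  {B Bh : Matrix (Fin p) (Fin K) ℝ} {U : Matrix (Fin n) (Fin p) ℝ} {e : Fin n → ℝ} {C h r : ℝ}
  (W : FactorDesign C h r F B U e) (hn : 0 < n) (hp : 0 < p)
  (hest : IsFactorEstimate (F * Bᵀ + U) Fh Bh)
include W

theorem inv_card_le (hp : 0 < p) : 1 / (p : ℝ) ≤ h ^ 2 := by
  have h1 := pow_le_pow_left₀ (by positivity) W.inv_le 2
  rwa [inv_pow, Real.sq_sqrt (Nat.cast_nonneg p), inv_eq_one_div] at h1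

include hn hest

theorem l2Norm_U_loadings_le {ψ : Fin K → ℝ} {b : ℝ} (hp : 0 < p)
    (hψ : l2Norm ψ ≤ 4 * C ^ 3 / p * b) :
    l2Norm (U *ᵥ (Bh *ᵥ ψ)) ≤ 12 * C ^ 5 * (Real.sqrt n * h * b) := by
  have hC := W.C_pos
  have hh := W.h_nonneg
  have hp' : (0 : ℝ) < p := by exact_mod_cast hp
  calc l2Norm (U *ᵥ (Bh *ᵥ ψ)) ≤ C * (Real.sqrt n * Real.sqrt p * h) * l2Norm (Bh *ᵥ ψ) := W.op_U _
    _ ≤ C * (Real.sqrt n * Real.sqrt p * h) * (3 * C * Real.sqrt p * (4 * C ^ 3 / p * b)) := by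
        gcongr
        exact (W.l2Norm_estimated_loadings_le hn hest ψ).trans (by gcongr)
    _ = (Real.sqrt p * Real.sqrt p) / p * (12 * C ^ 5 * (Real.sqrt n * h * b)) := by ring
    _ = _ := by rw [Real.mul_self_sqrt hp'.le, div_self hp'.ne', one_mul]

/-- Cauchy–Schwarz on U_j and UB̂ψ would give only n h b. Expanding B̂ pairs its main part with
BᵀUᵀU_j, of size n(1 + √p r), and the 1/p in ψ turns this into n h² b. The remainder carries the
operator norm of U twice, hence h² as well. -/
theorem abs_col_dotProduct_U_loadings_le {ψ : Fin K → ℝ} {b : ℝ} (hb : 0 ≤ b) (hp : 0 < p)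
    (hψ : l2Norm ψ ≤ 4 * C ^ 3 / p * b) (j : Fin p) :
    |Uᵀ j ⬝ᵥ U *ᵥ (Bh *ᵥ ψ)| ≤ 20 * C ^ 6 * (n * h ^ 2 * b) := by
  have hC := W.C_pos
  have hC1 := W.one_le
  have hh := W.h_nonneg
  have hr := W.r_nonneg
  have hn' : (0 : ℝ) < n := by exact_mod_cast hn
  have hp' : (0 : ℝ) < p := by exact_mod_cast hp
  have e1 : Uᵀ j ⬝ᵥ U *ᵥ (Bh *ᵥ ψ) =
      (Bᵀ *ᵥ (Uᵀ *ᵥ Uᵀ j)) ⬝ᵥ (((n : ℝ)⁻¹ • (Fᵀ * Fh)) *ᵥ ψ) +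
        (n : ℝ)⁻¹ * ((Uᵀ *ᵥ Uᵀ j) ⬝ᵥ (Uᵀ *ᵥ (Fh *ᵥ ψ))) := by
    rw [estimated_loadings_eq hn hest, add_mulVec, mulVec_add, dotProduct_add, mulVec_dotProduct,
      mulVec_dotProduct, mulVec_dotProduct Uᵀ, transpose_transpose, transpose_transpose,
      ← mulVec_mulVec, smul_mulVec _ (Uᵀ * Fh), mulVec_smul, dotProduct_smul, smul_eq_mul,
      ← mulVec_mulVec ψ Uᵀ]
  have h1 : |(Bᵀ *ᵥ (Uᵀ *ᵥ Uᵀ j)) ⬝ᵥ (((n : ℝ)⁻¹ • (Fᵀ * Fh)) *ᵥ ψ)| ≤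
      16 * C ^ 4 * (n * h ^ 2 * b) := by
    have hs : (1 + Real.sqrt p * r) / p ≤ 2 * h ^ 2 := by
      have i1 := W.inv_card_le hp
      have i2 : Real.sqrt p * r / p ≤ h ^ 2 := by
        have : Real.sqrt p * r / p = (Real.sqrt p)⁻¹ * r := by
          nth_rewrite 2 [← Real.mul_self_sqrt hp'.le]
          have := (Real.sqrt_pos.2 hp').ne'
          field_simp
        rw [this, sq]
        exact mul_le_mul W.inv_le W.r_le hr hh
      rw [add_div]; linarith
    calc _ ≤ _ := abs_dotProduct_le _ _
      _ ≤ (C * (n * (1 + Real.sqrt p * r))) * (2 * (4 * C ^ 3 / p * b)) := by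
          refine mul_le_mul (W.BUU j) ?_ (l2Norm_nonneg _) (by positivity)
          exact (W.factor_overlap_upper hn hest ψ).trans (by gcongr)
      _ = 8 * C ^ 4 * n * b * ((1 + Real.sqrt p * r) / p) := by ring
      _ ≤ 8 * C ^ 4 * n * b * (2 * h ^ 2) := by gcongr
      _ = _ := by ring
  have h2 : |(n : ℝ)⁻¹ * ((Uᵀ *ᵥ Uᵀ j) ⬝ᵥ (Uᵀ *ᵥ (Fh *ᵥ ψ)))| ≤ 4 * C ^ 6 * (n * h ^ 2 * b) := by
    rw [abs_mul, abs_of_pos (inv_pos.2 hn'), inv_mul_le_iff₀ hn']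
    calc _ ≤ _ := abs_dotProduct_le _ _
      _ ≤ (C * (Real.sqrt n * Real.sqrt p * h) * (C * Real.sqrt n)) *
          (C * (n * Real.sqrt p * h) * (4 * C ^ 3 / p * b)) := by
          refine mul_le_mul ?_ ?_ (l2Norm_nonneg _) (by positivity)
          · exact (_root_.l2Norm_transpose_mulVec_le (by positivity) W.op_U _).trans
              (by gcongr; exact W.U_col j)
          · exact (W.l2Norm_transpose_U_Fh_le hn hest ψ).trans (by gcongr)
      _ = (Real.sqrt n * Real.sqrt n) * (Real.sqrt p * Real.sqrt p) / p * n *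
          (4 * C ^ 6 * h ^ 2 * b) := by ring
      _ = _ := by
          rw [Real.mul_self_sqrt hp'.le, Real.mul_self_sqrt hn'.le]; field_simp
  have h3 : C ^ 4 ≤ C ^ 6 := pow_le_pow_right₀ hC1 (by norm_num)
  have h4 : 16 * C ^ 4 * (n * h ^ 2 * b) ≤ 16 * C ^ 6 * (n * h ^ 2 * b) := by gcongr
  rw [e1]
  exact (abs_add_le _ _).trans (by linarith)

include hp

/-- The score of the Lasso problem at the population coefficients. -/
theorem score_le {φ : Fin K → ℝ} {δ : Fin n → ℝ} {b : ℝ} (hb : 1 ≤ b)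
    (hφ : l2Norm φ ≤ C * b) (hδ : l2Norm δ ≤ C * (Real.sqrt n * r)) (j : Fin p) :
    |(((projOff Fh * (F * Bᵀ + U))ᵀ) *ᵥ (projOff Fh *ᵥ (F *ᵥ φ + e + δ))) j| ≤
      500 * C ^ 9 * (n * (h ^ 2 * b + r)) := by
  have hC := W.C_pos
  have hC1 := W.one_le
  have hh := W.h_nonneg
  have hr := W.r_nonneg
  have hn' : (0 : ℝ) < n := by exact_mod_cast hn
  have hp' : (0 : ℝ) < p := by exact_mod_cast hp
  have hnn := Real.mul_self_sqrt hn'.le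
  have hb0 : 0 ≤ b := zero_le_one.trans hb
  -- ψ represents the leakage of φ in the residual, and ζ that of the j-th loading row in the j-th
  -- column of the design.
  obtain ⟨ψ, hψ, hψn⟩ := W.exists_projOff_factors_eq hn hp hest φ
  obtain ⟨ζ, hζ, hζn⟩ := W.exists_projOff_factors_eq hn hp hest (B j)
  replace hψn : l2Norm ψ ≤ 4 * C ^ 3 / p * b :=
    hψn.trans ((mul_le_mul_of_nonneg_left hφ (by positivity)).trans_eq (by ring))
  replace hζn : l2Norm ζ ≤ 4 * C ^ 3 / p * 1 :=
    hζn.trans ((mul_le_mul_of_nonneg_left (W.B_row j) (by positivity)).trans_eq (by ring))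
  have hqb := (W.l2Norm_projOff_factors_le hn hp hest (B j)).trans
    (mul_le_mul_of_nonneg_left (W.B_row j) (by positivity))
  have hqφ := (W.l2Norm_projOff_factors_le hn hp hest φ).trans
    (mul_le_mul_of_nonneg_left hφ (by positivity))
  have hαj := W.l2Norm_estimated_factors_col_le hn hp hest j
  have hαe := W.l2Norm_estimated_factors_error_le hn hp hest
  have hUψ := W.l2Norm_U_loadings_le hn hest hp hψn
  have hUζ := W.l2Norm_U_loadings_le hn hest hp hζn
  have hαψ := (hest.l2Norm_transpose_mulVec_le hn _).trans
    (mul_le_mul_of_nonneg_left hUψ (Real.sqrt_nonneg n))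
  have hαζ := (hest.l2Norm_transpose_mulVec_le hn _).trans
    (mul_le_mul_of_nonneg_left hUζ (Real.sqrt_nonneg n))
  -- The j-th design column is Q(F B_j + U_j); expanding against φ, e and δ gives six terms. Those
  -- without e or δ must be of order h² b.
  have e0 : (((projOff Fh * (F * Bᵀ + U))ᵀ) *ᵥ (projOff Fh *ᵥ (F *ᵥ φ + e + δ))) j =
      (projOff Fh *ᵥ (F *ᵥ B j)) ⬝ᵥ (projOff Fh *ᵥ (F *ᵥ φ)) + Uᵀ j ⬝ᵥ (projOff Fh *ᵥ (F *ᵥ φ)) +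
      (projOff Fh *ᵥ (F *ᵥ B j)) ⬝ᵥ e + Uᵀ j ⬝ᵥ (projOff Fh *ᵥ e) +
      (projOff Fh *ᵥ (F *ᵥ B j)) ⬝ᵥ δ + Uᵀ j ⬝ᵥ (projOff Fh *ᵥ δ) := by
    have i1 : (((projOff Fh * (F * Bᵀ + U))ᵀ) *ᵥ (projOff Fh *ᵥ (F *ᵥ φ + e + δ))) j =
        (F *ᵥ B j + Uᵀ j) ⬝ᵥ (projOff Fh *ᵥ (F *ᵥ φ + e + δ)) := by
      have i2 : (projOff Fh)ᵀ = projOff Fh := transpose_proj Fh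
      rw [transpose_mul, i2, ← mulVec_mulVec, hest.projOff_mulVec_projOff hn]
      have i3 : (F * Bᵀ + U)ᵀ j = F *ᵥ B j + Uᵀ j := by
        ext i; simp [mulVec, dotProduct, mul_apply]
      rw [← i3]; rfl
    rw [i1, mulVec_add, mulVec_add, add_dotProduct]
    simp only [dotProduct_add, projOff_mulVec_dotProduct, hest.projOff_mulVec_projOff hn]
    ring
  have t1 : |(projOff Fh *ᵥ (F *ᵥ B j)) ⬝ᵥ (projOff Fh *ᵥ (F *ᵥ φ))| ≤
      9 * C ^ 8 * (n * (h ^ 2 * b)) := by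
    refine (abs_dotProduct_le _ _).trans ((mul_le_mul hqb hqφ (l2Norm_nonneg _)
      (by positivity)).trans_eq ?_)
    linear_combination (9 * C ^ 8 * h ^ 2 * b) * hnn
  have t2 : |Uᵀ j ⬝ᵥ (projOff Fh *ᵥ (F *ᵥ φ))| ≤ 164 * C ^ 9 * (n * (h ^ 2 * b)) := by
    rw [hψ, dotProduct_neg, abs_neg, dotProduct_projOff]
    have i1 := W.abs_col_dotProduct_U_loadings_le hn hest hb0 hp hψn j
    have i2 : |(n : ℝ)⁻¹ * ((Fhᵀ *ᵥ Uᵀ j) ⬝ᵥ (Fhᵀ *ᵥ (U *ᵥ (Bh *ᵥ ψ))))| ≤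
        144 * C ^ 9 * (n * (h ^ 2 * b)) := by
      rw [abs_mul, abs_of_pos (inv_pos.2 hn'), inv_mul_le_iff₀ hn']
      refine (abs_dotProduct_le _ _).trans ((mul_le_mul hαj hαψ (l2Norm_nonneg _)
        (by positivity)).trans_eq ?_)
      linear_combination (144 * C ^ 9 * n * h ^ 2 * b) * hnn
    have i3 : C ^ 6 ≤ C ^ 9 := pow_le_pow_right₀ hC1 (by norm_num)
    have i4 : 20 * C ^ 6 * (n * h ^ 2 * b) ≤ 20 * C ^ 9 * (n * h ^ 2 * b) := by gcongr
    refine (abs_sub _ _).trans ?_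
    linarith
  have t3 : |(projOff Fh *ᵥ (F *ᵥ B j)) ⬝ᵥ e| ≤
      8 * C ^ 5 * (n * r) + 148 * C ^ 9 * (n * h ^ 2) := by
    rw [hζ, neg_dotProduct, abs_neg, dotProduct_comm, dotProduct_projOff]
    have i2 : |(n : ℝ)⁻¹ * ((Fhᵀ *ᵥ e) ⬝ᵥ (Fhᵀ *ᵥ (U *ᵥ (Bh *ᵥ ζ))))| ≤
        144 * C ^ 9 * (n * h ^ 2) := by
      rw [abs_mul, abs_of_pos (inv_pos.2 hn'), inv_mul_le_iff₀ hn']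
      refine (abs_dotProduct_le _ _).trans ((mul_le_mul hαe hαζ (l2Norm_nonneg _)
        (by positivity)).trans_eq ?_)
      linear_combination (144 * C ^ 9 * n * h ^ 2) * hnn
    have i1 : e ⬝ᵥ U *ᵥ (Bh *ᵥ ζ) = (Uᵀ *ᵥ e) ⬝ᵥ (B *ᵥ (((n : ℝ)⁻¹ • (Fᵀ * Fh)) *ᵥ ζ)) +
        (n : ℝ)⁻¹ * ((Uᵀ *ᵥ e) ⬝ᵥ (Uᵀ *ᵥ (Fh *ᵥ ζ))) := by
      rw [estimated_loadings_eq hn hest, add_mulVec, mulVec_add, dotProduct_add,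
        mulVec_dotProduct, mulVec_dotProduct, transpose_transpose,
        ← mulVec_mulVec, smul_mulVec _ (Uᵀ * Fh), mulVec_smul, dotProduct_smul, smul_eq_mul,
        ← mulVec_mulVec ζ Uᵀ]
    -- An ℓ∞–ℓ₁ pairing: each entry of Uᵀe is of order n r, while the loading combination has
    -- bounded ℓ₁ norm. Pairing in ℓ₂ through the operator norm of U would leave n h.
    have i3 : |(Uᵀ *ᵥ e) ⬝ᵥ (B *ᵥ (((n : ℝ)⁻¹ • (Fᵀ * Fh)) *ᵥ ζ))| ≤ 8 * C ^ 5 * (n * r) := by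
      refine (abs_dotProduct_le_l1Norm (c := C * (n * r)) W.Ue).trans ?_
      have i4 : l1Norm (B *ᵥ (((n : ℝ)⁻¹ • (Fᵀ * Fh)) *ᵥ ζ)) ≤ 8 * C ^ 4 := by
        calc _ ≤ _ := l1Norm_le_sqrt_mul_l2Norm _
          _ ≤ Real.sqrt p * (C * Real.sqrt p * (2 * (4 * C ^ 3 / p * 1))) := by
              gcongr
              refine (W.B_upper _).trans ?_
              gcongr
              exact (W.factor_overlap_upper hn hest ζ).trans (by gcongr)
          _ = (Real.sqrt p * Real.sqrt p) / p * (8 * C ^ 4) := by ring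
          _ = _ := by rw [Real.mul_self_sqrt hp'.le, div_self hp'.ne', one_mul]
      calc _ ≤ C * (n * r) * (8 * C ^ 4) := by gcongr
        _ = _ := by ring
    have i5 : |(n : ℝ)⁻¹ * ((Uᵀ *ᵥ e) ⬝ᵥ (Uᵀ *ᵥ (Fh *ᵥ ζ)))| ≤ 4 * C ^ 6 * (n * h ^ 2) := by
      rw [abs_mul, abs_of_pos (inv_pos.2 hn'), inv_mul_le_iff₀ hn']
      calc _ ≤ _ := abs_dotProduct_le _ _
        _ ≤ (C * (Real.sqrt n * Real.sqrt p * h) * (C * Real.sqrt n)) *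
            (C * (n * Real.sqrt p * h) * (4 * C ^ 3 / p * 1)) := by
            refine mul_le_mul ?_ ?_ (l2Norm_nonneg _) (by positivity)
            · exact (_root_.l2Norm_transpose_mulVec_le (by positivity) W.op_U _).trans
                (by gcongr; exact W.e_norm)
            · exact (W.l2Norm_transpose_U_Fh_le hn hest ζ).trans (by gcongr)
        _ = (Real.sqrt n * Real.sqrt n) * (Real.sqrt p * Real.sqrt p) / p * n *
            (4 * C ^ 6 * h ^ 2) := by ring
        _ = _ := by
            rw [Real.mul_self_sqrt hp'.le, hnn]; field_simp
    have i6 : C ^ 6 ≤ C ^ 9 := pow_le_pow_right₀ hC1 (by norm_num)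
    have i7 : 4 * C ^ 6 * (n * h ^ 2) ≤ 4 * C ^ 9 * (n * h ^ 2) := by gcongr
    rw [i1]
    refine (abs_sub _ _).trans ((add_le_add_left (abs_add_le _ _) _).trans ?_)
    linarith
  have t4 : |Uᵀ j ⬝ᵥ (projOff Fh *ᵥ e)| ≤ C * (n * r) + 144 * C ^ 8 * (n * h ^ 2) := by
    rw [dotProduct_projOff]
    have i2 : |(n : ℝ)⁻¹ * ((Fhᵀ *ᵥ Uᵀ j) ⬝ᵥ (Fhᵀ *ᵥ e))| ≤ 144 * C ^ 8 * (n * h ^ 2) := by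
      rw [abs_mul, abs_of_pos (inv_pos.2 hn'), inv_mul_le_iff₀ hn']
      refine (abs_dotProduct_le _ _).trans ((mul_le_mul hαj hαe (l2Norm_nonneg _)
        (by positivity)).trans_eq ?_)
      ring
    exact (abs_sub _ _).trans (add_le_add (W.Ue j) i2)
  -- For δ Cauchy–Schwarz is enough, since ‖δ‖ is already of order √n r and h ≤ 1.
  have t5 : |(projOff Fh *ᵥ (F *ᵥ B j)) ⬝ᵥ δ| ≤ 3 * C ^ 5 * (n * r) := by
    have := W.h_le_one
    calc _ ≤ _ := abs_dotProduct_le _ _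
      _ ≤ 3 * C ^ 3 * (Real.sqrt n * h) * C * (C * (Real.sqrt n * r)) :=
          mul_le_mul hqb hδ (l2Norm_nonneg _) (by positivity)
      _ ≤ 3 * C ^ 3 * (Real.sqrt n * 1) * C * (C * (Real.sqrt n * r)) := by gcongr
      _ = 3 * C ^ 5 * ((Real.sqrt n * Real.sqrt n) * r) := by ring
      _ = _ := by rw [hnn]
  have t6 : |Uᵀ j ⬝ᵥ (projOff Fh *ᵥ δ)| ≤ C ^ 2 * (n * r) := by
    calc _ ≤ _ := abs_dotProduct_le _ _
      _ ≤ C * Real.sqrt n * (C * (Real.sqrt n * r)) :=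
          mul_le_mul (W.U_col j) ((hest.l2Norm_projOff_le hn δ).trans hδ) (l2Norm_nonneg _)
            (by positivity)
      _ = C ^ 2 * ((Real.sqrt n * Real.sqrt n) * r) := by ring
      _ = _ := by rw [hnn]
  have hz : 0 ≤ (n : ℝ) * r := by positivity
  have hy : 0 ≤ (n : ℝ) * h ^ 2 := by positivity
  have hyb : (n : ℝ) * h ^ 2 ≤ n * (h ^ 2 * b) := by
    rw [← mul_assoc]; exact le_mul_of_one_le_right hy hb
  have hyb0 := hy.trans hyb
  have p1 : C ≤ C ^ 9 := le_self_pow₀ hC1 (by norm_num)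
  have p2 : C ^ 2 ≤ C ^ 9 := pow_le_pow_right₀ hC1 (by norm_num)
  have p5 : C ^ 5 ≤ C ^ 9 := pow_le_pow_right₀ hC1 (by norm_num)
  have p8 : C ^ 8 ≤ C ^ 9 := pow_le_pow_right₀ hC1 (by norm_num)
  have q1 := mul_le_mul_of_nonneg_right p1 hz
  have q2 := mul_le_mul_of_nonneg_right p2 hz
  have q5 := mul_le_mul_of_nonneg_right p5 hz
  have q8 := mul_le_mul_of_nonneg_right p8 hyb0
  have q8' := mul_le_mul_of_nonneg_right p8 hy
  have q9 := mul_le_mul_of_nonneg_left hyb (show 0 ≤ C ^ 9 by positivity)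
  have q10 : 0 ≤ C ^ 9 * (n * (h ^ 2 * b)) := by positivity
  have q11 : 0 ≤ C ^ 9 * (n * r) := by positivity
  rw [e0]
  refine (abs_add_le _ _).trans ((add_le_add ((abs_add_le _ _).trans (add_le_add ((abs_add_le _ _).trans
    (add_le_add ((abs_add_le _ _).trans (add_le_add ((abs_add_le _ _).trans (add_le_add t1 t2)) t3))
    t4)) t5)) t6).trans ?_)
  have e9 : 500 * C ^ 9 * (n * (h ^ 2 * b + r)) =
      500 * (C ^ 9 * (n * (h ^ 2 * b))) + 500 * (C ^ 9 * (n * r)) := by ring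
  rw [e9]
  linarith

end FactorDesign

end

noncomputable section

/-! Sub-Gaussian and sub-exponential random variables -/

section

variable {Ω : Type*} [MeasurableSpace Ω] {P : Measure Ω}

/-- The scale `c` is admissible in the definition of the `ψ₂` norm of `X`. -/
def PsiTwoLE (P : Measure Ω) (X : Ω → ℝ) (c : ℝ) : Prop :=
  0 < c ∧ ∫⁻ ω, ENNReal.ofReal (Real.exp (X ω ^ 2 / c ^ 2)) ∂P ≤ 2

/-- The `ψ₁` analogue of `PsiTwoLE`. -/
structure PsiOneLE (P : Measure Ω) (W : Ω → ℝ) (b : ℝ) : Prop where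
  pos : 0 < b
  meas : Measurable W
  integrable : Integrable (fun ω => Real.exp (|W ω| / b)) P
  integral_le : ∫ ω, Real.exp (|W ω| / b) ∂P ≤ 2

theorem PsiTwoLE.mono {X Y : Ω → ℝ} {c d : ℝ} (h : PsiTwoLE P X c) (hcd : 0 < d)
    (hXY : ∀ ω, |Y ω| / d ≤ |X ω| / c) : PsiTwoLE P Y d := by
  refine ⟨hcd, (lintegral_mono fun ω => ?_).trans h.2⟩
  have h1 := pow_le_pow_left₀ (by positivity) (hXY ω) 2
  rw [div_pow, div_pow, sq_abs, sq_abs] at h1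
  gcongr

/-- ((X + Y)/2c)² is at most the average of (X/c)² and (Y/c)²; convexity of exp does the rest, with
no independence needed. -/
theorem PsiTwoLE.add {X Y : Ω → ℝ} {c : ℝ} (hX : PsiTwoLE P X c) (hY : PsiTwoLE P Y c)
    (hXm : Measurable X) : PsiTwoLE P (fun ω => X ω + Y ω) (2 * c) := by
  have hc := hX.1
  refine ⟨by linarith, ?_⟩
  calc ∫⁻ ω, ENNReal.ofReal (Real.exp ((X ω + Y ω) ^ 2 / (2 * c) ^ 2)) ∂P
      ≤ ∫⁻ ω, (ENNReal.ofReal (1 / 2) * ENNReal.ofReal (Real.exp (X ω ^ 2 / c ^ 2)) +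
          ENNReal.ofReal (1 / 2) * ENNReal.ofReal (Real.exp (Y ω ^ 2 / c ^ 2))) ∂P := by
        refine lintegral_mono fun ω => ?_
        rw [← ENNReal.ofReal_mul (by norm_num), ← ENNReal.ofReal_mul (by norm_num),
          ← ENNReal.ofReal_add (by positivity) (by positivity)]
        refine ENNReal.ofReal_le_ofReal ?_
        have h1 : (X ω + Y ω) ^ 2 / (2 * c) ^ 2 ≤
            1 / 2 * (X ω ^ 2 / c ^ 2) + 1 / 2 * (Y ω ^ 2 / c ^ 2) := by
          rw [← sub_nonneg]
          have : 1 / 2 * (X ω ^ 2 / c ^ 2) + 1 / 2 * (Y ω ^ 2 / c ^ 2) -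
              (X ω + Y ω) ^ 2 / (2 * c) ^ 2 = (X ω - Y ω) ^ 2 / (2 * c) ^ 2 := by
            field_simp; ring
          rw [this]; positivity
        have h2 := convexOn_exp.2 (Set.mem_univ (X ω ^ 2 / c ^ 2)) (Set.mem_univ (Y ω ^ 2 / c ^ 2))
          (show (0 : ℝ) ≤ 1 / 2 by norm_num) (show (0 : ℝ) ≤ 1 / 2 by norm_num) (by norm_num)
        simp only [smul_eq_mul] at h2
        exact (Real.exp_le_exp.2 h1).trans h2
    _ = ENNReal.ofReal (1 / 2) * ∫⁻ ω, ENNReal.ofReal (Real.exp (X ω ^ 2 / c ^ 2)) ∂P +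
          ENNReal.ofReal (1 / 2) * ∫⁻ ω, ENNReal.ofReal (Real.exp (Y ω ^ 2 / c ^ 2)) ∂P := by
        rw [lintegral_add_left (by fun_prop), lintegral_const_mul' _ _ ENNReal.ofReal_ne_top,
          lintegral_const_mul' _ _ ENNReal.ofReal_ne_top]
    _ ≤ ENNReal.ofReal (1 / 2) * 2 + ENNReal.ofReal (1 / 2) * 2 := by
        gcongr
        · exact hX.2
        · exact hY.2
    _ = 2 := by
        rw [← add_mul, ← ENNReal.ofReal_add (by norm_num) (by norm_num)]; norm_num

theorem psiTwoLE_of_bounded [IsProbabilityMeasure P] {X : Ω → ℝ} {c : ℝ} (hc : 0 < c)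
    (h : ∀ ω, 2 * |X ω| ≤ c) : PsiTwoLE P X c := by
  refine ⟨hc, ?_⟩
  calc ∫⁻ ω, ENNReal.ofReal (Real.exp (X ω ^ 2 / c ^ 2)) ∂P ≤ ∫⁻ _, 2 ∂P := by
        refine lintegral_mono fun ω => ?_
        have h1 : X ω ^ 2 / c ^ 2 ≤ 1 / 4 := by
          rw [div_le_iff₀ (by positivity), ← sq_abs (X ω)]
          nlinarith [h ω, abs_nonneg (X ω)]
        have h2 : Real.exp (X ω ^ 2 / c ^ 2) ≤ 2 := by
          have h3 : Real.exp (1 / 4) ≤ 2 := by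
            have := Real.exp_bound_div_one_sub_of_interval (x := 1 / 4) (by norm_num) (by norm_num)
            refine this.trans (by norm_num)
          exact (Real.exp_le_exp.2 h1).trans h3
        calc ENNReal.ofReal (Real.exp (X ω ^ 2 / c ^ 2)) ≤ ENNReal.ofReal 2 :=
              ENNReal.ofReal_le_ofReal h2
          _ = 2 := by simp
    _ = 2 := by simp

/-- |XY|/c² is at most the average of X²/c² and Y²/c², so exponential moments of products come from
those of squares. This is how Bernstein's inequality reaches every empirical covariance. -/
theorem PsiTwoLE.mul {X Y : Ω → ℝ} {c : ℝ} (hX : PsiTwoLE P X c) (hY : PsiTwoLE P Y c)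
    (hXm : Measurable X) (hYm : Measurable Y) : PsiOneLE P (fun ω => X ω * Y ω) (c ^ 2) := by
  have hc := hX.1
  have hle : ∀ ω, Real.exp (|X ω * Y ω| / c ^ 2) ≤
      1 / 2 * Real.exp (X ω ^ 2 / c ^ 2) + 1 / 2 * Real.exp (Y ω ^ 2 / c ^ 2) := by
    intro ω
    have h1 : |X ω * Y ω| / c ^ 2 ≤ 1 / 2 * (X ω ^ 2 / c ^ 2) + 1 / 2 * (Y ω ^ 2 / c ^ 2) := by
      rw [div_le_iff₀ (by positivity)]
      have : (1 / 2 * (X ω ^ 2 / c ^ 2) + 1 / 2 * (Y ω ^ 2 / c ^ 2)) * c ^ 2 =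
          1 / 2 * (X ω ^ 2 + Y ω ^ 2) := by field_simp
      rw [this, abs_mul, ← sq_abs (X ω), ← sq_abs (Y ω)]
      nlinarith [sq_nonneg (|X ω| - |Y ω|)]
    have h2 := convexOn_exp.2 (Set.mem_univ (X ω ^ 2 / c ^ 2)) (Set.mem_univ (Y ω ^ 2 / c ^ 2))
      (show (0 : ℝ) ≤ 1 / 2 by norm_num) (show (0 : ℝ) ≤ 1 / 2 by norm_num) (by norm_num)
    simp only [smul_eq_mul] at h2
    exact (Real.exp_le_exp.2 h1).trans h2
  have key : ∫⁻ ω, ENNReal.ofReal (Real.exp (|X ω * Y ω| / c ^ 2)) ∂P ≤ 2 := by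
    calc _ ≤ ∫⁻ ω, (ENNReal.ofReal (1 / 2) * ENNReal.ofReal (Real.exp (X ω ^ 2 / c ^ 2)) +
          ENNReal.ofReal (1 / 2) * ENNReal.ofReal (Real.exp (Y ω ^ 2 / c ^ 2))) ∂P := by
          refine lintegral_mono fun ω => ?_
          rw [← ENNReal.ofReal_mul (by norm_num), ← ENNReal.ofReal_mul (by norm_num),
            ← ENNReal.ofReal_add (by positivity) (by positivity)]
          exact ENNReal.ofReal_le_ofReal (hle ω)
      _ = ENNReal.ofReal (1 / 2) * ∫⁻ ω, ENNReal.ofReal (Real.exp (X ω ^ 2 / c ^ 2)) ∂P +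
          ENNReal.ofReal (1 / 2) * ∫⁻ ω, ENNReal.ofReal (Real.exp (Y ω ^ 2 / c ^ 2)) ∂P := by
          rw [lintegral_add_left (by fun_prop), lintegral_const_mul' _ _ ENNReal.ofReal_ne_top,
            lintegral_const_mul' _ _ ENNReal.ofReal_ne_top]
      _ ≤ ENNReal.ofReal (1 / 2) * 2 + ENNReal.ofReal (1 / 2) * 2 := by
          gcongr
          · exact hX.2
          · exact hY.2
      _ = 2 := by
          rw [← add_mul, ← ENNReal.ofReal_add (by norm_num) (by norm_num)]; norm_num
  have hmeas : Measurable fun ω => Real.exp (|X ω * Y ω| / c ^ 2) := by fun_prop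
  refine ⟨by positivity, by fun_prop, ⟨hmeas.aestronglyMeasurable, ?_⟩, ?_⟩
  · rw [hasFiniteIntegral_iff_ofReal (Eventually.of_forall fun ω => (Real.exp_pos _).le)]
    exact key.trans_lt (by simp)
  · rw [integral_eq_lintegral_of_nonneg_ae (Eventually.of_forall fun ω => (Real.exp_pos _).le)
      hmeas.aestronglyMeasurable]
    exact ENNReal.toReal_le_of_le_ofReal (by norm_num) (by simpa using key)

namespace PsiOneLE

variable {W : Ω → ℝ} {b : ℝ}

theorem integrable_abs (h : PsiOneLE P W b) : Integrable (fun ω => |W ω|) P := by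
  have hb := h.pos
  have hm := h.meas
  refine (h.integrable.const_mul b).mono' (by fun_prop) (Eventually.of_forall fun ω => ?_)
  rw [Real.norm_eq_abs, abs_abs]
  have := Real.add_one_le_exp (|W ω| / b)
  rw [← div_le_iff₀' hb]; linarith

theorem integrable_self (h : PsiOneLE P W b) : Integrable W P :=
  (integrable_norm_iff h.meas.aestronglyMeasurable).1 h.integrable_abs

theorem integrable_exp_mul (h : PsiOneLE P W b) {t : ℝ} (ht : |t| * b ≤ 1) :
    Integrable (fun ω => Real.exp (t * W ω)) P := by
  have hb := h.pos
  have hm := h.meas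
  refine h.integrable.mono' (by fun_prop) (Eventually.of_forall fun ω => ?_)
  rw [Real.norm_eq_abs, Real.abs_exp, Real.exp_le_exp, le_div_iff₀ hb]
  calc t * W ω * b ≤ |t * W ω| * b := by gcongr; exact le_abs_self _
    _ = (|t| * b) * |W ω| := by rw [abs_mul]; ring
    _ ≤ 1 * |W ω| := by gcongr
    _ = _ := one_mul _

/-- Taylor expansion eˣ ≤ 1 + x + x²e^{|x|} at x = tW. With a = |W|/b and |t|b ≤ 1/2, the bounds
e^{|x|} ≤ e^{a/2} and a²/8 ≤ e^{a/2} turn the remainder into 8(tb)²eᵃ, of mean at most 16(tb)². The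
mean of W is kept in the linear term, so no centring is required. -/
theorem mgf_le [IsProbabilityMeasure P] (h : PsiOneLE P W b) {t : ℝ} (ht : |t| * b ≤ 1 / 2) :
    mgf W P t ≤ Real.exp (t * ∫ ω, W ω ∂P + 16 * (t * b) ^ 2) := by
  have hb := h.pos
  have hpt : ∀ ω, Real.exp (t * W ω) ≤
      1 + t * W ω + 8 * (t * b) ^ 2 * Real.exp (|W ω| / b) := by
    intro ω
    have h1 : |Real.exp (t * W ω) - (1 + t * W ω)| ≤
        |t * W ω| ^ 2 * Real.exp |t * W ω| := by
      have := Complex.norm_exp_sub_sum_le_norm_mul_exp ((t * W ω : ℝ) : ℂ) 2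
      rw [Complex.norm_real, Real.norm_eq_abs] at this
      refine le_trans (le_of_eq ?_) this
      rw [← Real.norm_eq_abs, ← Complex.norm_real]
      congr 1
      push_cast [Finset.sum_range_succ]
      simp
    set a := |W ω| / b with ha
    have ha0 : 0 ≤ a := by positivity
    have h2 : |t * W ω| = (|t| * b) * a := by rw [abs_mul, ha]; field_simp
    have h3 : Real.exp |t * W ω| ≤ Real.exp (a / 2) := by
      rw [Real.exp_le_exp, h2]; nlinarith
    have h4 : a ^ 2 / 8 ≤ Real.exp (a / 2) := by
      have := Real.quadratic_le_exp_of_nonneg (x := a / 2) (by positivity)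
      nlinarith
    have h5 : Real.exp (a / 2) * Real.exp (a / 2) = Real.exp a := by
      rw [← Real.exp_add]; ring_nf
    have h6 : |t * W ω| ^ 2 * Real.exp |t * W ω| ≤ 8 * (t * b) ^ 2 * Real.exp a := by
      calc |t * W ω| ^ 2 * Real.exp |t * W ω| ≤ |t * W ω| ^ 2 * Real.exp (a / 2) := by gcongr
        _ = (t * b) ^ 2 * (8 * (a ^ 2 / 8)) * Real.exp (a / 2) := by
            rw [h2, mul_pow, mul_pow, sq_abs]; ring
        _ ≤ (t * b) ^ 2 * (8 * Real.exp (a / 2)) * Real.exp (a / 2) := by gcongr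
        _ = 8 * (t * b) ^ 2 * (Real.exp (a / 2) * Real.exp (a / 2)) := by ring
        _ = _ := by rw [h5]
    linarith [(abs_le.1 h1).2]
  have hint := h.integrable_self
  have h1 : mgf W P t ≤ ∫ ω, (1 + t * W ω + 8 * (t * b) ^ 2 * Real.exp (|W ω| / b)) ∂P :=
    integral_mono (h.integrable_exp_mul (ht.trans (by norm_num)))
      (((integrable_const 1).add (hint.const_mul t)).add (h.integrable.const_mul _)) hpt
  have h2 : ∫ ω, (1 + t * W ω + 8 * (t * b) ^ 2 * Real.exp (|W ω| / b)) ∂P =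
      1 + t * ∫ ω, W ω ∂P + 8 * (t * b) ^ 2 * ∫ ω, Real.exp (|W ω| / b) ∂P := by
    have hlin : Integrable (fun ω => 1 + t * W ω) P := (integrable_const 1).add (hint.const_mul t)
    rw [integral_add hlin (h.integrable.const_mul _),
      integral_add (integrable_const 1) (hint.const_mul t), integral_const_mul,
      integral_const_mul]
    simp
  rw [h2] at h1
  refine h1.trans ?_
  have h3 := Real.add_one_le_exp (t * ∫ ω, W ω ∂P + 16 * (t * b) ^ 2)
  have h4 := mul_le_mul_of_nonneg_left h.integral_le (show 0 ≤ 8 * (t * b) ^ 2 by positivity)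
  linarith

theorem neg (h : PsiOneLE P W b) : PsiOneLE P (fun ω => -W ω) b :=
  ⟨h.pos, h.meas.neg, by simpa using h.integrable, by simpa using h.integral_le⟩

theorem abs (h : PsiOneLE P W b) : PsiOneLE P (fun ω => |W ω|) b :=
  ⟨h.pos, by have := h.meas; fun_prop, by simpa using h.integrable, by simpa using h.integral_le⟩

variable {n : ℕ} {V : Fin n → Ω → ℝ}

/-- Chernoff bound. -/
theorem measure_sum_ge_le [IsProbabilityMeasure P] (h : PsiOneLE P W b)
    (hind : iIndepFun V P) (hV : ∀ i, Measurable (V i)) (hid : ∀ i, IdentDistrib (V i) W P P)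
    {t : ℝ} (ht0 : 0 ≤ t) (ht : t * b ≤ 1) (a : ℝ) :
    P.real {ω | a ≤ ∑ i, V i ω} ≤ Real.exp (-t * a) * mgf W P t ^ n := by
  have hmgf : ∀ i, mgf (V i) P t = mgf W P t := fun i => mgf_congr_of_identDistrib _ _ (hid i) t
  have hint : Integrable (fun ω => Real.exp (t * (∑ i, V i) ω)) P :=
    hind.integrable_exp_mul_sum hV fun i _ =>
      (((hid i).comp (u := fun x => Real.exp (t * x)) (by fun_prop)).integrable_iff).2
        (h.integrable_exp_mul (by rwa [abs_of_nonneg ht0]))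
  have := measure_ge_le_exp_mul_mgf (X := ∑ i, V i) a ht0 hint
  rw [hind.mgf_sum hV] at this
  simpa [hmgf, Finset.sum_apply] using this

theorem measure_sum_sub_ge_le [IsProbabilityMeasure P] (h : PsiOneLE P W b)
    (hind : iIndepFun V P) (hV : ∀ i, Measurable (V i)) (hid : ∀ i, IdentDistrib (V i) W P P)
    {x : ℝ} (hx0 : 0 ≤ x) (hx : x ≤ 16 * b) :
    P.real {ω | n * ∫ ω, W ω ∂P + n * x ≤ ∑ i, V i ω} ≤ Real.exp (-(n * x ^ 2 / (64 * b ^ 2))) := by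
  have hb := h.pos
  -- Minimises −tx + 16t²b²; the condition x ≤ 16b is exactly tb ≤ 1/2.
  set t := x / (32 * b ^ 2) with ht
  have ht0 : 0 ≤ t := by positivity
  have htb : t * b ≤ 1 / 2 := by
    rw [ht]
    have : x / (32 * b ^ 2) * b = x / (32 * b) := by field_simp
    rw [this, div_le_iff₀ (by positivity)]; linarith
  have h1 := h.measure_sum_ge_le hind hV hid ht0 (htb.trans (by norm_num))
    (n * ∫ ω, W ω ∂P + n * x)
  have h2 := pow_le_pow_left₀ mgf_nonneg (h.mgf_le (t := t) (by rwa [abs_of_nonneg ht0])) n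
  refine h1.trans ((mul_le_mul_of_nonneg_left h2 (Real.exp_pos _).le).trans_eq ?_)
  rw [← Real.exp_nat_mul, ← Real.exp_add]
  congr 1
  rw [ht]; field_simp; ring

/-- Bernstein's inequality. -/
theorem measure_abs_sum_sub_ge_le [IsProbabilityMeasure P] (h : PsiOneLE P W b)
    (hind : iIndepFun V P) (hV : ∀ i, Measurable (V i)) (hid : ∀ i, IdentDistrib (V i) W P P)
    {x : ℝ} (hx0 : 0 ≤ x) (hx : x ≤ 16 * b) :
    P.real {ω | n * x ≤ |∑ i, V i ω - n * ∫ ω, W ω ∂P|} ≤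
      2 * Real.exp (-(n * x ^ 2 / (64 * b ^ 2))) := by
  have h1 := h.measure_sum_sub_ge_le hind hV hid hx0 hx
  have h2 := h.neg.measure_sum_sub_ge_le (V := fun i ω => -V i ω)
    (hind.comp (fun _ x => -x) fun _ => measurable_neg) (fun i => (hV i).neg)
    (fun i => (hid i).comp measurable_neg) hx0 hx
  rw [integral_neg] at h2
  simp only [Finset.sum_neg_distrib] at h2
  calc _ ≤ P.real ({ω | n * ∫ ω, W ω ∂P + n * x ≤ ∑ i, V i ω} ∪
        {ω | n * -∫ ω, W ω ∂P + n * x ≤ -∑ i, V i ω}) := by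
        refine measureReal_mono (fun ω hω => ?_) (measure_ne_top _ _)
        simp only [Set.mem_union, Set.mem_ofPred_eq] at hω ⊢
        rcases le_abs.1 hω with h | h
        · left; linarith
        · right; linarith
    _ ≤ _ := measureReal_union_le _ _
    _ ≤ _ := by linarith

/-- Chernoff at the largest available exponent 1/b: each factor is at most 2 ≤ e, so the n
observations cost n in the exponent. Unlike Bernstein this allows arbitrarily large t, as the
operator norm of U requires. -/
theorem measure_sum_abs_ge_le [IsProbabilityMeasure P] (h : PsiOneLE P W b)
    (hind : iIndepFun V P) (hV : ∀ i, Measurable (V i)) (hid : ∀ i, IdentDistrib (V i) W P P)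
    (t : ℝ) : P.real {ω | b * (n + t) ≤ ∑ i, |V i ω|} ≤ Real.exp (-t) := by
  have hb := h.pos
  have h1 := h.abs.measure_sum_ge_le (V := fun i ω => |V i ω|)
    (hind.comp (fun _ x => |x|) fun _ => by fun_prop) (fun i => by have := hV i; fun_prop)
    (fun i => (hid i).comp (u := fun x => |x|) (by fun_prop)) (t := b⁻¹) (by positivity)
    (inv_mul_cancel₀ hb.ne').le (b * (n + t))
  have h2 : mgf (fun ω => |W ω|) P b⁻¹ ≤ Real.exp 1 := by
    have : mgf (fun ω => |W ω|) P b⁻¹ = ∫ ω, Real.exp (|W ω| / b) ∂P := by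
      simp only [mgf, div_eq_inv_mul]
    rw [this]
    refine h.integral_le.trans ?_
    have := Real.add_one_le_exp 1
    linarith
  refine h1.trans ((mul_le_mul_of_nonneg_left (pow_le_pow_left₀ mgf_nonneg h2 n)
    (Real.exp_pos _).le).trans_eq ?_)
  rw [← Real.exp_nat_mul, ← Real.exp_add]
  congr 1
  field_simp; ring

end PsiOneLE

end

end

/-! ### Population regression: moments, coefficients and a common `ψ₂` scale. -/

noncomputable section

section

variable {Ω : Type*} [MeasurableSpace Ω] {P : Measure Ω}

theorem PsiTwoLE.of_le {X : Ω → ℝ} {c d : ℝ} (h : PsiTwoLE P X c) (hcd : c ≤ d) :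
    PsiTwoLE P X d := by
  have hc := h.1
  exact h.mono (hc.trans_le hcd) fun ω => by gcongr

theorem psiTwoLE_of_psiTwoNorm_lt {X : Ω → ℝ} {c : ℝ} (h : psiTwoNorm P X < ENNReal.ofReal c) :
    PsiTwoLE P X c := by
  rw [psiTwoNorm, iInf_lt_iff] at h
  obtain ⟨d, hd⟩ := h
  rw [iInf_lt_iff] at hd
  obtain ⟨hd, hdc⟩ := hd
  exact PsiTwoLE.of_le hd (ENNReal.ofReal_lt_ofReal_iff_of_nonneg hd.1.le |>.1 hdc).le

/-- The norm is an infimum, so c is relaxed to 2c to make it strictly smaller and obtain an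
admissible scale; the rest is homogeneity. -/
theorem psiTwoLE_dotProduct [IsProbabilityMeasure P] {m : ℕ} {X : Ω → Fin m → ℝ} {c L : ℝ}
    (hc : 0 < c) (hX : psiTwoNormVec P X ≤ ENNReal.ofReal c) {v : Fin m → ℝ} (hL : 0 < L)
    (hv : l2Norm v ≤ L) : PsiTwoLE P (fun ω => v ⬝ᵥ X ω) (2 * c * L) := by
  by_cases h0 : v = 0
  · simp only [h0, zero_dotProduct]
    exact psiTwoLE_of_bounded (by positivity) fun ω => by simp only [abs_zero, mul_zero]; positivity
  have hv0 := l2Norm_pos h0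
  have h1 : PsiTwoLE P (fun ω => ((l2Norm v)⁻¹ • v) ⬝ᵥ X ω) (2 * c) := by
    apply psiTwoLE_of_psiTwoNorm_lt
    refine lt_of_le_of_lt (le_trans ?_ hX) (ENNReal.ofReal_lt_ofReal_iff (by linarith) |>.2
      (show c < 2 * c by linarith))
    refine le_iSup₂_of_le (f := fun (a : Fin m → ℝ) (_ : l2Norm a = 1) =>
      psiTwoNorm P fun ω => a ⬝ᵥ X ω) ((l2Norm v)⁻¹ • v) ?_ le_rfl
    rw [l2Norm_smul, abs_of_pos (inv_pos.2 hv0), inv_mul_cancel₀ hv0.ne']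
  refine h1.mono (by positivity) fun ω => ?_
  rw [smul_dotProduct, smul_eq_mul, abs_mul, abs_of_pos (inv_pos.2 hv0), div_le_div_iff₀
    (by positivity) (by positivity)]
  have h2 : (l2Norm v)⁻¹ * L ≥ 1 := by
    rw [ge_iff_le, inv_mul_eq_div, one_le_div hv0]; exact hv
  have h3 : 0 ≤ |v ⬝ᵥ X ω| * (2 * c) := by positivity
  nlinarith

/-- `P (G(Y) ≤ v) ≤ v` for the distribution function `G` of `Y`. -/
theorem measureReal_cdf_le (μ : Measure ℝ) [IsProbabilityMeasure μ] {v : ℝ} (hv : 0 ≤ v) :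
    μ.real {y | cdf μ y ≤ v} ≤ v := by
  have hmeas : MeasurableSet {y | cdf μ y ≤ v} := (monotone_cdf μ).measurable measurableSet_Iic
  by_contra! hcon
  have h1 : ENNReal.ofReal v < μ {y | cdf μ y ≤ v} := by
    rwa [ENNReal.ofReal_lt_iff_lt_toReal hv (measure_ne_top _ _)]
  -- Inner regularity replaces a quantile argument: a compact subset lies below its maximum y, which
  -- belongs to the set, so its mass is at most G(y) ≤ v. Atoms cause no difficulty.
  obtain ⟨C, hC, hCc, hlt⟩ := hmeas.exists_lt_isCompact h1
  rcases C.eq_empty_or_nonempty with rfl | hne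
  · simp at hlt
  obtain ⟨y, hyC, hy⟩ := hCc.exists_isGreatest hne
  have h2 : μ C ≤ ENNReal.ofReal v := by
    calc μ C ≤ μ (Set.Iic y) := measure_mono fun z hz => hy hz
      _ = ENNReal.ofReal (cdf μ y) := (ofReal_cdf μ y).symm
      _ ≤ _ := ENNReal.ofReal_le_ofReal (hC hyC)
  exact absurd hlt (not_lt.2 h2)

end

namespace FASIM

variable {K p : ℕ} {Ω : Type*} [MeasurableSpace Ω] {P : Measure Ω} [IsProbabilityMeasure P]
  (M : FASIM K p P) {c₀ τ Υ κ : ℝ}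

omit [IsProbabilityMeasure P] in
theorem measurable_index : Measurable M.index := by
  have h1 := M.measurable_f
  have h2 := M.measurable_u
  unfold index dotProduct
  fun_prop

omit [IsProbabilityMeasure P] in
theorem measurable_Y : Measurable M.Y :=
  M.measurable_g.comp (M.measurable_index.prodMk M.measurable_ε)

instance isProbabilityMeasure_map_Y : IsProbabilityMeasure (P.map M.Y) :=
  Measure.isProbabilityMeasure_map M.measurable_Y.aemeasurable

omit [IsProbabilityMeasure P] in
theorem measurable_hY : Measurable M.hY :=
  ((monotone_cdf (P.map M.Y)).measurable.comp M.measurable_Y).sub_const _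

omit [IsProbabilityMeasure P] in
theorem abs_hY_le (ω : Ω) : |M.hY ω| ≤ 1 / 2 := by
  have h1 := cdf_nonneg (P.map M.Y) (M.Y ω)
  have h2 := cdf_le_one (P.map M.Y) (M.Y ω)
  rw [abs_le, hY]; constructor <;> linarith

/-- The coefficients of the factors in the linear regression of `h(Y)` on `(f, u)`. -/
def gammaH : Fin K → ℝ := fun k => cov[fun ω => M.f ω k, M.hY; P]

/-- The error of the linear regression of `h(Y)` on `(f, u)`, as a function of the data. -/
def residual (t : (Fin K → ℝ) × (Fin p → ℝ) × ℝ) : ℝ :=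
  cdf (P.map M.Y) t.2.2 - 1 / 2 - M.gammaH ⬝ᵥ t.1 - M.betaH ⬝ᵥ t.2.1

/-- The population triple `(f, u, Y)`. -/
def triple (ω : Ω) : (Fin K → ℝ) × (Fin p → ℝ) × ℝ := (M.f ω, M.u ω, M.Y ω)

omit [IsProbabilityMeasure P] in
theorem measurable_triple : Measurable M.triple :=
  M.measurable_f.prodMk (M.measurable_u.prodMk M.measurable_Y)

omit [IsProbabilityMeasure P] in
theorem measurable_residual : Measurable M.residual := by
  have h1 : Measurable fun t : (Fin K → ℝ) × (Fin p → ℝ) × ℝ => cdf (P.map M.Y) t.2.2 :=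
    (monotone_cdf (P.map M.Y)).measurable.comp (by fun_prop)
  unfold residual dotProduct
  fun_prop

omit [IsProbabilityMeasure P] in
theorem residual_triple (ω : Ω) :
    M.residual (M.triple ω) = M.hY ω - M.gammaH ⬝ᵥ M.f ω - M.betaH ⬝ᵥ M.u ω := rfl

/-- A common `ψ₂` scale for all variables that occur in the analysis. -/
def psiScale (c₀ τ κ : ℝ) : ℝ := 4 * (1 + 2 * c₀ * (1 + τ + 1 / κ))

namespace Regular

variable {M} (R : M.Regular c₀ τ Υ κ) (hc₀ : 0 < c₀) (hτ : 1 < τ) (hκ₀ : 0 < κ) (hκ₁ : κ < 1)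
include R

omit R in
theorem memLp_hY : MemLp M.hY 2 P :=
  MemLp.of_bound M.measurable_hY.aestronglyMeasurable (1 / 2)
    (Eventually.of_forall fun ω => by rw [Real.norm_eq_abs]; exact M.abs_hY_le ω)

omit R [IsProbabilityMeasure P] in
theorem integrable_mul {X Y : Ω → ℝ} (hX : MemLp X 2 P) (hY : MemLp Y 2 P) :
    Integrable (fun ω => X ω * Y ω) P := hX.integrable_mul hY

omit R [IsProbabilityMeasure P] in
theorem memLp_dotProduct {m : ℕ} {X : Ω → Fin m → ℝ} (hX : ∀ j, MemLp (fun ω => X ω j) 2 P)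
    (v : Fin m → ℝ) : MemLp (fun ω => v ⬝ᵥ X ω) 2 P := by
  unfold dotProduct
  exact memLp_finsetSum _ fun j _ => (hX j).const_mul (v j)

omit R [IsProbabilityMeasure P] in
theorem integral_dotProduct_mul {m : ℕ} {X : Ω → Fin m → ℝ} (hX : ∀ j, MemLp (fun ω => X ω j) 2 P)
    (v : Fin m → ℝ) {Z : Ω → ℝ} (hZ : MemLp Z 2 P) :
    ∫ ω, (v ⬝ᵥ X ω) * Z ω ∂P = v ⬝ᵥ fun j => ∫ ω, X ω j * Z ω ∂P := by
  simp only [dotProduct, Finset.sum_mul, mul_assoc]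
  rw [integral_finsetSum _ fun j _ => (integrable_mul (hX j) hZ).const_mul (v j)]
  simp only [integral_const_mul]

theorem integral_u_mul {Z : Ω → ℝ} (hZ : MemLp Z 2 P) (j : Fin p) :
    ∫ ω, M.u ω j * Z ω ∂P = cov[fun ω => M.u ω j, Z; P] := by
  rw [covariance_eq_sub (M.memLp_u j) hZ, R.mean_u j, zero_mul, sub_zero]; rfl

theorem integral_f_mul {Z : Ω → ℝ} (hZ : MemLp Z 2 P) (k : Fin K) :
    ∫ ω, M.f ω k * Z ω ∂P = cov[fun ω => M.f ω k, Z; P] := by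
  rw [covariance_eq_sub (M.memLp_f k) hZ, R.mean_f k, zero_mul, sub_zero]; rfl

theorem integral_u_mul_dotProduct (j : Fin p) (v : Fin p → ℝ) :
    ∫ ω, M.u ω j * (v ⬝ᵥ M.u ω) ∂P = (M.covU *ᵥ v) j := by
  have := integral_dotProduct_mul M.memLp_u v (M.memLp_u j)
  simp only [mul_comm (M.u _ j)]
  rw [this, mulVec, dotProduct_comm]
  congr 1; ext l
  rw [covU, of_apply, ← R.integral_u_mul (M.memLp_u l) j]
  simp only [mul_comm]

theorem integral_dotProduct_sq (v : Fin p → ℝ) :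
    ∫ ω, (v ⬝ᵥ M.u ω) * (v ⬝ᵥ M.u ω) ∂P = v ⬝ᵥ M.covU *ᵥ v := by
  rw [integral_dotProduct_mul M.memLp_u v (memLp_dotProduct M.memLp_u v)]
  congr 1; ext j
  exact R.integral_u_mul_dotProduct j v

theorem integral_u_mul_f (j : Fin p) (v : Fin K → ℝ) :
    ∫ ω, M.u ω j * (v ⬝ᵥ M.f ω) ∂P = 0 := by
  simp only [mul_comm (M.u _ j)]
  rw [integral_dotProduct_mul M.memLp_f v (M.memLp_u j)]
  have : (fun k => ∫ ω, M.f ω k * M.u ω j ∂P) = 0 := by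
    ext k
    have := R.integral_u_mul (M.memLp_f k) j
    rw [M.uncorrelated] at this
    simpa only [Pi.zero_apply, mul_comm] using this
  rw [this, dotProduct_zero]

theorem integral_f_mul_u (k : Fin K) (v : Fin p → ℝ) :
    ∫ ω, M.f ω k * (v ⬝ᵥ M.u ω) ∂P = 0 := by
  simp only [mul_comm (M.f _ k)]
  rw [integral_dotProduct_mul M.memLp_u v (M.memLp_f k)]
  have : (fun j => ∫ ω, M.u ω j * M.f ω k ∂P) = 0 := by
    ext j
    rw [R.integral_u_mul (M.memLp_f k) j, M.uncorrelated, Pi.zero_apply]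
  rw [this, dotProduct_zero]

theorem integral_f_mul_dotProduct (k : Fin K) (v : Fin K → ℝ) :
    ∫ ω, M.f ω k * (v ⬝ᵥ M.f ω) ∂P = v k := by
  simp only [mul_comm (M.f _ k)]
  rw [integral_dotProduct_mul M.memLp_f v (M.memLp_f k)]
  simp only [R.integral_f_mul (M.memLp_f k), M.cov_f, dotProduct]
  simp

omit R [IsProbabilityMeasure P] in
theorem transpose_covU : M.covUᵀ = M.covU := by
  ext j l
  rw [transpose_apply, covU, of_apply, of_apply, covariance_comm]

omit [IsProbabilityMeasure P] in
theorem mul_l2Norm_sq_le (v : Fin p → ℝ) : κ * l2Norm v ^ 2 ≤ v ⬝ᵥ M.covU *ᵥ v :=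
  mul_l2Norm_sq_le_of_spectrum transpose_covU (fun r hr => (R.eig_covU r hr).1) v

include hκ₀ in
theorem covU_mulVec_betaH : M.covU *ᵥ M.betaH = fun j => cov[fun ω => M.u ω j, M.hY; P] := by
  have h1 : (Matrix.of fun j l => ∫ ω, M.u ω j * M.u ω l ∂P : Matrix (Fin p) (Fin p) ℝ) =
      M.covU := by
    ext j l
    rw [of_apply, covU, of_apply, R.integral_u_mul (M.memLp_u l)]
  have h2 : IsUnit M.covU := by
    by_contra hcon
    have : (0 : ℝ) ∈ spectrum ℝ M.covU := by rwa [spectrum.zero_mem_iff]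
    linarith [(R.eig_covU 0 this).1]
  rw [betaH, h1, mulVec_mulVec, mul_nonsing_inv _ ((isUnit_iff_isUnit_det _).1 h2), one_mulVec]

omit R in
theorem integral_mul_residual {Z : Ω → ℝ} (hZ : MemLp Z 2 P) :
    ∫ ω, Z ω * M.residual (M.triple ω) ∂P = ∫ ω, Z ω * M.hY ω ∂P -
      ∫ ω, Z ω * (M.gammaH ⬝ᵥ M.f ω) ∂P - ∫ ω, Z ω * (M.betaH ⬝ᵥ M.u ω) ∂P := by
  have i1 := integrable_mul hZ (memLp_hY (M := M))
  have i2 := integrable_mul hZ (memLp_dotProduct M.memLp_f M.gammaH)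
  have i3 := integrable_mul hZ (memLp_dotProduct M.memLp_u M.betaH)
  have i4 : Integrable (fun ω => Z ω * M.hY ω - Z ω * (M.gammaH ⬝ᵥ M.f ω)) P := i1.sub i2
  simp only [residual_triple, mul_sub]
  rw [integral_sub i4 i3, integral_sub i1 i2]

include hκ₀ in
-- Population normal equation. As u and f are uncorrelated, the joint regression on (f, u) splits,
-- and Σ_u β_h = Cov(u, h(Y)) cancels the rest.
theorem integral_u_mul_residual (j : Fin p) :
    ∫ ω, M.u ω j * M.residual (M.triple ω) ∂P = 0 := by
  rw [integral_mul_residual (M.memLp_u j), R.integral_u_mul memLp_hY, R.integral_u_mul_f,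
    R.integral_u_mul_dotProduct, R.covU_mulVec_betaH hκ₀]
  simp

theorem integral_f_mul_residual (k : Fin K) :
    ∫ ω, M.f ω k * M.residual (M.triple ω) ∂P = 0 := by
  rw [integral_mul_residual (M.memLp_f k), R.integral_f_mul memLp_hY, R.integral_f_mul_u,
    R.integral_f_mul_dotProduct, gammaH]
  simp

omit R in
-- Integrates (Z − h(Y))² ≥ 0 with h(Y)² ≤ 1/4. For a fitted value Z one has E Z h(Y) = E Z², so E
-- Z² ≤ 1/4; this bounds the regression coefficients.
theorem integral_dotProduct_mul_hY_le {Z : Ω → ℝ} (hZ : MemLp Z 2 P) :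
    2 * ∫ ω, Z ω * M.hY ω ∂P ≤ 1 / 4 + ∫ ω, Z ω * Z ω ∂P := by
  have i1 := integrable_mul hZ (memLp_hY (M := M))
  have i2 := integrable_mul hZ hZ
  rw [← integral_const_mul]
  have : ∫ ω, (1 / 4 + Z ω * Z ω) ∂P = 1 / 4 + ∫ ω, Z ω * Z ω ∂P := by
    rw [integral_add (integrable_const _) i2]; simp
  rw [← this]
  refine integral_mono (i1.const_mul 2) ((integrable_const _).add i2) fun ω => ?_
  have h1 := abs_le.1 (M.abs_hY_le ω)
  show 2 * (Z ω * M.hY ω) ≤ 1 / 4 + Z ω * Z ω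
  nlinarith [sq_nonneg (Z ω - M.hY ω)]

theorem l2Norm_gammaH_le : l2Norm M.gammaH ≤ 1 := by
  have h1 := integral_dotProduct_mul_hY_le (M := M) (memLp_dotProduct M.memLp_f M.gammaH)
  rw [integral_dotProduct_mul M.memLp_f _ memLp_hY,
    integral_dotProduct_mul M.memLp_f _ (memLp_dotProduct M.memLp_f M.gammaH)] at h1
  simp only [R.integral_f_mul memLp_hY, R.integral_f_mul_dotProduct] at h1
  change 2 * (M.gammaH ⬝ᵥ M.gammaH) ≤ 1 / 4 + M.gammaH ⬝ᵥ M.gammaH at h1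
  exact l2Norm_le_of_sq zero_le_one (by linarith)

include hκ₀ hκ₁ in
theorem l2Norm_betaH_le : l2Norm M.betaH ≤ 1 / κ := by
  have h1 := integral_dotProduct_mul_hY_le (M := M) (memLp_dotProduct M.memLp_u M.betaH)
  rw [integral_dotProduct_mul M.memLp_u _ memLp_hY, R.integral_dotProduct_sq] at h1
  simp only [R.integral_u_mul memLp_hY] at h1
  rw [← R.covU_mulVec_betaH hκ₀] at h1
  have h2 := R.mul_l2Norm_sq_le M.betaH
  have h3 : (κ * l2Norm M.betaH) ^ 2 ≤ 1 ^ 2 := by nlinarith [sq_nonneg (l2Norm M.betaH)]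
  rw [le_div_iff₀ hκ₀, mul_comm]
  exact (abs_le_of_sq_le_sq' h3 zero_le_one).2

omit R [IsProbabilityMeasure P] in
include hc₀ hτ hκ₀ in
theorem psiScale_pos : 4 ≤ psiScale c₀ τ κ := by
  have : 0 < 1 / κ := by positivity
  have : 0 ≤ 2 * c₀ * (1 + τ + 1 / κ) := by positivity
  rw [psiScale]; linarith

include hc₀ hτ hκ₀ in
theorem psiTwoLE_u {v : Fin p → ℝ} (hv : l2Norm v ≤ 1) :
    PsiTwoLE P (fun ω => v ⬝ᵥ M.u ω) (psiScale c₀ τ κ) := by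
  refine (psiTwoLE_dotProduct hc₀ R.psi_u (one_pos.trans hτ) (hv.trans hτ.le)).of_le ?_
  have : 0 < 1 / κ := by positivity
  rw [psiScale]; nlinarith

include hc₀ hτ hκ₀ in
theorem psiTwoLE_u' {v : Fin p → ℝ} (hv : l2Norm v ≤ τ) :
    PsiTwoLE P (fun ω => v ⬝ᵥ M.u ω) (psiScale c₀ τ κ) := by
  refine (psiTwoLE_dotProduct hc₀ R.psi_u (one_pos.trans hτ) hv).of_le ?_
  have : 0 < 1 / κ := by positivity
  rw [psiScale]; nlinarith

include hc₀ hτ hκ₀ in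
theorem psiTwoLE_f {v : Fin K → ℝ} (hv : l2Norm v ≤ 1) :
    PsiTwoLE P (fun ω => v ⬝ᵥ M.f ω) (psiScale c₀ τ κ) := by
  refine (psiTwoLE_dotProduct hc₀ R.psi_f (one_pos.trans hτ) (hv.trans hτ.le)).of_le ?_
  have : 0 < 1 / κ := by positivity
  rw [psiScale]; nlinarith

include hc₀ hτ hκ₀ hκ₁ in
theorem psiTwoLE_residual : PsiTwoLE P (fun ω => M.residual (M.triple ω)) (psiScale c₀ τ κ) := by
  have hk : 0 < 1 / κ := by positivity
  set d := 1 + 2 * c₀ * (1 + τ + 1 / κ) with hd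
  have hdpos : 1 ≤ d := by
    have : 0 ≤ 2 * c₀ * (1 + τ + 1 / κ) := by positivity
    linarith
  have h1 : PsiTwoLE P M.hY d :=
    psiTwoLE_of_bounded (by linarith) fun ω => by linarith [M.abs_hY_le ω]
  have h2 : PsiTwoLE P (fun ω => (-M.gammaH) ⬝ᵥ M.f ω) d := by
    refine (psiTwoLE_dotProduct hc₀ R.psi_f one_pos
      (by rw [l2Norm_neg]; exact R.l2Norm_gammaH_le)).of_le ?_
    nlinarith
  have h3 : PsiTwoLE P (fun ω => (-M.betaH) ⬝ᵥ M.u ω) (2 * d) := by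
    refine (psiTwoLE_dotProduct hc₀ R.psi_u hk
      (by rw [l2Norm_neg]; exact R.l2Norm_betaH_le hκ₀ hκ₁)).of_le ?_
    nlinarith
  -- Each addition doubles the scale, from d to 2d to 4d; this is the factor 4 in `psiScale`.
  have h4 := (h1.add h2 M.measurable_hY).add h3 (by
    have h1 := M.measurable_hY
    have h2 := M.measurable_f
    unfold dotProduct
    fun_prop)
  have e1 : psiScale c₀ τ κ = 2 * (2 * d) := by rw [psiScale, hd]; ring
  rw [e1]
  convert h4 using 2 with ω
  rw [residual_triple, neg_dotProduct, neg_dotProduct]; ring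

end Regular

end FASIM

end

/-! ### Concentration of sample averages, signed sums and the empirical distribution function. -/

noncomputable section

theorem measureReal_exists_le {Ω ι : Type*} [MeasurableSpace Ω] (P : Measure Ω) [Fintype ι]
    {q : ℝ} (A : ι → Set Ω) (hA : ∀ a, P.real (A a) ≤ q) :
    P.real (⋃ a, A a) ≤ Fintype.card ι * q := by
  refine (measureReal_iUnion_fintype_le _).trans ?_
  refine (Finset.sum_le_card_nsmul _ _ _ fun a _ => hA a).trans_eq ?_
  simp

namespace FASIM

variable {K p n : ℕ} {Ω : Type*} [MeasurableSpace Ω] {P : Measure Ω} [IsProbabilityMeasure P]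
  {M : FASIM K p P} {c₀ τ Υ κ c : ℝ} (S : M.Sample n)

namespace Sample

/-- The `i`-th observation. -/
def triple (i : Fin n) (ω : Ω) : (Fin K → ℝ) × (Fin p → ℝ) × ℝ := (S.f i ω, S.u i ω, S.Y i ω)

omit [IsProbabilityMeasure P] in
theorem measurable_triple (i : Fin n) : Measurable (S.triple i) :=
  (S.measurable_f i).prodMk ((S.measurable_u i).prodMk (S.measurable_Y i))

theorem measure_abs_sum_ge_le {φ ψ : (Fin K → ℝ) × (Fin p → ℝ) × ℝ → ℝ} (hφ : Measurable φ)
    (hψ : Measurable ψ) (h1 : PsiTwoLE P (fun ω => φ (M.triple ω)) c)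
    (h2 : PsiTwoLE P (fun ω => ψ (M.triple ω)) c) {x : ℝ} (hx0 : 0 ≤ x) (hx : x ≤ 16 * c ^ 2) :
    P.real {ω | n * x ≤ |∑ i, φ (S.triple i ω) * ψ (S.triple i ω) -
      n * ∫ ω, φ (M.triple ω) * ψ (M.triple ω) ∂P|} ≤
      2 * Real.exp (-(n * x ^ 2 / (64 * (c ^ 2) ^ 2))) :=
  (h1.mul h2 (hφ.comp M.measurable_triple) (hψ.comp M.measurable_triple)).measure_abs_sum_sub_ge_le
    (V := fun i ω => φ (S.triple i ω) * ψ (S.triple i ω))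
    (S.indep.comp (fun _ t => φ t * ψ t) fun _ => hφ.mul hψ)
    (fun i => (hφ.mul hψ).comp (S.measurable_triple i))
    (fun i => (S.ident i).comp (u := fun t => φ t * ψ t) (hφ.mul hψ)) hx0 hx

theorem measure_sum_sq_ge_le {φ : (Fin K → ℝ) × (Fin p → ℝ) × ℝ → ℝ} (hφ : Measurable φ)
    (h1 : PsiTwoLE P (fun ω => φ (M.triple ω)) c) (t : ℝ) :
    P.real {ω | c ^ 2 * (n + t) ≤ ∑ i, φ (S.triple i ω) ^ 2} ≤ Real.exp (-t) := by
  have h2 : Measurable fun ω => φ (M.triple ω) := hφ.comp M.measurable_triple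
  have := (h1.mul h1 h2 h2).measure_sum_abs_ge_le
    (V := fun i ω => φ (S.triple i ω) * φ (S.triple i ω))
    (S.indep.comp (fun _ t => φ t * φ t) fun _ => hφ.mul hφ)
    (fun i => (hφ.mul hφ).comp (S.measurable_triple i))
    (fun i => (S.ident i).comp (u := fun t => φ t * φ t) (hφ.mul hφ)) t
  simpa only [abs_mul_self, ← sq, abs_sq] using this

theorem measure_exists_abs_sum_ge_le {ι : Type*} [Fintype ι]
    {φ ψ : ι → (Fin K → ℝ) × (Fin p → ℝ) × ℝ → ℝ} (hφ : ∀ a, Measurable (φ a))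
    (hψ : ∀ a, Measurable (ψ a)) (h1 : ∀ a, PsiTwoLE P (fun ω => φ a (M.triple ω)) c)
    (h2 : ∀ a, PsiTwoLE P (fun ω => ψ a (M.triple ω)) c) {x : ℝ} (hx0 : 0 ≤ x)
    (hx : x ≤ 16 * c ^ 2) :
    P.real {ω | ∃ a, n * x ≤ |∑ i, φ a (S.triple i ω) * ψ a (S.triple i ω) -
      n * ∫ ω, φ a (M.triple ω) * ψ a (M.triple ω) ∂P|} ≤
      Fintype.card ι * (2 * Real.exp (-(n * x ^ 2 / (64 * (c ^ 2) ^ 2)))) := by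
  have := measureReal_exists_le P _ fun a =>
    S.measure_abs_sum_ge_le (hφ a) (hψ a) (h1 a) (h2 a) hx0 hx
  rwa [← Set.ofPred_exists] at this

/-- The matrix of factors. -/
def Fmat (ω : Ω) : Matrix (Fin n) (Fin K) ℝ := Matrix.of fun i => S.f i ω

/-- The matrix of idiosyncratic components. -/
def Umat (ω : Ω) : Matrix (Fin n) (Fin p) ℝ := Matrix.of fun i => S.u i ω

/-- The vector of regression errors. -/
def err (ω : Ω) : Fin n → ℝ := fun i => M.residual (S.triple i ω)

omit [IsProbabilityMeasure P] in
theorem X_eq (ω : Ω) : S.X ω = S.Fmat ω * M.Bᵀ + S.Umat ω := by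
  ext i j
  simp [Sample.X, Fmat, Umat, mul_apply, mulVec, dotProduct, mul_comm]

omit [IsProbabilityMeasure P] in
theorem l2Norm_Umat_mulVec_sq (ω : Ω) (v : Fin p → ℝ) :
    l2Norm (S.Umat ω *ᵥ v) ^ 2 = ∑ i, (v ⬝ᵥ S.u i ω) ^ 2 := by
  rw [l2Norm_sq']
  refine Finset.sum_congr rfl fun i _ => ?_
  rw [dotProduct_comm]; rfl

variable (R : M.Regular c₀ τ Υ κ) (hc₀ : 0 < c₀) (hτ : 1 < τ) (hκ₀ : 0 < κ) (hκ₁ : κ < 1)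
include R hc₀ hτ hκ₀

theorem measure_Umat_mulVec_gt_le (v : Fin p → ℝ) (t : ℝ) :
    P.real {ω | psiScale c₀ τ κ ^ 2 * (n + t) * l2Norm v ^ 2 < l2Norm (S.Umat ω *ᵥ v) ^ 2} ≤
      Real.exp (-t) := by
  by_cases h0 : v = 0
  · have : {ω | psiScale c₀ τ κ ^ 2 * (n + t) * l2Norm v ^ 2 < l2Norm (S.Umat ω *ᵥ v) ^ 2} = ∅ := by
      ext ω; simp [h0, l2Norm_zero]
    rw [this, measureReal_empty]; positivity
  have hv := l2Norm_pos h0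
  refine le_trans (measureReal_mono (fun ω hω => ?_) (measure_ne_top _ _))
    (S.measure_sum_sq_ge_le (φ := fun t => ((l2Norm v)⁻¹ • v) ⬝ᵥ t.2.1)
      (by unfold dotProduct; fun_prop) (R.psiTwoLE_u hc₀ hτ hκ₀ (v := (l2Norm v)⁻¹ • v)
        (by rw [l2Norm_smul, abs_of_pos (inv_pos.2 hv), inv_mul_cancel₀ hv.ne'])) t)
  simp only [Set.mem_ofPred_eq] at hω ⊢
  rw [l2Norm_Umat_mulVec_sq] at hω
  simp only [smul_dotProduct, smul_eq_mul, mul_pow, ← Finset.mul_sum]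
  rw [inv_pow, inv_mul_eq_div, le_div_iff₀ (by positivity)]
  exact hω.le

include hκ₁ in
theorem measure_Umat_mulVec_lt_le (v : Fin p → ℝ) :
    P.real {ω | l2Norm (S.Umat ω *ᵥ v) ^ 2 < n * (κ / 2) * l2Norm v ^ 2} ≤
      2 * Real.exp (-(n * (κ / 2) ^ 2 / (64 * (psiScale c₀ τ κ ^ 2) ^ 2))) := by
  by_cases h0 : v = 0
  · have : {ω | l2Norm (S.Umat ω *ᵥ v) ^ 2 < n * (κ / 2) * l2Norm v ^ 2} = ∅ := by
      ext ω; simp [h0, l2Norm_zero]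
    rw [this, measureReal_empty]; positivity
  have hv := l2Norm_pos h0
  set w := (l2Norm v)⁻¹ • v with hw
  have hwn : l2Norm w = 1 := by
    rw [hw, l2Norm_smul, abs_of_pos (inv_pos.2 hv), inv_mul_cancel₀ hv.ne']
  have hψ := R.psiTwoLE_u hc₀ hτ hκ₀ hwn.le
  have hsc := Regular.psiScale_pos hc₀ hτ hκ₀
  have hm : Measurable fun t : (Fin K → ℝ) × (Fin p → ℝ) × ℝ => w ⬝ᵥ t.2.1 := by
    unfold dotProduct; fun_prop
  refine le_trans (measureReal_mono (fun ω hω => ?_) (measure_ne_top _ _))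
    (S.measure_abs_sum_ge_le hm hm hψ hψ (x := κ / 2) (by positivity) (by nlinarith))
  simp only [Set.mem_ofPred_eq] at hω ⊢
  have e1 : ∫ ω, (w ⬝ᵥ (M.triple ω).2.1) * (w ⬝ᵥ (M.triple ω).2.1) ∂P = w ⬝ᵥ M.covU *ᵥ w :=
    R.integral_dotProduct_sq w
  have h1 := R.mul_l2Norm_sq_le w
  rw [hwn, one_pow, mul_one] at h1
  rw [l2Norm_Umat_mulVec_sq] at hω
  have e2 : ∑ i, (w ⬝ᵥ (S.triple i ω).2.1) * (w ⬝ᵥ (S.triple i ω).2.1) =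
      (∑ i, (v ⬝ᵥ S.u i ω) ^ 2) / l2Norm v ^ 2 := by
    rw [Finset.sum_div]
    refine Finset.sum_congr rfl fun i _ => ?_
    rw [hw, smul_dotProduct, smul_eq_mul]
    simp only [triple]
    field_simp
  rw [e1, e2]
  rw [← div_lt_iff₀ (by positivity)] at hω
  have h2 : (n : ℝ) * κ ≤ n * (w ⬝ᵥ M.covU *ᵥ w) := by gcongr
  refine le_trans ?_ (neg_le_abs _)
  linarith

theorem measure_exists_signedSum_gt_le (t : ℝ) (d : ℕ) :
    P.real {ω | ∃ J : Fin d → Fin p × Bool, psiScale c₀ τ κ ^ 2 * (n + t) *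
      l2Norm (signedSum J) ^ 2 < l2Norm (S.Umat ω *ᵥ signedSum J) ^ 2} ≤
      (2 * p : ℝ) ^ d * Real.exp (-t) := by
  have := measureReal_exists_le P _ fun J : Fin d → Fin p × Bool =>
    S.measure_Umat_mulVec_gt_le R hc₀ hτ hκ₀ (signedSum J) t
  rw [← Set.ofPred_exists] at this
  refine this.trans_eq ?_
  simp [mul_comm]

include hκ₁ in
theorem measure_exists_signedSum_lt_le (d : ℕ) :
    P.real {ω | ∃ J : Fin d → Fin p × Bool, l2Norm (S.Umat ω *ᵥ signedSum J) ^ 2 <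
      n * (κ / 2) * l2Norm (signedSum J) ^ 2} ≤
      (2 * p : ℝ) ^ d *
        (2 * Real.exp (-(n * (κ / 2) ^ 2 / (64 * (psiScale c₀ τ κ ^ 2) ^ 2)))) := by
  have := measureReal_exists_le P _ fun J : Fin d → Fin p × Bool =>
    S.measure_Umat_mulVec_lt_le R hc₀ hτ hκ₀ hκ₁ (signedSum J)
  rw [← Set.ofPred_exists] at this
  refine this.trans_eq ?_
  simp [mul_comm]

end Sample

/-! Uniform convergence of the empirical distribution function at the sample points -/

/-- The distribution function of `-Y`. -/
def cdfNeg (M : FASIM K p P) (y : ℝ) : ℝ := cdf (P.map fun ω => -M.Y ω) (-y)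

variable (M) in
theorem cdfNeg_eq (y : ℝ) : M.cdfNeg y = (P.map M.Y).real (Set.Ici y) := by
  have hm := M.measurable_Y
  have hneg : Measurable fun ω => -M.Y ω := hm.neg
  have : IsProbabilityMeasure (P.map fun ω => -M.Y ω) :=
    Measure.isProbabilityMeasure_map hneg.aemeasurable
  rw [cdfNeg, cdf_eq_real, map_measureReal_apply hneg measurableSet_Iic,
    map_measureReal_apply hm measurableSet_Ici]
  congr 1; ext ω; simp

/-- The distribution function of `Y` and the reflected distribution function of `-Y`. -/
def levelCDF (M : FASIM K p P) : Bool → ℝ → ℝ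
  | true => cdf (P.map M.Y)
  | false => M.cdfNeg

variable (M) in
omit [IsProbabilityMeasure P] in
theorem measurable_levelCDF : ∀ b, Measurable (M.levelCDF b)
  | true => (monotone_cdf _).measurable
  | false => (monotone_cdf _).measurable.comp measurable_neg

/-- Indicators of the sublevel sets of the two distribution functions. -/
def levelIndicator (M : FASIM K p P) (a : Bool × Fin (n + 1))
    (t : (Fin K → ℝ) × (Fin p → ℝ) × ℝ) : ℝ :=
  (M.levelCDF a.1 ⁻¹' Set.Iic ((a.2 : ℝ) / n)).indicator 1 t.2.2

variable (M) in
omit [IsProbabilityMeasure P] in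
theorem measurable_levelIndicator (a : Bool × Fin (n + 1)) : Measurable (M.levelIndicator a) :=
  (measurable_one.indicator (M.measurable_levelCDF a.1 measurableSet_Iic)).comp (by fun_prop)

variable (M) in
theorem integral_levelIndicator_le (a : Bool × Fin (n + 1)) :
    ∫ ω, M.levelIndicator a (M.triple ω) * 1 ∂P ≤ (a.2 : ℝ) / n := by
  have hm := M.measurable_Y
  have hneg : Measurable fun ω => -M.Y ω := hm.neg
  have e1 : ∫ ω, M.levelIndicator a (M.triple ω) * 1 ∂P =
      P.real (M.Y ⁻¹' (M.levelCDF a.1 ⁻¹' Set.Iic ((a.2 : ℝ) / n))) := by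
    rw [← integral_indicator_one (hm (M.measurable_levelCDF a.1 measurableSet_Iic))]
    simp only [mul_one]
    rfl
  have hv : (0 : ℝ) ≤ (a.2 : ℝ) / n := by positivity
  rw [e1]
  obtain ⟨b, m⟩ := a
  cases b
  · have : IsProbabilityMeasure (P.map fun ω => -M.Y ω) :=
      Measure.isProbabilityMeasure_map hneg.aemeasurable
    refine le_trans (le_of_eq ?_) (measureReal_cdf_le (P.map fun ω => -M.Y ω) hv)
    exact (map_measureReal_apply hneg ((monotone_cdf (P.map fun ω => -M.Y ω)).measurable
      measurableSet_Iic)).symm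
  · refine le_trans (le_of_eq ?_) (measureReal_cdf_le (P.map M.Y) hv)
    exact (map_measureReal_apply hm ((monotone_cdf (P.map M.Y)).measurable measurableSet_Iic)).symm

namespace Sample

/-- A union bound over 2(n + 1) indicators. The constant factor 1 gives the indicators the product
form of the Bernstein bound, and 2 ≤ c makes variables bounded by 1 admissible. -/
theorem measure_exists_level_ge_le (hc : 2 ≤ c) {x : ℝ} (hx0 : 0 ≤ x) (hx : x ≤ 16 * c ^ 2) :
    P.real {ω | ∃ a : Bool × Fin (n + 1), n * x ≤ |∑ i, M.levelIndicator a (S.triple i ω) * 1 -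
      n * ∫ ω, M.levelIndicator a (M.triple ω) * 1 ∂P|} ≤
      (2 * (n + 1 : ℝ)) * (2 * Real.exp (-(n * x ^ 2 / (64 * (c ^ 2) ^ 2)))) := by
  have := S.measure_exists_abs_sum_ge_le (φ := fun a : Bool × Fin (n + 1) => M.levelIndicator a)
    (ψ := fun _ _ => 1) (c := c) M.measurable_levelIndicator (fun _ => measurable_const)
    (fun a => psiTwoLE_of_bounded (by linarith) fun ω => by
      have : |M.levelIndicator a (M.triple ω)| ≤ 1 := by
        classical
        rw [levelIndicator, Set.indicator_apply]; split_ifs <;> simp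
      linarith)
    (fun a => psiTwoLE_of_bounded (by linarith) fun ω => by simpa using hc) hx0 hx
  simpa using this

/-- If Y_k ≤ y then F(Y_k) ≤ F(y), an event of probability at most F(y) under F; its frequency
bounds F_n(y) above. If Y_k > y then P(Y ≥ Y_k) ≤ 1 − F(y), which bounds 1 − F_n(y) in the same way.
Only levels in [0, 1] matter, so a finite grid suffices and F may have jumps. -/
theorem abs_empCDF_sub_le {ω : Ω} {x : ℝ} (hn : 0 < n)
    (h : ¬ ∃ a : Bool × Fin (n + 1), n * x ≤ |∑ i, M.levelIndicator a (S.triple i ω) * 1 -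
      n * ∫ ω, M.levelIndicator a (M.triple ω) * 1 ∂P|) (i : Fin n) :
    |empCDF (S.Yvec ω) (S.Yvec ω i) - cdf (P.map M.Y) (S.Yvec ω i)| ≤ x + 1 / n := by
  push Not at h
  have hn' : (0 : ℝ) < n := by exact_mod_cast hn
  set y := S.Yvec ω i with hy
  set v := cdf (P.map M.Y) y with hv
  have hv0 : 0 ≤ v := cdf_nonneg _ _
  have hv1 : v ≤ 1 := cdf_le_one _ _
  -- Rounding w up to the grid point ⌈nw⌉/n costs at most 1/n, and w ≤ 1 keeps the index among the n
  -- + 1 levels.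
  have key : ∀ (b : Bool) (w : ℝ), 0 ≤ w → w ≤ 1 →
      ∀ g : Fin n → ℝ, (∀ k, g k ≤ (M.levelCDF b ⁻¹' Set.Iic w).indicator 1 (S.Y k ω)) →
        ∑ k, g k ≤ n * (w + x + 1 / n) := by
    intro b w hw0 hw1 g hg
    have hm : ⌈n * w⌉₊ < n + 1 := by
      rw [Nat.lt_succ_iff, Nat.ceil_le]; nlinarith
    have hwm : w ≤ (⌈n * w⌉₊ : ℝ) / n := by
      rw [le_div_iff₀ hn', mul_comm]; exact Nat.le_ceil _
    have h1 := h (b, ⟨⌈n * w⌉₊, hm⟩)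
    have h2 := M.integral_levelIndicator_le (n := n) (b, ⟨⌈n * w⌉₊, hm⟩)
    simp only at h2
    have h3 : ∑ k, g k ≤ ∑ k, M.levelIndicator (b, ⟨⌈n * w⌉₊, hm⟩) (S.triple k ω) * 1 := by
      refine Finset.sum_le_sum fun k _ => (hg k).trans ?_
      rw [mul_one]
      exact Set.indicator_le_indicator_of_subset (fun z hz => le_trans hz hwm)
        (fun _ => zero_le_one) _
    have h4 : (⌈n * w⌉₊ : ℝ) < n * w + 1 := Nat.ceil_lt_add_one (by positivity)
    have h5 := mul_le_mul_of_nonneg_left h2 hn'.le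
    rw [mul_div_cancel₀ _ hn'.ne'] at h5
    have h6 := (abs_lt.1 h1).2
    have : (n : ℝ) * (w + x + 1 / n) = n * w + n * x + 1 := by field_simp
    linarith
  have hup := key true v hv0 hv1 (fun k => if S.Yvec ω k ≤ y then 1 else 0) fun k => by
    by_cases hk : S.Yvec ω k ≤ y
    · have hmem : S.Y k ω ∈ M.levelCDF true ⁻¹' Set.Iic v := monotone_cdf (P.map M.Y) hk
      rw [Set.indicator_of_mem hmem, if_pos hk]; rfl
    · rw [if_neg hk]; exact Set.indicator_nonneg (fun _ _ => zero_le_one) _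
  -- The lower bound on F_n is an upper bound on the count of Y_k > y, through the reflected
  -- distribution function.
  have hlo := key false (1 - v) (by linarith) (by linarith)
    (fun k => 1 - if S.Yvec ω k ≤ y then 1 else 0) fun k => by
    by_cases hk : S.Yvec ω k ≤ y
    · rw [if_pos hk, sub_self]; exact Set.indicator_nonneg (fun _ _ => zero_le_one) _
    · have hmem : S.Y k ω ∈ M.levelCDF false ⁻¹' Set.Iic (1 - v) := by
        change M.cdfNeg (S.Y k ω) ≤ 1 - v
        rw [cdfNeg_eq, hv, cdf_eq_real, ← probReal_compl_eq_one_sub measurableSet_Iic]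
        refine measureReal_mono (fun z hz => ?_) (measure_ne_top _ _)
        simp only [Set.mem_Ici, Set.compl_Iic, Set.mem_Ioi] at hz ⊢
        exact lt_of_lt_of_le (not_le.1 hk) hz
      rw [Set.indicator_of_mem hmem, if_neg hk, sub_zero]; rfl
  rw [Finset.sum_sub_distrib] at hlo
  simp only [Finset.sum_const, Finset.card_univ, Fintype.card_fin, nsmul_eq_mul, mul_one] at hlo
  set T : ℝ := ∑ k, if S.Yvec ω k ≤ y then (1 : ℝ) else 0 with hT
  have e1 : empCDF (S.Yvec ω) y = T / n := by rw [empCDF, inv_mul_eq_div]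
  rw [e1, abs_le]
  constructor
  · rw [le_sub_iff_add_le, le_div_iff₀ hn']; linarith
  · rw [sub_le_iff_le_add, div_le_iff₀ hn']; linarith

end Sample

end FASIM

end

/-! ### The good event and its probability. -/

noncomputable section

theorem l2Norm_single {m : ℕ} (j : Fin m) : l2Norm (Pi.single j (1 : ℝ)) = 1 := by
  rw [l2Norm_eq_norm, PiLp.toLp_single, PiLp.norm_single]; simp

theorem l1Norm_le_sqrt_l0Norm {m : ℕ} (a : Fin m → ℝ) :
    l1Norm a ≤ Real.sqrt (l0Norm a) * l2Norm a := by
  set T : Finset (Fin m) := Finset.univ.filter fun i => a i ≠ 0 with hT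
  have hcard : (T.card : ℝ) = l0Norm a := by
    rw [l0Norm, hT, ← Set.ncard_coe_finset]; simp
  have h1 : l1Norm a = ∑ i ∈ T, |a i| := by
    rw [l1Norm, hT, Finset.sum_filter]
    refine Finset.sum_congr rfl fun i _ => ?_
    split_ifs with h
    · rfl
    · rw [not_not.1 h, abs_zero]
  rw [h1, ← hcard, l2Norm, ← Real.sqrt_mul (Nat.cast_nonneg _)]
  refine Real.le_sqrt_of_sq_le ?_
  refine (sq_sum_le_card_mul_sum_sq (s := T) (f := fun i => |a i|)).trans ?_
  refine mul_le_mul_of_nonneg_left ?_ (Nat.cast_nonneg _)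
  simp only [sq_abs]
  exact Finset.sum_le_sum_of_subset_of_nonneg (Finset.subset_univ _) fun _ _ _ => sq_nonneg _

/-- A quadratic form is bounded by the largest entry of its matrix. -/
theorem abs_quadratic_le {m : ℕ} (A : Matrix (Fin m) (Fin m) ℝ) {x : ℝ} (hx : 0 ≤ x)
    (h : ∀ k l, |A k l| ≤ x) (v : Fin m → ℝ) : |v ⬝ᵥ A *ᵥ v| ≤ x * (m * l2Norm v ^ 2) := by
  have h1 : ∀ k, |(A *ᵥ v) k| ≤ x * l1Norm v := fun k => abs_dotProduct_le_l1Norm (h k)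
  rw [dotProduct_comm]
  refine (abs_dotProduct_le_l1Norm h1).trans ?_
  have h2 := pow_le_pow_left₀ (l1Norm_nonneg v) (l1Norm_le_sqrt_mul_l2Norm v) 2
  rw [mul_pow, Real.sq_sqrt (Nat.cast_nonneg m)] at h2
  nlinarith

theorem quadratic_smul_one_sub {n p : ℕ} (a : ℝ) (U : Matrix (Fin n) (Fin p) ℝ) (v : Fin p → ℝ) :
    v ⬝ᵥ (a • (1 : Matrix (Fin p) (Fin p) ℝ) - Uᵀ * U) *ᵥ v =
      a * l2Norm v ^ 2 - l2Norm (U *ᵥ v) ^ 2 := by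
  rw [sub_mulVec, smul_mulVec, one_mulVec, dotProduct_sub, dotProduct_smul, smul_eq_mul,
    ← dotProduct_self_mulVec, l2Norm_sq, l2Norm_sq]

theorem gram_apply_self {n p : ℕ} (U : Matrix (Fin n) (Fin p) ℝ) (j : Fin p) :
    (Uᵀ * U) j j = l2Norm (Uᵀ j) ^ 2 := by
  rw [l2Norm_sq]; rfl

/-- Upper bounds on signed sums extend to all vectors. -/
theorem l2Norm_mulVec_sq_le_of_signedSum {n p : ℕ} (hp : 2 ≤ p) {U : Matrix (Fin n) (Fin p) ℝ}
    {a : ℝ} (ha : 0 ≤ a) (h : ∀ J : Fin p → Fin p × Bool,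
      l2Norm (U *ᵥ signedSum J) ^ 2 ≤ a * l2Norm (signedSum J) ^ 2) (v : Fin p → ℝ) :
    l2Norm (U *ᵥ v) ^ 2 ≤ 3 * a * l2Norm v ^ 2 := by
  have h1 := quadratic_ge_of_signedSum (a • (1 : Matrix (Fin p) (Fin p) ℝ) - Uᵀ * U) (a := a) hp
    (fun j => by
      rw [Matrix.sub_apply, gram_apply_self]
      have : 0 ≤ l2Norm (Uᵀ j) ^ 2 := sq_nonneg _
      simpa using this)
    (fun J => by rw [quadratic_smul_one_sub]; linarith [h J]) v
  rw [quadratic_smul_one_sub] at h1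
  have h2 := pow_le_pow_left₀ (l1Norm_nonneg v) (l1Norm_le_sqrt_mul_l2Norm v) 2
  rw [mul_pow, Real.sq_sqrt (Nat.cast_nonneg p)] at h2
  have hp' : (2 : ℝ) ≤ p := by exact_mod_cast hp
  have h3 := mul_le_mul_of_nonneg_left h2 ha
  have h4 : 0 ≤ a * l2Norm v ^ 2 := by positivity
  -- From ‖v‖₁² ≤ p‖v‖₂² the factor is 2p − 1, and 2p − 1 ≤ 3(p − 1) because p ≥ 2.
  have h5 : ((p : ℝ) - 1) * l2Norm (U *ᵥ v) ^ 2 ≤ ((p : ℝ) - 1) * (3 * a * l2Norm v ^ 2) := by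
    nlinarith
  exact le_of_mul_le_mul_left h5 (by linarith)

/-- Lower bounds on signed sums extend to all vectors, up to an `ℓ₁` penalty. -/
theorem le_l2Norm_mulVec_sq_of_signedSum {n p d : ℕ} (hd : 2 ≤ d) {U : Matrix (Fin n) (Fin p) ℝ}
    {a b : ℝ} (ha : 0 ≤ a) (hb : ∀ j, l2Norm (Uᵀ j) ^ 2 ≤ b)
    (h : ∀ J : Fin d → Fin p × Bool,
      a * l2Norm (signedSum J) ^ 2 ≤ l2Norm (U *ᵥ signedSum J) ^ 2) (v : Fin p → ℝ) :
    -(b * l1Norm v ^ 2) ≤ ((d : ℝ) - 1) * (l2Norm (U *ᵥ v) ^ 2 - a * l2Norm v ^ 2) := by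
  have e : ∀ v, v ⬝ᵥ (Uᵀ * U - a • (1 : Matrix (Fin p) (Fin p) ℝ)) *ᵥ v =
      l2Norm (U *ᵥ v) ^ 2 - a * l2Norm v ^ 2 := by
    intro v
    rw [← neg_sub, neg_mulVec, dotProduct_neg, quadratic_smul_one_sub]; ring
  have h1 := quadratic_ge_of_signedSum (Uᵀ * U - a • (1 : Matrix (Fin p) (Fin p) ℝ)) (a := b) hd
    (fun j => by
      rw [Matrix.sub_apply, gram_apply_self]
      have h2 : (a • (1 : Matrix (Fin p) (Fin p) ℝ)) j j = a := by simp
      linarith [hb j])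
    (fun J => by rw [e]; linarith [h J]) v
  rwa [e] at h1

namespace FASIM

variable {K p n : ℕ} {Ω : Type*} [MeasurableSpace Ω] {P : Measure Ω} [IsProbabilityMeasure P]
  {M : FASIM K p P} {c₀ τ Υ κ c : ℝ} (S : M.Sample n)

/-- The `k`-th column of the loading matrix, scaled by `√p`. -/
def scaledLoading (M : FASIM K p P) (k : Fin K) : Fin p → ℝ := (Real.sqrt p)⁻¹ • M.Bᵀ k

/-- The high-probability event on which the analysis of the estimators is deterministic. -/
structure Sample.Good (S : M.Sample n) (c κ x x₀ t : ℝ) (d : ℕ) (ω : Ω) : Prop where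
  FU : ¬ ∃ a : Fin p × Fin K, n * x ≤ |∑ i, (S.triple i ω).2.1 a.1 * (S.triple i ω).1 a.2 -
    n * ∫ ω, (M.triple ω).2.1 a.1 * (M.triple ω).1 a.2 ∂P|
  BUU : ¬ ∃ a : Fin p × Fin K, n * x ≤
    |∑ i, (S.triple i ω).2.1 a.1 * (M.scaledLoading a.2 ⬝ᵥ (S.triple i ω).2.1) -
    n * ∫ ω, (M.triple ω).2.1 a.1 * (M.scaledLoading a.2 ⬝ᵥ (M.triple ω).2.1) ∂P|
  Ue : ¬ ∃ j : Fin p, n * x ≤ |∑ i, (S.triple i ω).2.1 j * M.residual (S.triple i ω) -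
    n * ∫ ω, (M.triple ω).2.1 j * M.residual (M.triple ω) ∂P|
  Fe : ¬ ∃ k : Fin K, n * x ≤ |∑ i, (S.triple i ω).1 k * M.residual (S.triple i ω) -
    n * ∫ ω, (M.triple ω).1 k * M.residual (M.triple ω) ∂P|
  U_col : ¬ ∃ j : Fin p, c ^ 2 * (n + n) ≤ ∑ i, (S.triple i ω).2.1 j ^ 2
  e_norm : ¬ c ^ 2 * (n + n) ≤ ∑ i, M.residual (S.triple i ω) ^ 2
  FF : ¬ ∃ a : Fin K × Fin K, n * x₀ ≤ |∑ i, (S.triple i ω).1 a.1 * (S.triple i ω).1 a.2 -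
    n * ∫ ω, (M.triple ω).1 a.1 * (M.triple ω).1 a.2 ∂P|
  op : ¬ ∃ J : Fin p → Fin p × Bool, c ^ 2 * (n + t) *
      l2Norm (signedSum J) ^ 2 < l2Norm (S.Umat ω *ᵥ signedSum J) ^ 2
  re : ¬ ∃ J : Fin d → Fin p × Bool, l2Norm (S.Umat ω *ᵥ signedSum J) ^ 2 <
      n * (κ / 2) * l2Norm (signedSum J) ^ 2
  cdf : ¬ ∃ a : Bool × Fin (n + 1), n * x ≤ |∑ i, M.levelIndicator a (S.triple i ω) * 1 -
      n * ∫ ω, M.levelIndicator a (M.triple ω) * 1 ∂P|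

namespace Regular

variable (R : M.Regular c₀ τ Υ κ) (hc₀ : 0 < c₀) (hτ : 1 < τ) (hΥ : 0 < Υ) (hκ₀ : 0 < κ)
  (hκ₁ : κ < 1)
include R

omit [IsProbabilityMeasure P] R in
theorem transpose_gram : (M.Bᵀ * M.B)ᵀ = M.Bᵀ * M.B := by
  rw [transpose_mul, transpose_transpose]

omit [IsProbabilityMeasure P] in
include hτ in
theorem l2Norm_B_le (v : Fin K → ℝ) : l2Norm (M.B *ᵥ v) ≤ τ * Real.sqrt p * l2Norm v := by
  have h1 := le_mul_l2Norm_sq_of_spectrum transpose_gram (fun r hr => (R.pervasive r hr).2) v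
  refine l2Norm_le_of_sq (mul_nonneg (by positivity) (l2Norm_nonneg v)) ?_
  rw [dotProduct_self_mulVec]
  refine h1.trans ?_
  rw [mul_pow, mul_pow, Real.sq_sqrt (Nat.cast_nonneg p)]
  have : τ ≤ τ ^ 2 := by nlinarith
  have : (p : ℝ) * τ ≤ τ ^ 2 * p := by nlinarith [(Nat.cast_nonneg p : (0 : ℝ) ≤ p)]
  gcongr

omit [IsProbabilityMeasure P] in
include hτ in
theorem le_l2Norm_B (v : Fin K → ℝ) : Real.sqrt p / τ * l2Norm v ≤ l2Norm (M.B *ᵥ v) := by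
  have h1 := mul_l2Norm_sq_le_of_spectrum transpose_gram (fun r hr => (R.pervasive r hr).1) v
  refine (pow_le_pow_iff_left₀ (mul_nonneg (by positivity) (l2Norm_nonneg v)) (l2Norm_nonneg _)
    two_ne_zero).1 ?_
  rw [l2Norm_sq (M.B *ᵥ v), dotProduct_self_mulVec]
  refine le_trans ?_ h1
  rw [mul_pow, div_pow, Real.sq_sqrt (Nat.cast_nonneg p)]
  have : τ ≤ τ ^ 2 := by nlinarith
  gcongr

omit [IsProbabilityMeasure P] in
include hΥ in
theorem l2Norm_B_row_le (j : Fin p) : l2Norm (M.B j) ≤ Real.sqrt K * Υ :=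
  l2Norm_le_of_forall hΥ.le fun k => R.loadings j k

include hc₀ hτ hκ₀

theorem psiTwoLE_u_apply (j : Fin p) :
    PsiTwoLE P (fun ω => M.u ω j) (psiScale c₀ τ κ) := by
  simpa using R.psiTwoLE_u hc₀ hτ hκ₀ (l2Norm_single j).le

theorem psiTwoLE_f_apply (k : Fin K) :
    PsiTwoLE P (fun ω => M.f ω k) (psiScale c₀ τ κ) := by
  simpa using R.psiTwoLE_f hc₀ hτ hκ₀ (l2Norm_single k).le

theorem psiTwoLE_scaledLoading (hp : 0 < p) (k : Fin K) :
    PsiTwoLE P (fun ω => M.scaledLoading k ⬝ᵥ M.u ω) (psiScale c₀ τ κ) := by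
  have hs : 0 < Real.sqrt p := Real.sqrt_pos.2 (by exact_mod_cast hp)
  refine R.psiTwoLE_u' hc₀ hτ hκ₀ ?_
  rw [scaledLoading, l2Norm_smul, abs_of_pos (inv_pos.2 hs), inv_mul_le_iff₀ hs]
  have h1 := R.l2Norm_B_le hτ (Pi.single k 1)
  rw [l2Norm_single, mul_one, mul_comm] at h1
  rwa [mulVec_single_one] at h1

include hκ₁

/-- A union bound over the ten conditions. The deviation of FᵀF needs only a constant threshold, the
covariances with u need order r, and t = 4p log p is chosen to beat the (2p)^p signed sums. -/
theorem measure_not_good_le (hp : 2 ≤ p) {r : ℝ} (hr : 0 ≤ r) (hr2 : r ≤ 1 / 2)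
    (hnr : n * r ^ 2 = Real.log p) (d : ℕ) :
    P.real {ω | ¬ S.Good (psiScale c₀ τ κ) κ (32 * psiScale c₀ τ κ ^ 2 * r) (1 / (2 * (K + 1)))
      (4 * p * Real.log p) d ω} ≤
      (4 * p * K + 2 * p + 2 * K + 4 * (n + 1)) * Real.exp (-(16 * Real.log p)) +
      (p + 1) * Real.exp (-n) +
      K ^ 2 * (2 * Real.exp (-(n * (1 / (2 * (K + 1))) ^ 2 / (64 * (psiScale c₀ τ κ ^ 2) ^ 2)))) +
      (2 * p : ℝ) ^ p * Real.exp (-(4 * p * Real.log p)) +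
      (2 * p : ℝ) ^ d *
        (2 * Real.exp (-(n * (κ / 2) ^ 2 / (64 * (psiScale c₀ τ κ ^ 2) ^ 2)))) := by
  have hsc := psiScale_pos hc₀ hτ hκ₀
  have hpu := R.psiTwoLE_u_apply hc₀ hτ hκ₀
  have hpf := R.psiTwoLE_f_apply hc₀ hτ hκ₀
  have hpl := R.psiTwoLE_scaledLoading hc₀ hτ hκ₀ (by linarith)
  have hpe := R.psiTwoLE_residual hc₀ hτ hκ₀ hκ₁
  have hre := S.measure_exists_signedSum_lt_le R hc₀ hτ hκ₀ hκ₁ d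
  have hop := S.measure_exists_signedSum_gt_le R hc₀ hτ hκ₀ (4 * p * Real.log p) p
  set c := psiScale c₀ τ κ with hc
  have hx0 : 0 ≤ 32 * c ^ 2 * r := by positivity
  have hx : 32 * c ^ 2 * r ≤ 16 * c ^ 2 := by nlinarith [sq_nonneg c]
  -- 32²/64 = 16: the threshold 32c²r makes the Bernstein exponent 16 log p, leaving polynomial room
  -- for the union bounds.
  have hq : (n : ℝ) * (32 * c ^ 2 * r) ^ 2 / (64 * (c ^ 2) ^ 2) = 16 * Real.log p := by
    rw [← hnr]; field_simp; ring
  have mu : ∀ j : Fin p, Measurable fun t : (Fin K → ℝ) × (Fin p → ℝ) × ℝ => t.2.1 j :=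
    fun j => by fun_prop
  have mf : ∀ k : Fin K, Measurable fun t : (Fin K → ℝ) × (Fin p → ℝ) × ℝ => t.1 k :=
    fun j => by fun_prop
  have ml : ∀ k : Fin K, Measurable fun t : (Fin K → ℝ) × (Fin p → ℝ) × ℝ =>
    M.scaledLoading k ⬝ᵥ t.2.1 := fun j => by unfold dotProduct; fun_prop
  have me := M.measurable_residual
  have h1 := S.measure_exists_abs_sum_ge_le (ι := Fin p × Fin K) (φ := fun a t => t.2.1 a.1)
    (ψ := fun a t => t.1 a.2) (fun a => mu _) (fun a => mf _) (fun a => hpu _) (fun a => hpf _)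
    hx0 hx
  have h2 := S.measure_exists_abs_sum_ge_le (ι := Fin p × Fin K) (φ := fun a t => t.2.1 a.1)
    (ψ := fun a t => M.scaledLoading a.2 ⬝ᵥ t.2.1) (fun a => mu _) (fun a => ml _)
    (fun a => hpu _) (fun a => hpl _) hx0 hx
  have h3 := S.measure_exists_abs_sum_ge_le (ι := Fin p) (φ := fun a t => t.2.1 a)
    (ψ := fun a t => M.residual t) (fun a => mu _) (fun a => me)
    (fun a => hpu _) (fun a => hpe) hx0 hx
  have h4 := S.measure_exists_abs_sum_ge_le (ι := Fin K) (φ := fun a t => t.1 a)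
    (ψ := fun a t => M.residual t) (fun a => mf _) (fun a => me)
    (fun a => hpf _) (fun a => hpe) hx0 hx
  have h5 := measureReal_exists_le P _ fun j : Fin p => S.measure_sum_sq_ge_le (mu j) (hpu j) n
  rw [← Set.ofPred_exists] at h5
  have h6 := S.measure_sum_sq_ge_le me hpe n
  have hx₀' : (1 : ℝ) / (2 * (K + 1)) ≤ 16 * c ^ 2 := by
    have : (1 : ℝ) / (2 * (K + 1)) ≤ 1 := by
      rw [div_le_one (by positivity)]
      have : (0 : ℝ) ≤ K := Nat.cast_nonneg K
      linarith
    nlinarith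
  have h7 := S.measure_exists_abs_sum_ge_le (ι := Fin K × Fin K) (φ := fun a t => t.1 a.1)
    (ψ := fun a t => t.1 a.2) (fun a => mf _) (fun a => mf _) (fun a => hpf _) (fun a => hpf _)
    (x := 1 / (2 * (K + 1))) (by positivity) hx₀'
  have h8 := S.measure_exists_level_ge_le (c := c) (by linarith) hx0 hx
  rw [hq] at h1 h2 h3 h4 h8
  simp only [Fintype.card_prod, Fintype.card_fin, Nat.cast_mul] at h1 h2 h3 h4 h5 h7
  calc _ ≤ _ := measureReal_mono (fun ω hω => by
        by_contra hcon
        simp only [Set.mem_union, not_or] at hcon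
        obtain ⟨⟨⟨⟨⟨⟨⟨⟨⟨g1, g2⟩, g3⟩, g4⟩, g5⟩, g6⟩, g7⟩, g8⟩, g9⟩, g10⟩ := hcon
        exact hω ⟨g1, g2, g3, g4, g5, g6, g7, g8, g9, g10⟩) (measure_ne_top _ _)
    _ ≤ _ := (measureReal_union_le _ _).trans (add_le_add ((measureReal_union_le _ _).trans
        (add_le_add ((measureReal_union_le _ _).trans (add_le_add ((measureReal_union_le _ _).trans
        (add_le_add ((measureReal_union_le _ _).trans (add_le_add ((measureReal_union_le _ _).trans
        (add_le_add ((measureReal_union_le _ _).trans (add_le_add ((measureReal_union_le _ _).trans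
        (add_le_add ((measureReal_union_le _ _).trans (add_le_add h1 h2)) h3)) h4)) h5)) h6)) h7))
        hop)) hre)) h8)
    _ = _ := by ring

end Regular

end FASIM

end

/-! ### The good event implies the deterministic design conditions. -/

noncomputable section

namespace FASIM

variable {K p n : ℕ} {Ω : Type*} [MeasurableSpace Ω] {P : Measure Ω} [IsProbabilityMeasure P]
  {M : FASIM K p P} {c₀ τ Υ κ : ℝ} (S : M.Sample n)

/-- The constant with which the sample satisfies `FactorDesign`. -/
def designConst (K : ℕ) (c₀ τ Υ κ : ℝ) : ℝ :=
  1 + τ + (1 + Real.sqrt K) * (Υ + Υ / κ + 32 * psiScale c₀ τ κ ^ 2)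

namespace Regular

variable (R : M.Regular c₀ τ Υ κ) (hc₀ : 0 < c₀) (hτ : 1 < τ) (hΥ : 0 < Υ) (hκ₀ : 0 < κ)
  (hκ₁ : κ < 1)
include R

omit [IsProbabilityMeasure P] in
theorem l1Norm_covU_le (j : Fin p) : l1Norm (M.covU j) ≤ 1 / κ := by
  refine le_trans (le_of_eq ?_) (R.colsum_covU j)
  refine Finset.sum_congr rfl fun l _ => ?_
  simp only [covU, of_apply]
  rw [covariance_comm]

include hΥ in
-- The bounded column sums of Σ_u keep E u_j(B_k · u) bounded although B_k has p entries of constant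
-- size. It yields the 1 in the scale n(1 + √p r) of BᵀUᵀU_j.
theorem abs_integral_u_mul_scaledLoading_le (hp : 0 < p) (j : Fin p) (k : Fin K) :
    |Real.sqrt p * ∫ ω, M.u ω j * (M.scaledLoading k ⬝ᵥ M.u ω) ∂P| ≤ Υ / κ := by
  have hs : 0 < Real.sqrt p := Real.sqrt_pos.2 (by exact_mod_cast hp)
  rw [R.integral_u_mul_dotProduct, scaledLoading, mulVec_smul, Pi.smul_apply, smul_eq_mul,
    mul_inv_cancel_left₀ hs.ne']
  have h1 : |M.Bᵀ k ⬝ᵥ M.covU j| ≤ Υ * l1Norm (M.covU j) :=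
    abs_dotProduct_le_l1Norm fun l => R.loadings l k
  rw [dotProduct_comm] at h1
  refine h1.trans ?_
  rw [div_eq_mul_one_div]
  exact mul_le_mul_of_nonneg_left (R.l1Norm_covU_le j) hΥ.le

include hΥ hκ₀ hκ₁ in
-- Bounded loadings against ‖β_h‖₁ ≤ √s‖β_h‖₂. The √s is the size of the factor coefficient left in
-- the residual, and the reason why s enters the growth condition.
theorem l2Norm_transpose_B_mulVec_betaH_le :
    l2Norm (M.Bᵀ *ᵥ M.betaH) ≤ Real.sqrt K * (Υ / κ * Real.sqrt (l0Norm M.betaH)) := by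
  refine l2Norm_le_of_forall (by positivity) fun k => ?_
  have h1 : |M.Bᵀ k ⬝ᵥ M.betaH| ≤ Υ * l1Norm M.betaH :=
    abs_dotProduct_le_l1Norm fun l => R.loadings l k
  refine h1.trans ?_
  have h2 := l1Norm_le_sqrt_l0Norm M.betaH
  have h3 := mul_le_mul_of_nonneg_left (R.l2Norm_betaH_le hκ₀ hκ₁)
    (Real.sqrt_nonneg (l0Norm M.betaH))
  calc Υ * l1Norm M.betaH ≤ Υ * (Real.sqrt (l0Norm M.betaH) * (1 / κ)) :=
        mul_le_mul_of_nonneg_left (h2.trans h3) hΥ.le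
    _ = _ := by ring

omit [IsProbabilityMeasure P] R in
include hτ hΥ hκ₀ in
theorem designConst_bounds :
    1 + τ ≤ designConst K c₀ τ Υ κ ∧ 1 + 32 * psiScale c₀ τ κ ^ 2 ≤ designConst K c₀ τ Υ κ ∧
    1 + Real.sqrt K * (Υ + Υ / κ + 32 * psiScale c₀ τ κ ^ 2) ≤ designConst K c₀ τ Υ κ := by
  have h1 : 0 < Υ / κ := by positivity
  have h2 := sq_nonneg (psiScale c₀ τ κ)
  have h3 := Real.sqrt_nonneg (K : ℝ)
  have h4 : 0 ≤ Real.sqrt K * (Υ + Υ / κ + 32 * psiScale c₀ τ κ ^ 2) := by positivity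
  unfold designConst
  refine ⟨?_, ?_, ?_⟩ <;> nlinarith

set_option maxHeartbeats 400000 in
include hc₀ hτ hΥ hκ₀ in
theorem factorDesign {x₀ t r : ℝ} {d : ℕ} {ω : Ω}
    (G : S.Good (psiScale c₀ τ κ) κ (32 * psiScale c₀ τ κ ^ 2 * r) x₀ t d ω) (hp : 2 ≤ p)
    (hx₀ : x₀ * K ≤ 1 / 2) (hx₀' : 0 ≤ x₀) (hr : 0 ≤ r) (ht : t = 4 * p * (n * r ^ 2))
    (hsmall : 6 * designConst K c₀ τ Υ κ ^ 4 * Real.sqrt (1 / p + r ^ 2) ≤ 1) :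
    FactorDesign (designConst K c₀ τ Υ κ) (Real.sqrt (1 / p + r ^ 2)) r (S.Fmat ω) M.B
      (S.Umat ω) (S.err ω) := by
  have hsc : 4 ≤ psiScale c₀ τ κ := psiScale_pos hc₀ hτ hκ₀
  obtain ⟨b1, b2, b3⟩ := designConst_bounds (c₀ := c₀) (K := K) hτ hΥ hκ₀
  have im : ∀ j k, ∫ ω, (M.triple ω).2.1 j * (M.triple ω).1 k ∂P = 0 := fun j k => by
    simpa [triple] using R.integral_u_mul_f j (Pi.single k 1)
  have iff : ∀ k l, ∫ ω, (M.triple ω).1 k * (M.triple ω).1 l ∂P =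
      (1 : Matrix (Fin K) (Fin K) ℝ) k l := fun k l => by
    have := R.integral_f_mul_dotProduct k (Pi.single l 1)
    simp only [single_one_dotProduct] at this
    rw [one_apply]
    simpa [triple, Pi.single_apply] using this
  have iue : ∀ j, ∫ ω, (M.triple ω).2.1 j * M.residual (M.triple ω) ∂P = 0 :=
    R.integral_u_mul_residual hκ₀
  have ife : ∀ k, ∫ ω, (M.triple ω).1 k * M.residual (M.triple ω) ∂P = 0 :=
    R.integral_f_mul_residual
  have ibu := R.abs_integral_u_mul_scaledLoading_le hΥ (by linarith)
  have hBu := R.l2Norm_B_le hτ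
  have hBl := R.le_l2Norm_B hτ
  have hBr := R.l2Norm_B_row_le hΥ
  obtain ⟨gFU, gBUU, gUe, gFe, gUc, gen, gFF, gop, -, -⟩ := G
  push Not at gFU gBUU gUe gFe gUc gen gFF gop
  simp only [im, iue, ife, mul_zero, sub_zero] at gFU gUe gFe
  set c := psiScale c₀ τ κ with hc
  set C := designConst K c₀ τ Υ κ with hC
  have hn0 : (0 : ℝ) ≤ n := Nat.cast_nonneg n
  have hp0 : (2 : ℝ) ≤ p := by exact_mod_cast hp
  have hK0 := Real.sqrt_nonneg (K : ℝ)
  have hsn := Real.sqrt_nonneg (n : ℝ)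
  have hsn2 : Real.sqrt n ^ 2 = n := Real.sq_sqrt hn0
  have hsp2 : Real.sqrt p ^ 2 = p := Real.sq_sqrt (by linarith)
  have hsp := Real.sqrt_nonneg (p : ℝ)
  have hc2 : 16 ≤ c ^ 2 := by
    have := pow_le_pow_left₀ (by norm_num) hsc 2
    linarith
  have hΥκ : 0 < Υ / κ := by positivity
  have b4 : Real.sqrt K * (32 * c ^ 2) ≤ C := by
    have : 0 ≤ Real.sqrt K * (Υ + Υ / κ) := by positivity
    linarith
  have b5 : Real.sqrt K * Υ ≤ C := by
    have : 0 ≤ Real.sqrt K * (Υ / κ + 32 * c ^ 2) := by positivity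
    linarith
  have b6 : Real.sqrt K ≤ C := by
    have := le_mul_of_one_le_right hK0 (by linarith : 1 ≤ Υ + Υ / κ + 32 * c ^ 2)
    linarith
  have b7 : Real.sqrt K * (Υ / κ + 32 * c ^ 2) ≤ C := by
    have : 0 ≤ Real.sqrt K * Υ := by positivity
    linarith
  have b8 : 4 * c ≤ C := by
    have := mul_le_mul_of_nonneg_right hsc (by linarith : 0 ≤ c)
    linarith [sq c]
  have hC1 : 1 ≤ C := by linarith
  have b9 : 16 * c ^ 2 ≤ C ^ 2 := by
    have := pow_le_pow_left₀ (by linarith) b8 2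
    rwa [mul_pow, show (4 : ℝ) ^ 2 = 16 by norm_num] at this
  have hh2 : Real.sqrt (1 / p + r ^ 2) ^ 2 = 1 / p + r ^ 2 := Real.sq_sqrt (by positivity)
  have hh0 := Real.sqrt_nonneg (1 / p + r ^ 2)
  -- FᵀF is within n x₀ of n I in every entry, and a K-dimensional quadratic form costs a further
  -- factor K; x₀K ≤ 1/2 gives the bound.
  have hquad : ∀ v, |n * l2Norm v ^ 2 - l2Norm (S.Fmat ω *ᵥ v) ^ 2| ≤ n / 2 * l2Norm v ^ 2 := by
    intro v
    rw [← quadratic_smul_one_sub]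
    refine (abs_quadratic_le _ (x := n * x₀) (by positivity) (fun k l => ?_) v).trans ?_
    · have := (gFF (k, l)).le
      rw [iff, abs_sub_comm] at this
      exact this
    · have := mul_le_mul_of_nonneg_left hx₀ (mul_nonneg hn0 (sq_nonneg (l2Norm v)))
      linarith
  have hcol : ∀ {a : Fin n → ℝ}, ∑ i, a i ^ 2 < c ^ 2 * (n + n) → l2Norm a ≤ C * Real.sqrt n := by
    intro a ha
    refine l2Norm_le_of_sq (by positivity) ?_
    rw [← l2Norm_sq, l2Norm_sq', mul_pow, hsn2]
    have h1 := mul_le_mul_of_nonneg_right b9 hn0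
    have h2 : 0 ≤ c ^ 2 * n := by positivity
    linarith
  refine ⟨hC1, b6, hr, Real.le_sqrt_of_sq_le (by linarith [show (0 : ℝ) ≤ 1 / p by positivity]),
    ?_, hsmall, ?_, ?_, ?_, ?_, ?_, fun j => (hBr j).trans b5, fun j => hcol (gUc j), ?_, ?_, ?_,
    ?_, hcol gen⟩
  · rw [← Real.sqrt_inv]
    exact Real.sqrt_le_sqrt (by rw [one_div]; linarith [sq_nonneg r])
  · intro v
    -- Here (√n √p h)² = n(1 + p r²), and 3(n + t) ≤ 16 n(1 + p r²) for t = 4p n r²; the 16 is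
    -- absorbed by 4c ≤ C.
    have h1 := l2Norm_mulVec_sq_le_of_signedSum hp (a := c ^ 2 * (n + t))
      (by rw [ht]; positivity) gop v
    refine l2Norm_le_of_sq (mul_nonneg (by positivity) (l2Norm_nonneg v)) ?_
    rw [← l2Norm_sq]
    refine h1.trans ?_
    have h2 : (C * (Real.sqrt n * Real.sqrt p * Real.sqrt (1 / p + r ^ 2)) * l2Norm v) ^ 2 =
        C ^ 2 * (n * (1 + p * r ^ 2)) * l2Norm v ^ 2 := by
      rw [mul_pow, mul_pow, mul_pow, mul_pow, hsn2, hsp2, hh2]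
      field_simp
    rw [h2, ht]
    refine mul_le_mul_of_nonneg_right ?_ (sq_nonneg _)
    have h4 : 0 ≤ c ^ 2 * n := by positivity
    have h5 : 0 ≤ c ^ 2 * (n * (p * r ^ 2)) := by positivity
    calc 3 * (c ^ 2 * (n + 4 * p * (n * r ^ 2))) ≤ 16 * c ^ 2 * (n * (1 + p * r ^ 2)) := by
          linarith
      _ ≤ _ := mul_le_mul_of_nonneg_right b9 (by positivity)
  · intro v
    refine l2Norm_le_of_sq (mul_nonneg (by positivity) (l2Norm_nonneg v)) ?_
    rw [← l2Norm_sq, mul_pow, mul_pow, hsn2]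
    have h1 := neg_abs_le (n * l2Norm v ^ 2 - l2Norm (S.Fmat ω *ᵥ v) ^ 2)
    have h2 := hquad v
    have : 0 ≤ n * l2Norm v ^ 2 := by positivity
    linarith
  · intro v
    have h1 := le_abs_self (n * l2Norm v ^ 2 - l2Norm (S.Fmat ω *ᵥ v) ^ 2)
    have h2 := hquad v
    linarith
  · intro v
    refine (hBu v).trans ?_
    gcongr
    · exact l2Norm_nonneg v
    · linarith
  · intro v
    refine le_trans ?_ (hBl v)
    gcongr
    · exact l2Norm_nonneg v
    · linarith
  · intro j
    refine (l2Norm_le_of_forall (c := n * (32 * c ^ 2 * r)) (by positivity) fun k => ?_).trans ?_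
    · have := (gFU (j, k)).le
      simp only [mul_comm ((S.triple _ ω).2.1 _)] at this
      exact this
    · have := mul_le_mul_of_nonneg_right b4 (mul_nonneg hn0 hr)
      linarith
  · intro j
    refine (l2Norm_le_of_forall (c := n * (Υ / κ + Real.sqrt p * (32 * c ^ 2 * r)))
      (by positivity) fun k => ?_).trans ?_
    · have e1 : (M.Bᵀ *ᵥ ((S.Umat ω)ᵀ *ᵥ (S.Umat ω)ᵀ j)) k = Real.sqrt p *
          ∑ i, (S.triple i ω).2.1 j * (M.scaledLoading k ⬝ᵥ (S.triple i ω).2.1) := by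
        have hs : Real.sqrt p ≠ 0 := (Real.sqrt_pos.2 (by linarith)).ne'
        have e2 : (M.Bᵀ *ᵥ ((S.Umat ω)ᵀ *ᵥ (S.Umat ω)ᵀ j)) k =
            M.Bᵀ k ⬝ᵥ ((S.Umat ω)ᵀ *ᵥ (S.Umat ω)ᵀ j) := rfl
        rw [e2, ← mulVec_dotProduct, dotProduct, Finset.mul_sum]
        refine Finset.sum_congr rfl fun i _ => ?_
        simp only [scaledLoading, smul_dotProduct, smul_eq_mul]
        have e3 : (S.Umat ω *ᵥ M.Bᵀ k) i = M.Bᵀ k ⬝ᵥ (S.triple i ω).2.1 := dotProduct_comm _ _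
        have e4 : (S.Umat ω)ᵀ j i = (S.triple i ω).2.1 j := rfl
        rw [e3, e4]
        field_simp
      have h1 := (gBUU (j, k)).le
      have h2 := ibu j k
      rw [e1]
      set A := ∑ i, (S.triple i ω).2.1 j * (M.scaledLoading k ⬝ᵥ (S.triple i ω).2.1) with hA
      set I := ∫ ω, M.u ω j * (M.scaledLoading k ⬝ᵥ M.u ω) ∂P with hI
      have h3 : |A - n * I| ≤ n * (32 * c ^ 2 * r) := h1
      -- Deviation and mean separately: undoing the 1/√p scaling multiplies the deviation by √p,
      -- whereas the mean stays bounded.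
      calc |Real.sqrt p * A| = |Real.sqrt p * (A - n * I) + n * (Real.sqrt p * I)| := by ring_nf
        _ ≤ _ := abs_add_le _ _
        _ = Real.sqrt p * |A - n * I| + n * |Real.sqrt p * I| := by
          rw [abs_mul, abs_mul (n : ℝ), abs_of_nonneg hsp, abs_of_nonneg hn0]
        _ ≤ Real.sqrt p * (n * (32 * c ^ 2 * r)) + n * (Υ / κ) := by gcongr
        _ = _ := by ring
    · have h1 : Υ / κ + Real.sqrt p * (32 * c ^ 2 * r) ≤
          (Υ / κ + 32 * c ^ 2) * (1 + Real.sqrt p * r) := by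
        have : 0 ≤ Υ / κ * (Real.sqrt p * r) := by positivity
        linarith
      calc _ ≤ Real.sqrt K * (n * ((Υ / κ + 32 * c ^ 2) * (1 + Real.sqrt p * r))) := by gcongr
        _ = Real.sqrt K * (Υ / κ + 32 * c ^ 2) * (n * (1 + Real.sqrt p * r)) := by ring
        _ ≤ _ := mul_le_mul_of_nonneg_right b7 (by positivity)
  · intro j
    refine le_trans (gUe j).le ?_
    have := mul_le_mul_of_nonneg_right b2 (mul_nonneg hn0 hr)
    linarith [mul_nonneg hn0 hr]
  · refine (l2Norm_le_of_forall (c := n * (32 * c ^ 2 * r)) (by positivity)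
      fun k => (gFe k).le).trans ?_
    have := mul_le_mul_of_nonneg_right b4 (mul_nonneg hn0 hr)
    linarith

end Regular

end FASIM

end

/-! ### Restricted eigenvalue and the Lasso bound on the good event. -/

noncomputable section

/-- A restricted lower bound for `U` is inherited by a matrix that is close to it. -/
theorem restricted_lower_bound {n p d s : ℕ} (hd : 2 ≤ d) (hn : 0 < n)
    {U V : Matrix (Fin n) (Fin p) ℝ} {b κ q : ℝ} (hκ : 0 < κ)
    (hb : ∀ j, l2Norm (Uᵀ j) ^ 2 ≤ n * b)
    (h : ∀ J : Fin d → Fin p × Bool,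
      n * (κ / 2) * l2Norm (signedSum J) ^ 2 ≤ l2Norm (U *ᵥ signedSum J) ^ 2)
    (hq : 0 ≤ q) (hUV : ∀ v, l2Norm (U *ᵥ v) - q * Real.sqrt n * l1Norm v ≤ l2Norm (V *ᵥ v))
    (hb0 : 0 ≤ b) (hds : 64 * b * s ≤ κ * (d - 1)) (hqs : 4 * q * Real.sqrt s ≤ Real.sqrt κ / 4)
    {v : Fin p → ℝ} (hv : l1Norm v ≤ 4 * Real.sqrt s * l2Norm v) :
    κ / 16 * l2Norm v ^ 2 ≤ (n : ℝ)⁻¹ * l2Norm (V *ᵥ v) ^ 2 := by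
  have hn0 : (0 : ℝ) < n := by exact_mod_cast hn
  have hd0 : (2 : ℝ) ≤ d := by exact_mod_cast hd
  have hv0 := l2Norm_nonneg v
  have h1 := le_l2Norm_mulVec_sq_of_signedSum hd (by positivity) hb h v
  have h2 : l1Norm v ^ 2 ≤ 16 * s * l2Norm v ^ 2 := by
    refine (pow_le_pow_left₀ (l1Norm_nonneg v) hv 2).trans_eq ?_
    rw [mul_pow, mul_pow, Real.sq_sqrt (Nat.cast_nonneg s)]; norm_num
  -- On the cone the sparsification penalty takes half of the constant κ/2.
  have h3 : n * b * l1Norm v ^ 2 ≤ (d - 1) * (n * (κ / 4) * l2Norm v ^ 2) := by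
    calc n * b * l1Norm v ^ 2 ≤ n * b * (16 * s * l2Norm v ^ 2) := by gcongr
      _ = n / 4 * (64 * b * s) * l2Norm v ^ 2 := by ring
      _ ≤ n / 4 * (κ * (d - 1)) * l2Norm v ^ 2 := by gcongr
      _ = _ := by ring
  have h4 : n * (κ / 4) * l2Norm v ^ 2 ≤ l2Norm (U *ᵥ v) ^ 2 := by
    have h5 : 0 ≤ ((d : ℝ) - 1) * (l2Norm (U *ᵥ v) ^ 2 - n * (κ / 4) * l2Norm v ^ 2) := by
      linarith
    linarith [nonneg_of_mul_nonneg_right h5 (by linarith)]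
  have hs2 : Real.sqrt n ^ 2 = n := Real.sq_sqrt hn0.le
  have hk2 : Real.sqrt κ ^ 2 = κ := Real.sq_sqrt hκ.le
  have h6 : Real.sqrt n * (Real.sqrt κ / 2) * l2Norm v ≤ l2Norm (U *ᵥ v) := by
    refine (pow_le_pow_iff_left₀ (by positivity) (l2Norm_nonneg _) two_ne_zero).1 ?_
    rw [mul_pow, mul_pow, div_pow, hs2, hk2]
    linarith
  -- Passing from U to V halves the remaining √κ/2 to √κ/4, whence κ/16 after squaring.
  have h7 : q * Real.sqrt n * l1Norm v ≤ Real.sqrt n * (Real.sqrt κ / 4) * l2Norm v := by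
    calc q * Real.sqrt n * l1Norm v ≤ q * Real.sqrt n * (4 * Real.sqrt s * l2Norm v) := by gcongr
      _ = Real.sqrt n * (4 * q * Real.sqrt s) * l2Norm v := by ring
      _ ≤ _ := by gcongr
  have h8 : Real.sqrt n * (Real.sqrt κ / 4) * l2Norm v ≤ l2Norm (V *ᵥ v) := by
    linarith [hUV v]
  have h9 := pow_le_pow_left₀ (by positivity) h8 2
  rw [mul_pow, mul_pow, div_pow, hs2, hk2] at h9
  rw [le_inv_mul_iff₀ hn0]
  linarith

/-- The growth condition, with log p = n r², says √m ≤ √D p r, which controls √m/p; the part r²√m is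
at most r because √m r ≤ 1. -/
theorem rate_le {n p m D r : ℝ} (hn : 0 < n) (hp : 0 < p) (hm : 0 ≤ m) (hr : 0 ≤ r) (hD : 0 ≤ D)
    (h1 : n * m ≤ D * (p ^ 2 * (n * r ^ 2))) (h2 : m * r ^ 2 ≤ 1) :
    (1 / p + r ^ 2) * Real.sqrt m ≤ (Real.sqrt D + 1) * r := by
  have hm2 : Real.sqrt m ^ 2 = m := Real.sq_sqrt hm
  have h3 : Real.sqrt m * r ≤ 1 := by
    refine (pow_le_pow_iff_left₀ (by positivity) zero_le_one two_ne_zero).1 ?_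
    rw [mul_pow, hm2]; linarith
  have h4 : Real.sqrt m ≤ Real.sqrt D * r * p := by
    refine (pow_le_pow_iff_left₀ (by positivity) (by positivity) two_ne_zero).1 ?_
    rw [mul_pow, mul_pow, hm2, Real.sq_sqrt hD]
    refine le_of_mul_le_mul_left (h1.trans_eq ?_) hn
    ring
  have h5 : 1 / p * Real.sqrt m ≤ Real.sqrt D * r := by
    rw [one_div, inv_mul_le_iff₀ hp]; linarith
  have h6 := mul_le_mul_of_nonneg_right h3 hr
  linarith [sq r]

namespace FASIM

variable {K p n : ℕ} {Ω : Type*} [MeasurableSpace Ω] {P : Measure Ω} [IsProbabilityMeasure P]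
  {M : FASIM K p P} {c₀ τ Υ κ : ℝ} (S : M.Sample n)

/-- The deviation of the empirical distribution function from `F` at the data. -/
def Sample.cdfError (S : M.Sample n) (ω : Ω) : Fin n → ℝ :=
  fun i => empCDF (S.Yvec ω) (S.Yvec ω i) - cdf (P.map M.Y) (S.Yvec ω i)

omit [IsProbabilityMeasure P] in
-- Substituting the regression of h(Y) on (f, u), the term Uβ_h cancels; as X also contains FBᵀ, the
-- factor coefficient becomes γ_h − Bᵀβ_h.
theorem Sample.response_sub (ω : Ω) :
    (fun i => empCDF (S.Yvec ω) (S.Yvec ω i) - 1 / 2) - S.X ω *ᵥ M.betaH =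
      S.Fmat ω *ᵥ (M.gammaH - M.Bᵀ *ᵥ M.betaH) + S.err ω + S.cdfError ω := by
  rw [S.X_eq, add_mulVec, ← mulVec_mulVec, mulVec_sub]
  ext i
  have e1 : (S.Fmat ω *ᵥ M.gammaH) i = M.gammaH ⬝ᵥ S.f i ω := dotProduct_comm _ _
  have e2 : (S.Umat ω *ᵥ M.betaH) i = M.betaH ⬝ᵥ S.u i ω := dotProduct_comm _ _
  simp only [Pi.sub_apply, Pi.add_apply, e1, e2, err, cdfError, residual, triple, Yvec]
  ring

/-- The lower bound on the tuning parameter, in units of `√(log p / n)`. -/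
def tuningConst (K : ℕ) (c₀ τ Υ κ D : ℝ) : ℝ :=
  1000 * designConst K c₀ τ Υ κ ^ 9 * (Real.sqrt D + 2)

namespace Regular

variable (R : M.Regular c₀ τ Υ κ) (hc₀ : 0 < c₀) (hτ : 1 < τ) (hΥ : 0 < Υ) (hκ₀ : 0 < κ)
  (hκ₁ : κ < 1)
include R hc₀ hτ hΥ hκ₀ hκ₁

theorem lasso_error_bound_of_good {D r reg : ℝ} {d s : ℕ} {ω : Ω}
    (G : S.Good (psiScale c₀ τ κ) κ (32 * psiScale c₀ τ κ ^ 2 * r) (1 / (2 * (K + 1)))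
      (4 * p * Real.log p) d ω) (hn : 0 < n) (hp : 2 ≤ p) (hlog : 1 ≤ Real.log p) (hr : 0 ≤ r)
    (hnr : n * r ^ 2 = Real.log p) (hs : s = l0Norm M.betaH)
    (hsmall : 6 * designConst K c₀ τ Υ κ ^ 4 * Real.sqrt (1 / p + r ^ 2) ≤ 1) (hD : 0 ≤ D)
    (hnp : (n : ℝ) * max 1 (s : ℝ) ≤ D * ((p : ℝ) ^ 2 * Real.log p))
    (hmr : max 1 (s : ℝ) * r ^ 2 ≤ 1) (hd : 2 ≤ d)
    (hds : 128 * psiScale c₀ τ κ ^ 2 * s ≤ κ * (d - 1))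
    (hhs : 60 * designConst K c₀ τ Υ κ ^ 4 * Real.sqrt (1 / p + r ^ 2) * Real.sqrt s ≤
      Real.sqrt κ / 4) (hreg0 : 0 < reg) (hreg : tuningConst K c₀ τ Υ κ D * r ≤ reg)
    {Fh : Matrix (Fin n) (Fin K) ℝ} {Bh : Matrix (Fin p) (Fin K) ℝ} {bh : Fin p → ℝ}
    (hF : IsFactorEstimate (S.X ω) Fh Bh)
    (hL : IsLassoEstimate reg (S.X ω) (S.Yvec ω) Fh Bh bh) :
    l2Norm (bh - M.betaH) ≤ 48 / κ * (reg * Real.sqrt s) ∧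
      l1Norm (bh - M.betaH) ≤ 192 / κ * (reg * s) := by
  have hn0 : (0 : ℝ) < n := by exact_mod_cast hn
  have hp0 : (0 : ℝ) < p := by exact_mod_cast (by linarith : 0 < p)
  have hx₀ : (1 : ℝ) / (2 * (K + 1)) * K ≤ 1 / 2 := by
    rw [div_mul_eq_mul_div, div_le_div_iff₀ (by positivity) two_pos]
    linarith
  have W := R.factorDesign S hc₀ hτ hΥ hκ₀ G hp hx₀ (by positivity) hr (by rw [hnr]) hsmall
  obtain ⟨b1, b2, b3⟩ := designConst_bounds (c₀ := c₀) (K := K) hτ hΥ hκ₀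
  have hγ := R.l2Norm_gammaH_le
  have hBβ := R.l2Norm_transpose_B_mulVec_betaH_le hΥ hκ₀ hκ₁
  rw [← hs] at hBβ
  set c := psiScale c₀ τ κ with hc
  set C := designConst K c₀ τ Υ κ with hC
  set h := Real.sqrt (1 / p + r ^ 2) with hh
  have hh2 : h ^ 2 = 1 / p + r ^ 2 := Real.sq_sqrt (by positivity)
  have hh0 : 0 ≤ h := Real.sqrt_nonneg _
  have hC1 := W.one_le
  set m : ℝ := max 1 (s : ℝ) with hm
  have hm1 : 1 ≤ m := le_max_left _ _
  have hsm : Real.sqrt s ≤ Real.sqrt m := Real.sqrt_le_sqrt (le_max_right _ _)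
  have hm1' : 1 ≤ Real.sqrt m := Real.one_le_sqrt.2 hm1
  have hK0 := Real.sqrt_nonneg (K : ℝ)
  have hΥκ : 0 < Υ / κ := by positivity
  have hφ : l2Norm (M.gammaH - M.Bᵀ *ᵥ M.betaH) ≤ C * Real.sqrt m := by
    refine (l2Norm_sub_le _ _).trans ?_
    have h1 : Real.sqrt K * (Υ / κ * Real.sqrt s) ≤ Real.sqrt K * (Υ / κ * Real.sqrt m) := by
      gcongr
    have h2 : 0 ≤ Real.sqrt K * (Υ + 32 * c ^ 2) := by positivity
    have h3 : (1 + Real.sqrt K * (Υ / κ)) * Real.sqrt m ≤ C * Real.sqrt m :=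
      mul_le_mul_of_nonneg_right (by linarith) (by linarith)
    linarith
  have hδ : l2Norm (S.cdfError ω) ≤ C * (Real.sqrt n * r) := by
    -- (nr)² = n log p ≥ 1, so the discretisation error 1/n is absorbed in r.
    have h1 : 1 / (n : ℝ) ≤ r := by
      rw [div_le_iff₀ hn0]
      refine (pow_le_pow_iff_left₀ zero_le_one (by positivity) two_ne_zero).1 ?_
      have h2 : (1 : ℝ) ≤ n := by exact_mod_cast hn
      have h3 : (r * n) ^ 2 = n * (n * r ^ 2) := by ring
      rw [h3, hnr, one_pow]
      exact one_le_mul_of_one_le_of_one_le h2 hlog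
    refine (l2Norm_le_of_forall (c := C * r) (by positivity) fun i => ?_).trans_eq (by ring)
    refine (S.abs_empCDF_sub_le hn G.cdf i).trans ?_
    have := mul_le_mul_of_nonneg_right b2 hr
    linarith
  have hF' := hF
  rw [S.X_eq] at hF'
  have hres : S.X ω - Fh * Bhᵀ = projOff Fh * (S.Fmat ω * M.Bᵀ + S.Umat ω) := by
    rw [hF.residual hn, S.X_eq]; rfl
  have hscore := W.score_le hn (by linarith) hF' hm1' hφ hδ
  have hy : projResponse Fh (S.Yvec ω) -
      (projOff Fh * (S.Fmat ω * M.Bᵀ + S.Umat ω)) *ᵥ M.betaH =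
      projOff Fh *ᵥ (S.Fmat ω *ᵥ (M.gammaH - M.Bᵀ *ᵥ M.betaH) + S.err ω + S.cdfError ω) := by
    rw [← S.response_sub, ← S.X_eq, mulVec_sub, mulVec_mulVec]; rfl
  have hrate := rate_le hn0 hp0 (by linarith : 0 ≤ m) hr hD (by rw [hnr]; exact hnp) hmr
  rw [IsLassoEstimate, hres] at hL
  have hmain := lasso_error_bound (b := M.betaH) (c := κ / 16) hreg0 (by positivity) hL
    (fun j => ?_) (fun v hv => ?_)
  · rw [← hs] at hmain
    refine ⟨hmain.1.trans_eq ?_, hmain.2.trans_eq ?_⟩ <;> (congr 1; field_simp; norm_num)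
  · rw [hy, abs_mul, abs_of_pos (inv_pos.2 hn0), inv_mul_le_iff₀ hn0]
    refine (hscore j).trans ?_
    -- `rate_le` gives √D + 1 and the score adds one more r. Then 500(√D + 2)C⁹ is half of
    -- `tuningConst`, which gives λ/2.
    have h1 : h ^ 2 * Real.sqrt m + r ≤ (Real.sqrt D + 2) * r := by
      rw [hh2]; linarith
    have h2 : 500 * C ^ 9 * (n * (h ^ 2 * Real.sqrt m + r)) ≤
        500 * C ^ 9 * (n * ((Real.sqrt D + 2) * r)) := by gcongr
    have h3 : n * (tuningConst K c₀ τ Υ κ D * r) ≤ n * reg :=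
      mul_le_mul_of_nonneg_left hreg hn0.le
    rw [tuningConst, ← hC] at h3
    linarith
  · rw [← hs] at hv
    have hcol := G.U_col
    have hre := G.re
    push Not at hcol hre
    refine restricted_lower_bound (b := 2 * c ^ 2) (q := 15 * C ^ 4 * h) hd hn hκ₀ (fun j => ?_)
      hre (by positivity) (fun w => ?_) (by positivity) (by linarith) (by linarith) hv
    · rw [l2Norm_sq']
      refine (hcol j).le.trans_eq ?_
      ring
    · have := W.le_l2Norm_residual_mulVec hn (by linarith) hF' w
      linarith

end Regular

end FASIM

end

/-! ### Consequences of the growth conditions and vanishing of the tail bounds. -/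

noncomputable section

open Topology

theorem two_mul_pow_le_exp {p : ℕ} (hp : 2 ≤ p) (d : ℕ) :
    (2 * p : ℝ) ^ d ≤ Real.exp (2 * (d * Real.log p)) := by
  have h0 : (2 : ℝ) ≤ p := by exact_mod_cast hp
  have h1 : (2 * p : ℝ) ≤ (p : ℝ) ^ 2 := by nlinarith
  refine (pow_le_pow_left₀ (by positivity) h1 d).trans_eq ?_
  rw [← pow_mul, ← Real.exp_log (by positivity : (0 : ℝ) < (p : ℝ) ^ (2 * d)), Real.log_pow]
  push_cast
  ring_nf

theorem tendsto_exp_neg_mul_nat {b : ℝ} (hb : 0 < b) :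
    Tendsto (fun n : ℕ => Real.exp (-(n * b))) atTop (𝓝 0) :=
  Real.tendsto_exp_neg_atTop_nhds_zero.comp
    (tendsto_natCast_atTop_atTop.atTop_mul_const hb)

/-- The exponential is p⁻¹⁶, and n ≤ D p³ makes the prefactor polynomial in p. -/
theorem tendsto_poly_mul_exp_log {p : ℕ → ℕ} (hp : Tendsto p atTop atTop) {D : ℝ} (K : ℕ)
    (hn : ∀ᶠ n : ℕ in atTop, (n : ℝ) ≤ D * (p n : ℝ) ^ 3) :
    Tendsto (fun n : ℕ => (4 * p n * K + 2 * p n + 2 * K + 4 * (n + 1)) *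
      Real.exp (-(16 * Real.log (p n)))) atTop (𝓝 0) := by
  have h1 : Tendsto (fun n => (6 * K + 2 + 4 * (D + 1)) * ((p n : ℝ))⁻¹) atTop (𝓝 0) := by
    have := (tendsto_inv_atTop_zero.comp (tendsto_natCast_atTop_atTop.comp hp)).const_mul
      (6 * K + 2 + 4 * (D + 1))
    simpa using this
  refine squeeze_zero' (Eventually.of_forall fun n => by positivity) ?_ h1
  filter_upwards [hn, hp.eventually_ge_atTop 1] with n hn hp
  have hp1 : (1 : ℝ) ≤ p n := by exact_mod_cast hp
  have hp0 : (0 : ℝ) < p n := by linarith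
  have e1 : Real.exp (-(16 * Real.log (p n))) = ((p n : ℝ) ^ 16)⁻¹ := by
    rw [Real.exp_neg, ← Real.exp_log (by positivity : (0 : ℝ) < (p n : ℝ) ^ 16), Real.log_pow]
    norm_num
  rw [e1, ← div_eq_mul_inv, ← div_eq_mul_inv, div_le_div_iff₀ (by positivity) hp0]
  have h13 : (p n : ℝ) ^ 1 ≤ (p n : ℝ) ^ 3 := pow_le_pow_right₀ hp1 (by norm_num)
  have h03 : (1 : ℝ) ≤ (p n : ℝ) ^ 3 := one_le_pow₀ hp1
  have hK : (0 : ℝ) ≤ K := Nat.cast_nonneg K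
  have hD : 0 ≤ D * (p n : ℝ) ^ 3 := (Nat.cast_nonneg n).trans hn
  have hD' : 0 ≤ D := nonneg_of_mul_nonneg_left hD (by positivity)
  have h2 : (4 * p n * K + 2 * p n + 2 * K + 4 * (n + 1) : ℝ) ≤
      (6 * K + 2 + 4 * (D + 1)) * (p n : ℝ) ^ 3 := by
    rw [pow_one] at h13
    have a1 := mul_le_mul_of_nonneg_right h13 hK
    have a2 := mul_le_mul_of_nonneg_right h03 hK
    linarith
  calc _ ≤ (6 * K + 2 + 4 * (D + 1)) * (p n : ℝ) ^ 3 * p n := by gcongr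
    _ = (6 * K + 2 + 4 * (D + 1)) * (p n : ℝ) ^ 4 := by ring
    _ ≤ _ := by
      gcongr
      norm_num

theorem tendsto_pow_mul_exp_neg {p d : ℕ → ℕ} (hp : ∀ᶠ n in atTop, 2 ≤ p n) {b : ℝ} (hb : 0 < b)
    (hd : Tendsto (fun n : ℕ => d n * Real.log (p n) / n) atTop (𝓝 0)) :
    Tendsto (fun n : ℕ => (2 * p n : ℝ) ^ d n * Real.exp (-(n * b))) atTop (𝓝 0) := by
  refine squeeze_zero' (Eventually.of_forall fun n => by positivity) ?_
    (tendsto_exp_neg_mul_nat (half_pos hb))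
  filter_upwards [hp, hd.eventually_le_const (by positivity : 0 < b / 4), eventually_gt_atTop 0]
    with n hp hd hn
  have hn0 : (0 : ℝ) < n := by exact_mod_cast hn
  rw [div_le_iff₀ hn0] at hd
  refine (mul_le_mul_of_nonneg_right (two_mul_pow_le_exp hp _) (Real.exp_nonneg _)).trans ?_
  rw [← Real.exp_add]
  exact Real.exp_le_exp.2 (by linarith)

theorem tendsto_self_pow_mul_exp_neg {p : ℕ → ℕ} (hp : Tendsto p atTop atTop) :
    Tendsto (fun n => (2 * p n : ℝ) ^ p n * Real.exp (-(4 * p n * Real.log (p n)))) atTop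
      (𝓝 0) := by
  refine squeeze_zero' (Eventually.of_forall fun n => by positivity) ?_
    ((tendsto_exp_neg_mul_nat one_pos).comp hp)
  filter_upwards [hp.eventually_ge_atTop 3] with n hp
  refine (mul_le_mul_of_nonneg_right (two_mul_pow_le_exp (by linarith) _)
    (Real.exp_nonneg _)).trans ?_
  rw [← Real.exp_add]
  have hp0 : (3 : ℝ) ≤ p n := by exact_mod_cast hp
  have h1 : 1 ≤ Real.log (p n) := by
    rw [Real.le_log_iff_exp_le (by linarith)]
    linarith [Real.exp_one_lt_d9]
  refine Real.exp_le_exp.2 ?_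
  have := mul_le_mul_of_nonneg_left h1 (by linarith : (0 : ℝ) ≤ p n)
  linarith

theorem tendsto_add_one_mul_exp_neg {p : ℕ → ℕ} (hp : ∀ᶠ n in atTop, 2 ≤ p n)
    (hL : Tendsto (fun n : ℕ => Real.log (p n) / n) atTop (𝓝 0)) :
    Tendsto (fun n : ℕ => (p n + 1 : ℝ) * Real.exp (-n)) atTop (𝓝 0) := by
  have h1 := tendsto_pow_mul_exp_neg (d := fun _ => 1) hp one_pos (by simpa using hL)
  refine squeeze_zero' (Eventually.of_forall fun n => by positivity) ?_ h1
  filter_upwards [hp] with n hp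
  have hp0 : (2 : ℝ) ≤ p n := by exact_mod_cast hp
  rw [mul_one, pow_one]
  gcongr
  linarith

/-- The consequences of the growth conditions on dimension and sparsity. -/
theorem growth_conditions {p s : ℕ → ℕ} {D : ℝ}
    (hL : (fun n => Real.log (p n)) =o[atTop] (fun n : ℕ => (n : ℝ)))
    (hs : (fun n => (s n : ℝ)) =o[atTop] (fun n : ℕ => (n : ℝ) / Real.log (p n)))
    (hD : ∀ᶠ n : ℕ in atTop,
      (n : ℝ) * max 1 (s n : ℝ) ≤ D * ((p n : ℝ) ^ 2 * Real.log (p n))) :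
    0 < D ∧ Tendsto p atTop atTop ∧ (∀ᶠ n : ℕ in atTop, (n : ℝ) ≤ D * (p n : ℝ) ^ 3) ∧
    Tendsto (fun n : ℕ => max 1 (s n : ℝ) * (Real.log (p n) / n)) atTop (𝓝 0) ∧
    Tendsto (fun n : ℕ => max 1 (s n : ℝ) * (1 / p n + Real.log (p n) / n)) atTop (𝓝 0) := by
  have hlog0 : ∀ n, 0 ≤ Real.log (p n) := fun n => Real.log_natCast_nonneg _
  have hm : ∀ n, 1 ≤ max 1 (s n : ℝ) := fun n => le_max_left _ _
  have hDpos : 0 < D := by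
    obtain ⟨n, hn, hn0⟩ := (hD.and (eventually_gt_atTop 0)).exists
    have hn0' : (0 : ℝ) < n := by exact_mod_cast hn0
    have h1 : 0 < D * ((p n : ℝ) ^ 2 * Real.log (p n)) :=
      lt_of_lt_of_le (mul_pos hn0' (by linarith [hm n])) hn
    exact pos_of_mul_pos_left h1 (mul_nonneg (sq_nonneg _) (hlog0 n))
  have hn3 : ∀ᶠ n : ℕ in atTop, (n : ℝ) ≤ D * (p n : ℝ) ^ 3 := by
    filter_upwards [hD] with n hn
    have h1 : (n : ℝ) ≤ n * max 1 (s n : ℝ) := le_mul_of_one_le_right (Nat.cast_nonneg n) (hm n)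
    have h2 : Real.log (p n) ≤ p n := Real.log_le_self (Nat.cast_nonneg _)
    calc (n : ℝ) ≤ D * ((p n : ℝ) ^ 2 * Real.log (p n)) := h1.trans hn
      _ ≤ D * ((p n : ℝ) ^ 2 * p n) := by gcongr
      _ = _ := by ring
  -- Divergence of p is forced: n ≤ D p³.
  have hp : Tendsto p atTop atTop := by
    have h1 : Tendsto (fun n => D * (p n : ℝ) ^ 3) atTop atTop :=
      tendsto_atTop_mono' _ hn3 tendsto_natCast_atTop_atTop
    refine tendsto_atTop.2 fun b => ?_
    filter_upwards [h1.eventually_gt_atTop (D * (b : ℝ) ^ 3)] with n hn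
    have h2 : (b : ℝ) ^ 3 < (p n : ℝ) ^ 3 := lt_of_mul_lt_mul_left hn hDpos.le
    have h3 : b ^ 3 < p n ^ 3 := by exact_mod_cast h2
    exact (lt_of_pow_lt_pow_left₀ 3 (Nat.zero_le _) h3).le
  have ha : Tendsto (fun n : ℕ => max 1 (s n : ℝ) * (Real.log (p n) / n)) atTop (𝓝 0) := by
    have h1 := hL.tendsto_div_nhds_zero
    have h2 := hs.tendsto_div_nhds_zero
    have h3 := h1.add h2
    rw [add_zero] at h3
    refine squeeze_zero (fun n => mul_nonneg (by linarith [hm n])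
      (div_nonneg (hlog0 n) (Nat.cast_nonneg n))) (fun n => ?_) h3
    have h4 : 0 ≤ Real.log (p n) / n := div_nonneg (hlog0 n) (Nat.cast_nonneg n)
    have h5 : (s n : ℝ) / (n / Real.log (p n)) = s n * (Real.log (p n) / n) := by
      rw [div_div_eq_mul_div, mul_div_assoc]
    have h6 : max 1 (s n : ℝ) ≤ 1 + s n :=
      max_le (by linarith [Nat.cast_nonneg (α := ℝ) (s n)]) (by linarith)
    rw [h5]
    nlinarith
  refine ⟨hDpos, hp, hn3, ha, ?_⟩
  have hb : Tendsto (fun n : ℕ => max 1 (s n : ℝ) * (1 / p n)) atTop (𝓝 0) := by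
    have h1 : Tendsto (fun n : ℕ => Real.sqrt (D * (max 1 (s n : ℝ) * (Real.log (p n) / n))))
        atTop (𝓝 0) := by
      have := (ha.const_mul D).sqrt
      simpa using this
    refine squeeze_zero' (Eventually.of_forall fun n => by
      have := hm n
      positivity) ?_ h1
    filter_upwards [hD, eventually_gt_atTop 0, hp.eventually_gt_atTop 0] with n hn hn0 hp0
    have hn0' : (0 : ℝ) < n := by exact_mod_cast hn0
    have hp0' : (0 : ℝ) < p n := by exact_mod_cast hp0
    refine Real.le_sqrt_of_sq_le ?_
    -- Multiplying n m ≤ D p² log p by m gives (m/p)² ≤ D m log p/n, which tends to zero.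
    rw [mul_pow, one_div, inv_pow, ← div_eq_mul_inv, div_le_iff₀ (by positivity), sq (max 1 _)]
    have h2 := mul_le_mul_of_nonneg_left hn (by linarith [hm n] : 0 ≤ max 1 (s n : ℝ))
    refine le_of_mul_le_mul_left (le_trans (le_of_eq ?_) (h2.trans_eq ?_)) hn0'
    · ring
    · field_simp
  have := hb.add ha
  rw [add_zero] at this
  exact this.congr fun n => by ring

end

/-! ### Conclusion: from the good event to stochastic boundedness. -/

noncomputable section

open Topology

/-- Since the exceptional probability tends to zero, one constant C serves every δ. -/
theorem IsBigOP.of_forall_subset {Ω : ℕ → Type*} [∀ n, MeasurableSpace (Ω n)]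
    {P : ∀ n, Measure (Ω n)} [∀ n, IsProbabilityMeasure (P n)] {R : ∀ n, Ω n → ℝ} {b : ℕ → ℝ}
    {A : ∀ n, Set (Ω n)} {C : ℝ} (hC : 0 < C)
    (hA : Tendsto (fun n => (P n).real (A n)) atTop (𝓝 0))
    (h : ∀ᶠ n in atTop, ∀ ω, ω ∉ A n → |R n ω| ≤ C * b n) : IsBigOP P R b := by
  intro δ hδ
  refine ⟨C, hC, ?_⟩
  filter_upwards [h, hA.eventually_le_const hδ] with n hn hδn
  calc P n {ω | C * b n < |R n ω|} ≤ P n (A n) :=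
        measure_mono fun ω hω => by
          by_contra hcon
          exact absurd (hn ω hcon) (not_le.2 hω)
    _ = ENNReal.ofReal ((P n).real (A n)) := (ofReal_measureReal (measure_ne_top _ _)).symm
    _ ≤ _ := ENNReal.ofReal_le_ofReal hδn

/-- The number of terms of the signed sums on which the restricted eigenvalue is controlled. -/
def signedSumLength (A m : ℝ) : ℕ := ⌈A * m⌉₊ + 2

theorem signedSumLength_bounds {A m : ℝ} (hA : 0 ≤ A) (hm : 1 ≤ m) :
    A * m + 1 ≤ signedSumLength A m - 1 ∧ (signedSumLength A m : ℝ) ≤ (A + 3) * m := by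
  have h1 := Nat.le_ceil (A * m)
  have h2 := Nat.ceil_lt_add_one (by positivity : 0 ≤ A * m)
  unfold signedSumLength
  push_cast
  constructor <;> linarith

namespace FASIM

theorem tendsto_measure_not_good {K : ℕ} {c₀ τ Υ κ D : ℝ} (hc₀ : 0 < c₀) (hτ : 1 < τ)
    (hκ₀ : 0 < κ) (hκ₁ : κ < 1) {p : ℕ → ℕ} {Ω : ℕ → Type*} [∀ n, MeasurableSpace (Ω n)]
    {P : ∀ n, Measure (Ω n)} [∀ n, IsProbabilityMeasure (P n)] {M : ∀ n, FASIM K (p n) (P n)}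
    (S : ∀ n, (M n).Sample n) (R : ∀ n, (M n).Regular c₀ τ Υ κ) (hp : Tendsto p atTop atTop)
    (hnp : ∀ᶠ n : ℕ in atTop, (n : ℝ) ≤ D * (p n : ℝ) ^ 3) {d : ℕ → ℕ}
    (hL : Tendsto (fun n : ℕ => Real.log (p n) / n) atTop (𝓝 0))
    (hd : Tendsto (fun n : ℕ => d n * Real.log (p n) / n) atTop (𝓝 0)) :
    Tendsto (fun n => (P n).real {ω | ¬ (S n).Good (psiScale c₀ τ κ) κ
      (32 * psiScale c₀ τ κ ^ 2 * Real.sqrt (Real.log (p n) / n)) (1 / (2 * (K + 1)))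
      (4 * p n * Real.log (p n)) (d n) ω}) atTop (𝓝 0) := by
  have hp2 := hp.eventually_ge_atTop 2
  have hsc := Regular.psiScale_pos hc₀ hτ hκ₀
  have hc : 0 < 64 * (psiScale c₀ τ κ ^ 2) ^ 2 := by
    have : 0 < psiScale c₀ τ κ := by linarith
    positivity
  have h1 := tendsto_poly_mul_exp_log hp K hnp
  have h2 := tendsto_add_one_mul_exp_neg hp2 hL
  have h3 := ((tendsto_exp_neg_mul_nat
    (by positivity : 0 < (1 / (2 * ((K : ℝ) + 1))) ^ 2 / (64 * (psiScale c₀ τ κ ^ 2) ^ 2))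
      ).const_mul 2).const_mul ((K : ℝ) ^ 2)
  have h4 := tendsto_self_pow_mul_exp_neg hp
  have h5 := (tendsto_pow_mul_exp_neg hp2
    (by positivity : 0 < (κ / 2) ^ 2 / (64 * (psiScale c₀ τ κ ^ 2) ^ 2)) hd).mul_const 2
  have h := (((h1.add h2).add h3).add h4).add h5
  simp only [mul_zero, zero_mul, add_zero] at h
  refine squeeze_zero' (Eventually.of_forall fun n => measureReal_nonneg) ?_ h
  filter_upwards [hp2, eventually_gt_atTop 0,
    hL.eventually_le_const (by norm_num : (0 : ℝ) < 1 / 4)] with n hp2 hn hL4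
  have hn0 : (0 : ℝ) < n := by exact_mod_cast hn
  have hr0 : 0 ≤ Real.log (p n) / n := div_nonneg (Real.log_natCast_nonneg _) hn0.le
  refine ((R n).measure_not_good_le (S n) hc₀ hτ hκ₀ hκ₁ hp2 (Real.sqrt_nonneg _) ?_ ?_
    (d n)).trans_eq ?_
  · rw [Real.sqrt_le_left (by norm_num)]
    linarith
  · rw [Real.sq_sqrt hr0]
    field_simp
  · simp only [mul_div_assoc]
    ring

end FASIM

end

theorem theorem4 (K : ℕ) (c₀ τ Υ κ D : ℝ) (hc₀ : 0 < c₀) (hτ : 1 < τ) (hΥ : 0 < Υ)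
    (hκ₀ : 0 < κ) (hκ₁ : κ < 1) :
    ∃ C₀ : ℝ, 0 < C₀ ∧
    ∀ (p : ℕ → ℕ) (Ω : ℕ → Type*) [∀ n, MeasurableSpace (Ω n)] (P : ∀ n, Measure (Ω n))
      [∀ n, IsProbabilityMeasure (P n)]
      (M : ∀ n, FASIM K (p n) (P n)) (S : ∀ n, (M n).Sample n)
      -- regularity of the model, with constants that do not depend on `n`; linearity condition
      (_ : ∀ n, (M n).Regular c₀ τ Υ κ)
      (_ : ∀ n, (M n).LinearityCondition)
      -- pilot estimators
      (lam : ℕ → Fin K → ℝ) (G : ∀ n, Matrix (Fin (p n)) (Fin K) ℝ)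
      (Sh : ∀ n, Ω n → Matrix (Fin (p n)) (Fin (p n)) ℝ)
      (lamh : ∀ n, Ω n → Fin K → ℝ)
      (Gh : ∀ n, Ω n → Matrix (Fin (p n)) (Fin K) ℝ)
      (_ : PilotRates P M lam G Sh lamh Gh)
      -- dimension and sparsity
      (s : ℕ → ℕ) (_ : ∀ n, s n = l0Norm (M n).betaH)
      (_ : (fun n => Real.log (p n)) =o[atTop] (fun n : ℕ => (n : ℝ)))
      (_ : (fun n => (s n : ℝ)) =o[atTop] (fun n : ℕ => (n : ℝ) / Real.log (p n)))
      (_ : ∀ᶠ n : ℕ in atTop,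
        (n : ℝ) * max 1 (s n : ℝ) ≤ D * ((p n : ℝ) ^ 2 * Real.log (p n)))
      -- tuning parameter
      (reg : ℕ → ℝ) (C₁ : ℝ)
      (_ : ∀ᶠ n : ℕ in atTop, C₀ * Real.sqrt (Real.log (p n) / n) ≤ reg n ∧
        reg n ≤ C₁ * Real.sqrt (Real.log (p n) / n))
      -- estimated factors and loadings, Lasso estimate
      (Fh : ∀ n, Ω n → Matrix (Fin n) (Fin K) ℝ)
      (Bh : ∀ n, Ω n → Matrix (Fin (p n)) (Fin K) ℝ)
      (betah : ∀ n, Ω n → Fin (p n) → ℝ)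
      (_ : ∀ᶠ n in atTop, ∀ ω, IsFactorEstimate ((S n).X ω) (Fh n ω) (Bh n ω))
      (_ : ∀ᶠ n in atTop, ∀ ω, IsLassoEstimate (reg n) ((S n).X ω) ((S n).Yvec ω)
        (Fh n ω) (Bh n ω) (betah n ω)),
      IsBigOP P (fun n ω => l2Norm (betah n ω - (M n).betaH))
        (fun n => reg n * Real.sqrt (s n)) ∧
      IsBigOP P (fun n ω => l1Norm (betah n ω - (M n).betaH))
        (fun n => reg n * s n) := by
  obtain ⟨b1, -, -⟩ := FASIM.Regular.designConst_bounds (K := K) (c₀ := c₀) hτ hΥ hκ₀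
  set C := FASIM.designConst K c₀ τ Υ κ with hC
  have hC1 : 1 ≤ C := by linarith
  refine ⟨FASIM.tuningConst K c₀ τ Υ κ D, by rw [FASIM.tuningConst, ← hC]; positivity, ?_⟩
  intro p Ω _ P _ M S R _ lam G Sh lamh Gh _ s hs hL hsL hD reg C₁ hreg Fh Bh betah hF hB
  obtain ⟨hDpos, hp, hn3, ha, hw⟩ := growth_conditions hL hsL hD
  have hm : ∀ n, 1 ≤ max 1 (s n : ℝ) := fun n => le_max_left _ _
  have hsc := FASIM.Regular.psiScale_pos hc₀ hτ hκ₀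
  set c := FASIM.psiScale c₀ τ κ with hc
  -- Chosen so that κ(d − 1) ≥ 128c²m, the length required by the restricted eigenvalue; still d ≤
  -- (A + 3)m, so d log p = o(n).
  set A := 128 * c ^ 2 / κ with hA
  have hA0 : 0 ≤ A := by positivity
  have hlen := fun n => signedSumLength_bounds hA0 (hm n)
  set d : ℕ → ℕ := fun n => signedSumLength A (max 1 (s n : ℝ)) with hd
  have hr0 : ∀ n : ℕ, 0 ≤ Real.log (p n) / n := fun n =>
    div_nonneg (Real.log_natCast_nonneg _) (Nat.cast_nonneg n)
  have hdL : Tendsto (fun n : ℕ => d n * Real.log (p n) / n) atTop (nhds 0) := by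
    have h1 := ha.const_mul (A + 3)
    rw [mul_zero] at h1
    refine squeeze_zero (fun n => ?_) (fun n => ?_) h1
    · rw [mul_div_assoc]
      exact mul_nonneg (Nat.cast_nonneg _) (hr0 n)
    · rw [mul_div_assoc, ← mul_assoc]
      exact mul_le_mul_of_nonneg_right (hlen n).2 (hr0 n)
  have hgood := FASIM.tendsto_measure_not_good hc₀ hτ hκ₀ hκ₁ S R hp hn3
    hL.tendsto_div_nhds_zero hdL
  have hw2 := hw.sqrt
  rw [Real.sqrt_zero] at hw2
  have hbound : ∀ᶠ n in atTop, ∀ ω, ω ∉ {ω | ¬ (S n).Good c κ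
      (32 * c ^ 2 * Real.sqrt (Real.log (p n) / n)) (1 / (2 * (K + 1)))
      (4 * p n * Real.log (p n)) (d n) ω} →
      l2Norm (betah n ω - (M n).betaH) ≤ 48 / κ * (reg n * Real.sqrt (s n)) ∧
      l1Norm (betah n ω - (M n).betaH) ≤ 192 / κ * (reg n * s n) := by
    filter_upwards [hF, hB, hD, hreg, hp.eventually_ge_atTop 3, eventually_gt_atTop 0,
      ha.eventually_le_const one_pos,
      -- √m h → 0 supplies both smallness conditions: the one on h alone because m ≥ 1, the one on
      -- √s h because s ≤ m.
      hw2.eventually_le_const (by positivity : 0 < 1 / (6 * C ^ 4)),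
      hw2.eventually_le_const (by positivity : 0 < Real.sqrt κ / 4 / (60 * C ^ 4))]
      with n hF hB hD hreg hp hn ha hw6 hw60 ω hω
    have hn0 : (0 : ℝ) < n := by exact_mod_cast hn
    have hp0 : (3 : ℝ) ≤ p n := by exact_mod_cast hp
    have hlog : 1 ≤ Real.log (p n) := by
      rw [Real.le_log_iff_exp_le (by linarith)]
      linarith [Real.exp_one_lt_d9]
    have hr2 : Real.sqrt (Real.log (p n) / n) ^ 2 = Real.log (p n) / n := Real.sq_sqrt (hr0 n)
    have hrpos : 0 < Real.sqrt (Real.log (p n) / n) :=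
      Real.sqrt_pos.2 (div_pos (by linarith) hn0)
    have hq0 : 0 ≤ 1 / (p n : ℝ) + Real.log (p n) / n := add_nonneg (by positivity) (hr0 n)
    have hT : 0 < FASIM.tuningConst K c₀ τ Υ κ D := by rw [FASIM.tuningConst, ← hC]; positivity
    have hd2 : 2 ≤ d n := by simp only [hd, signedSumLength]; omega
    rw [Real.sqrt_mul (by linarith [hm n]), mul_comm] at hw6 hw60
    have hs0 : Real.sqrt (s n) ≤ Real.sqrt (max 1 (s n : ℝ)) :=
      Real.sqrt_le_sqrt (le_max_right _ _)
    have hm1 : 1 ≤ Real.sqrt (max 1 (s n : ℝ)) := Real.one_le_sqrt.2 (hm n)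
    refine (R n).lasso_error_bound_of_good (S n) hc₀ hτ hΥ hκ₀ hκ₁ (D := D) (not_not.1 hω) hn
      (by linarith) hlog hrpos.le (by rw [hr2]; field_simp) (hs n) ?_ hDpos.le hD
      (by rw [hr2]; exact ha) hd2 ?_ ?_ ((mul_pos hT hrpos).trans_le hreg.1) hreg.1 (hF ω) (hB ω)
    · rw [hr2, ← hC, mul_comm, ← le_div_iff₀ (by positivity)]
      exact (le_mul_of_one_le_right (Real.sqrt_nonneg _) hm1).trans hw6
    · have h1 := mul_le_mul_of_nonneg_left (hlen n).1 hκ₀.le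
      have h2 : κ * (A * max 1 (s n : ℝ) + 1) = 128 * c ^ 2 * max 1 (s n : ℝ) + κ := by
        rw [hA]; field_simp
      have h3 : 128 * c ^ 2 * (s n : ℝ) ≤ 128 * c ^ 2 * max 1 (s n : ℝ) := by
        gcongr
        exact le_max_right _ _
      linarith
    · rw [hr2, ← hC, mul_assoc, mul_comm, ← le_div_iff₀ (by positivity)]
      exact (mul_le_mul_of_nonneg_left hs0 (Real.sqrt_nonneg _)).trans hw60
  refine ⟨IsBigOP.of_forall_subset (by positivity : 0 < 48 / κ) hgood ?_,
    IsBigOP.of_forall_subset (by positivity : 0 < 192 / κ) hgood ?_⟩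
  · filter_upwards [hbound] with n hn ω hω
    rw [abs_of_nonneg (l2Norm_nonneg _)]
    exact (hn ω hω).1
  · filter_upwards [hbound] with n hn ω hω
    rw [abs_of_nonneg (l1Norm_nonneg _)]
    exact (hn ω hω).2
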